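/- **Setting.** Formulas are relational and many-sorted: every variable $v$ has a sort $s(v)$, every relation symbol $R$ has an arity $\mathrm{ar}(R)$, which is a word of sorts, and an atom is $R(v_1,\dots,v_m)$ with $s(v_1)\cdots s(v_m)=\mathrm{ar}(R)$. A *qc-formula* is built from atoms by conjunctions of arbitrary finite arity and the quantifiers $\forall,\exists$; a *qc-sentence* is a qc-formula without free variables. A *QCSP instance* is a pair $(\phi,\mathbf B)$ where $\phi$ is a qc-sentence and $\mathbf B$ is a finite structure over the same signature, with a (possibly empty) universe $B_s$ for each sort $s$ and relations $R^{\mathbf B}\subseteq B_{s_1}\times\cdots\times B_{s_m}$ for $\mathrm{ar}(R)=s_1\cdots s_m$. A mapping $f:V\to B$ on a set $V$ of variables sends each $v\in V$ to an element of $B_{s(v)}$. View $\phi$ as a tree and let $I_\phi$ be the set of its nodes (subformula occurrences); $\phi(i)$ is the subformula at the node $i$. A *judgement* is a triple $(i,V,F)$ where $i\in I_\phi$, $V\subseteq\mathrm{free}(\phi(i))$ and $F$ is a set of mappings $V\to B$; its width is $|V|$, and it is *empty* if $F=\emptyset$. A *judgement proof* is a finite sequence of judgements, each of which has one of the following types: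 - (atom) $(i,\{v_1,\dots,v_m\},F)$ where $\phi(i)$ is an atom $R(v_1,\dots,v_m)$ and $F=\{f:\{v_1,\dots,v_m\}\to B \mid (f(v_1),\dots,f(v_m))\in R^{\mathbf B}\}$; - (projection) $(i,U,\{f{\upharpoonright}U\mid f\in F\})$ where $(i,V,F)$ is a previous judgement and $U\subseteq V$; - (join) $(i,U_1\cup U_2,F)$ where $(i,U_1,F_1)$ and $(i,U_2,F_2)$ are previous judgements and $F=\{f:U_1\cup U_2\to B\mid f{\upharpoonright}U_1\in F_1,\ f{\upharpoonright}U_2\in F_2\}$; - (upward flow) $(i,V,F)$ where $(j,V,F)$ is a previous judgement and $i$ is the parent of $j$; - ($\forall$-elimination) $(i,V\setminus\{y\},F')$ where $(j,V,F)$ is a previous judgement with $y\in V$, $i$ is the parent of $j$, $\phi(i)=\forall y\,\phi(j)$, and $F'=\{f:V\setminus\{y\}\to B\mid f[y\to b]\in F \text{ for all } b\in B_{s(y)}\}$; - (downward flow) $(j,V,F)$ where $(i,V,F)$ is a previous judgement and $i$ is the parent of $j$. In each case the new triple must itself be a judgement, that is, its variables must be free in the subformula at its node. For $k\ge 1$,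 the instance $(\phi,\mathbf B)$ is *$k$-judge-consistent* if no judgement proof all of whose judgements have width at most $k$ contains an empty judgement. **Theorem.** For each $k\ge 1$ there is a polynomial-time algorithm that, given a QCSP instance $(\phi,\mathbf B)$, decides whether the instance is $k$-judge-consistent. Here the instance is given as a string over a finite alphabet: $\phi$ is written out as a formula, the universes and relations of $\mathbf B$ are written out as lists of their elements and tuples, and the names of sorts, variables, relation symbols and elements are numbers in binary. Polynomial time means that a (multi-stack) Turing machine, which may depend on $k$, halts with the right answer after a number of steps bounded by a polynomial in the length of this string, where the polynomial may depend on $k$. -/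

import Mathlib

namespace QCSP

/-! Sorts, relation symbols, names of variables and elements of universes are natural numbers. -/

/-- A variable carries its sort; variables with different sorts are different variables. -/
@[ext] structure Var where
  name : ℕ
  sort : ℕ

instance : DecidableEq Var := fun x y =>
  decidable_of_iff (x.name = y.name ∧ x.sort = y.sort) Var.ext_iff.symm

/-- Quantified-conjunctive formulas. Conjunctions have arbitrary finite arity; the conjunction of
arity `0` is the sentence that is always true. -/
inductive QCFormula : Type
  | atom (R : ℕ) (vs : List Var) : QCFormula
  | conj (n : ℕ) (ψ : Fin n → QCFormula) : QCFormula
  | all (y : Var) (ψ : QCFormula) : QCFormula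
  | ex (x : Var) (ψ : QCFormula) : QCFormula

namespace QCFormula

/-- The set of free variables. -/
def free : QCFormula → Finset Var
  | atom _ vs => vs.toFinset
  | conj _ ψ => Finset.univ.biUnion fun c => (ψ c).free
  | all y ψ => ψ.free.erase y
  | ex x ψ => ψ.free.erase x

/-- The immediate subformula number `c`, if there is one. -/
def child : QCFormula → ℕ → Option QCFormula
  | atom _ _, _ => none
  | conj n ψ, c => if h : c < n then some (ψ ⟨c, h⟩) else none
  | all _ ψ, c => if c = 0 then some ψ else none
  | ex _ ψ, c => if c = 0 then some ψ else none

/-- The subformula that is reached from the root along a path of child numbers. -/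
def sub : QCFormula → List ℕ → Option QCFormula
  | φ, [] => some φ
  | φ, c :: p => (φ.child c).bind fun ψ => ψ.sub p

/-- The index set `I_φ`: one index for each node of the tree of `φ`, that is, for each
subformula occurrence. An index is the path that leads from the root to the node. -/
def Index (φ : QCFormula) : Type := {p : List ℕ // (φ.sub p).isSome}

/-- The subformula `φ(i)` at the location `i`. -/
def subAt (φ : QCFormula) (i : φ.Index) : QCFormula := (φ.sub i.1).get i.2

/-- `i` is the parent of `j`. -/
def IsParent {φ : QCFormula} (i j : φ.Index) : Prop := ∃ c : ℕ, j.1 = i.1 ++ [c]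

end QCFormula

/-- A sort together with the explicit list of the elements of its universe. -/
structure SortTable where
  sort : ℕ
  elems : List ℕ

/-- A relation symbol together with its arity (a word of sorts) and the explicit list of the
tuples in its interpretation. -/
structure RelTable where
  symbol : ℕ
  arity : List ℕ
  tuples : List (List ℕ)

/-- The data of a finite many-sorted relational structure, given explicitly. -/
structure FinStructure where
  sorts : List SortTable
  rels : List RelTable

namespace FinStructure

/-- The universe `B_s`. It may be empty. -/
def dom (B : FinStructure) (s : ℕ) : Set ℕ :=
  {b | ∃ T ∈ B.sorts, T.sort = s ∧ b ∈ T.elems}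

/-- The interpretation `R^B`. -/
def rel (B : FinStructure) (R : ℕ) : Set (List ℕ) :=
  {t | ∃ T ∈ B.rels, T.symbol = R ∧ t ∈ T.tuples}

/-- `s` is a sort of the signature of `B`. -/
def HasSort (B : FinStructure) (s : ℕ) : Prop := ∃ T ∈ B.sorts, T.sort = s

/-- `R` is a relation symbol of the signature of `B`, and its arity is `w`. -/
def HasArity (B : FinStructure) (R : ℕ) (w : List ℕ) : Prop :=
  ∃ T ∈ B.rels, T.symbol = R ∧ T.arity = w

/-- No sort and no symbol is declared twice, all arities are words over the declared sorts, and
the interpretation of a symbol of arity `w` consists of tuples in the product `B_w`. -/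
structure WellFormed (B : FinStructure) : Prop where
  sorts_nodup : (B.sorts.map SortTable.sort).Nodup
  rels_nodup : (B.rels.map RelTable.symbol).Nodup
  arity_sorts : ∀ T ∈ B.rels, ∀ s ∈ T.arity, B.HasSort s
  tuples_mem : ∀ T ∈ B.rels, ∀ t ∈ T.tuples,
    List.Forall₂ (fun b s => b ∈ B.dom s) t T.arity

end FinStructure

/-- `φ` is a formula over the signature of `B`: every atom `R(v₁, …, vₘ)` satisfies
`s(v₁) ⋯ s(vₘ) = ar(R)`, and quantified variables have declared sorts. -/
def QCFormula.WellSorted (B : FinStructure) : QCFormula → Prop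
  | .atom R vs => B.HasArity R (vs.map Var.sort)
  | .conj _ ψ => ∀ c, (ψ c).WellSorted B
  | .all y ψ => B.HasSort y.sort ∧ ψ.WellSorted B
  | .ex x ψ => B.HasSort x.sort ∧ ψ.WellSorted B

/-- A QCSP instance `(φ, B)`: a qc-sentence and a finite structure over the same signature. -/
structure Instance where
  formula : QCFormula
  struct : FinStructure
  struct_wf : struct.WellFormed
  formula_wf : formula.WellSorted struct
  sentence : formula.free = ∅

/-! ### Judgement proofs -/

/-- Mappings `V → B`: every `v ∈ V` is sent to an element of the universe of its sort. -/
def Mapping (B : FinStructure) (V : Finset Var) : Type :=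
  (v : {v : Var // v ∈ V}) → {b : ℕ // b ∈ B.dom v.1.sort}

namespace Mapping

variable {B : FinStructure}

/-- The restriction of `f` to `U`. -/
def restrict {U V : Finset Var} (h : U ⊆ V) (f : Mapping B V) : Mapping B U :=
  fun v => f ⟨v.1, h v.2⟩

/-- The extension `f[y → b]`. -/
def extend {V : Finset Var} {y : Var} (f : Mapping B (V.erase y))
    (b : {b : ℕ // b ∈ B.dom y.sort}) : Mapping B V :=
  fun v => if h : v.1 = y then ⟨b.1, h ▸ b.2⟩ else f ⟨v.1, Finset.mem_erase.2 ⟨h, v.2⟩⟩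

/-- The tuple `(f(v₁), …, f(vₘ))`. -/
def tuple (vs : List Var) (f : Mapping B vs.toFinset) : List ℕ :=
  vs.attach.map fun v => (f ⟨v.1, List.mem_toFinset.2 v.2⟩).1

end Mapping

/-- The join of two constraints. -/
def join {B : FinStructure} {U₁ U₂ : Finset Var}
    (F₁ : Set (Mapping B U₁)) (F₂ : Set (Mapping B U₂)) : Set (Mapping B (U₁ ∪ U₂)) :=
  {f | f.restrict Finset.subset_union_left ∈ F₁ ∧ f.restrict Finset.subset_union_right ∈ F₂}

/-- The operator `ε_y`, which eliminates a universally quantified variable. -/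
def elimAll {B : FinStructure} {V : Finset Var} (y : Var) (F : Set (Mapping B V)) :
    Set (Mapping B (V.erase y)) :=
  {f | ∀ b : {b : ℕ // b ∈ B.dom y.sort}, f.extend b ∈ F}

/-- A judgement `(i, V, F)` on `(φ, B)`. -/
structure Judgement (φ : QCFormula) (B : FinStructure) where
  loc : φ.Index
  vars : Finset Var
  maps : Set (Mapping B vars)
  vars_subset : vars ⊆ (φ.subAt loc).free

/-- `Follows P J`: the judgement `J` is of one of the types that are allowed in a judgement proof
in which the previous judgements are those in the list `P`. -/
inductive Follows {φ : QCFormula} {B : FinStructure} (P : List (Judgement φ B)) :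
    Judgement φ B → Prop
  | atom (i : φ.Index) (R : ℕ) (vs : List Var) (hi : φ.subAt i = .atom R vs)
      (hV : vs.toFinset ⊆ (φ.subAt i).free) :
      Follows P ⟨i, vs.toFinset, {f | f.tuple vs ∈ B.rel R}, hV⟩
  | projection (i : φ.Index) (U V : Finset Var) (F : Set (Mapping B V))
      (hV : V ⊆ (φ.subAt i).free) (hmem : ⟨i, V, F, hV⟩ ∈ P) (hUV : U ⊆ V)
      (hU : U ⊆ (φ.subAt i).free) :
      Follows P ⟨i, U, Mapping.restrict hUV '' F, hU⟩
  | join (i : φ.Index) (U₁ U₂ : Finset Var) (F₁ : Set (Mapping B U₁)) (F₂ : Set (Mapping B U₂))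
      (h₁ : U₁ ⊆ (φ.subAt i).free) (h₂ : U₂ ⊆ (φ.subAt i).free)
      (hmem₁ : ⟨i, U₁, F₁, h₁⟩ ∈ P) (hmem₂ : ⟨i, U₂, F₂, h₂⟩ ∈ P)
      (hU : U₁ ∪ U₂ ⊆ (φ.subAt i).free) :
      Follows P ⟨i, U₁ ∪ U₂, QCSP.join F₁ F₂, hU⟩
  | upwardFlow (i j : φ.Index) (V : Finset Var) (F : Set (Mapping B V))
      (hij : QCFormula.IsParent i j) (hj : V ⊆ (φ.subAt j).free) (hmem : ⟨j, V, F, hj⟩ ∈ P)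
      (hi : V ⊆ (φ.subAt i).free) :
      Follows P ⟨i, V, F, hi⟩
  | forallElimination (i j : φ.Index) (y : Var) (V : Finset Var) (F : Set (Mapping B V))
      (hij : QCFormula.IsParent i j) (hall : φ.subAt i = .all y (φ.subAt j)) (hy : y ∈ V)
      (hj : V ⊆ (φ.subAt j).free) (hmem : ⟨j, V, F, hj⟩ ∈ P)
      (hi : V.erase y ⊆ (φ.subAt i).free) :
      Follows P ⟨i, V.erase y, elimAll y F, hi⟩
  | downwardFlow (i j : φ.Index) (V : Finset Var) (F : Set (Mapping B V))
      (hij : QCFormula.IsParent i j) (hi : V ⊆ (φ.subAt i).free) (hmem : ⟨i, V, F, hi⟩ ∈ P)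
      (hj : V ⊆ (φ.subAt j).free) :
      Follows P ⟨j, V, F, hj⟩

/-- A judgement proof: a finite sequence of judgements, each of which follows from the judgements
before it. -/
def IsJudgementProof {φ : QCFormula} {B : FinStructure} (P : List (Judgement φ B)) : Prop :=
  ∀ (n : ℕ) (h : n < P.length), Follows (P.take n) P[n]

/-- `(φ, B)` is `k`-judge-consistent: no judgement proof of width at most `k` contains an empty
judgement. -/
def Instance.IsJudgeConsistent (k : ℕ) (I : Instance) : Prop :=
  ¬ ∃ P : List (Judgement I.formula I.struct),
    IsJudgementProof P ∧ (∀ J ∈ P, J.vars.card ≤ k) ∧ ∃ J ∈ P, J.maps = ∅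

/-! ### Instances as strings over a finite alphabet -/

/-- The input alphabet. -/
inductive Symb : Type
  | bit (b : Bool)
  | sep
  | opn
  | cls
  | atom
  | conj
  | all
  | ex

/-- Numbers are written in binary and followed by a separator. -/
def encodeNat (n : ℕ) : List Symb := n.bits.map Symb.bit ++ [Symb.sep]

/-- Lists are written item after item between two brackets. -/
def encodeList {α : Type} (enc : α → List Symb) (l : List α) : List Symb :=
  Symb.opn :: l.flatMap enc ++ [Symb.cls]

def Var.encode (x : Var) : List Symb := encodeNat x.name ++ encodeNat x.sort

/-- Formulas are written in prefix form. -/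
def QCFormula.encode : QCFormula → List Symb
  | .atom R vs => Symb.atom :: encodeNat R ++ encodeList Var.encode vs
  | .conj _ ψ => Symb.conj :: encodeList id (List.ofFn fun c => (ψ c).encode)
  | .all y ψ => Symb.all :: y.encode ++ ψ.encode
  | .ex x ψ => Symb.ex :: x.encode ++ ψ.encode

def SortTable.encode (T : SortTable) : List Symb :=
  encodeNat T.sort ++ encodeList encodeNat T.elems

def RelTable.encode (T : RelTable) : List Symb :=
  encodeNat T.symbol ++ encodeList encodeNat T.arity ++ encodeList (encodeList encodeNat) T.tuples

def FinStructure.encode (B : FinStructure) : List Symb :=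
  encodeList SortTable.encode B.sorts ++ encodeList RelTable.encode B.rels

def Instance.encode (I : Instance) : List Symb := I.formula.encode ++ I.struct.encode

/-- The property `p` of the objects in `α` is decidable in polynomial time: some Turing machine
that is started on the encoding of `a` halts with the right answer after a number of steps that is
bounded by a polynomial in the length of the encoding. -/
def DecidableInPolyTime {α Γ : Type} (enc : α → List Γ) (p : α → Prop) : Prop :=
  ∃ f : α → Bool, (∀ a, f a = true ↔ p a) ∧
    Nonempty (Turing.TM2ComputableInPolyTime enc Computability.encodeBool f)

end QCSP

namespace QCSP

open Turing

/-! For a fixed node and a fixed set of variables there may be exponentially many constraints `F`,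
so the derivable judgements cannot be listed. The remedy is that the derivable judgements with the
same node `i` and the same variables `V` are closed under intersection: join two of them and project
back (`Derivable.inter`). Since there are only finitely many mappings `V → B`, an empty judgement is
derivable if and only if, for some `(i, V)`, a judgement is derivable at all and each mapping is
missing from the constraint of some derivable judgement (`exists_isJudgementProof_iff`).

So it is enough to know which pairs `(i, V)` carry a derivable judgement and which triples `(i, V,
f)` are excluded, in the sense that `f ∉ F` for some derivable `(i, V, F)`. For `|V| ≤ k` these are
polynomially many facts. They form the least relation that is closed under one monotone rule for
each type of judgement: a mapping is excluded by a projection if all its extensions are excluded, by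
a join if one of its two restrictions is, by a universal elimination if one of its extensions by a
value of the variable is, and flows only change the node. `Step.excludes` is the soundness of these
rules, `covered_of_derivable` their completeness.

The complexity bound is the easy half of the theorem of Immerman and Vardi: least fixed point
definitions over the positions of a string can be evaluated in polynomial time. A position is a
suffix of the input. `PTX` and `PT` are the classes of conditions on positions that can be
evaluated, with and without a relation variable `X`; they are closed under Boolean operations,
quantification over positions, calls of `X` and least fixed points (`PT.lfp`). A relation of arity
`r` is kept as a truth table of length `(n + 1) ^ r` on a stack, and as many rounds of iteration
suffice. The programs are written in a small structured language whose running times compose, and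
`Run.steps` translates them to a multi-stack Turing machine.

The two halves meet in the representation of judgements. A node, a variable or a value is given by a
position where it is written, so a judgement with one mapping becomes a tuple of `2 * k + 2`
positions (with one flag). Parsing, the tree structure, free variables, universes and satisfaction
of atoms are themselves defined by quantifiers and least fixed points over positions (`Recog.formL`,
`Instance.pt_nodeAt`, `Instance.pt_freeAt`, `Instance.pt_satAt`). `pt_excludes` assembles all of
this. -/

instance : Finite Symb :=
  Finite.of_injective
    (fun s => match s with
      | .bit false => (0 : Fin 9) | .bit true => 1 | .sep => 2 | .opn => 3 | .cls => 4
      | .atom => 5 | .conj => 6 | .all => 7 | .ex => 8)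
    (by rintro (_ | _) (_ | _) <;> simp <;> rename_i a <;> cases a <;> simp <;>
          rename_i b <;> cases b <;> simp)

/-! ### Structured programs over stacks -/

/-- The contents of countably many stacks. -/
abbrev Stacks : Type := ℕ → List Symb

/-- Structured programs that operate on stacks. -/
inductive Prog : Type
  | skip
  | push (t : ℕ) (a : Symb)
  | pop (t : ℕ)
  | seq (P Q : Prog)
  | case (t : ℕ) (f : Option Symb → Prog)
  | loop (t : ℕ) (P : Prog)

namespace Prog

open Function (update)

/-- `Run P S S' n`: the program `P`, started on the stacks `S`, ends after `n` steps with the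
stacks `S'`. -/
inductive Run : Prog → Stacks → Stacks → ℕ → Prop
  | skip (S : Stacks) : Run skip S S 1
  | push (S : Stacks) (t : ℕ) (a : Symb) : Run (push t a) S (update S t (a :: S t)) 1
  | pop (S : Stacks) (t : ℕ) : Run (pop t) S (update S t (S t).tail) 1
  | seq {P Q : Prog} {S S' S'' : Stacks} {m n : ℕ} (h₁ : Run P S S' m) (h₂ : Run Q S' S'' n) :
      Run (seq P Q) S S'' (m + n)
  | case {t : ℕ} {f : Option Symb → Prog} {S S' : Stacks} {n : ℕ}
      (h : Run (f (S t).head?) S S' n) : Run (case t f) S S' (1 + n)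
  | loop_nil {t : ℕ} {P : Prog} {S : Stacks} (h : S t = []) : Run (loop t P) S S 1
  | loop_cons {t : ℕ} {P : Prog} {S S' S'' : Stacks} {m n : ℕ} (h : S t ≠ [])
      (h₁ : Run P S S' m) (h₂ : Run (loop t P) S' S'' n) : Run (loop t P) S S'' (1 + m + n)

/-- The program uses only stacks with numbers below `N`. -/
def UsesBelow (N : ℕ) : Prog → Prop
  | skip => True
  | push t _ => t < N
  | pop t => t < N
  | seq P Q => P.UsesBelow N ∧ Q.UsesBelow N
  | case t f => t < N ∧ ∀ o, (f o).UsesBelow N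
  | loop t P => t < N ∧ P.UsesBelow N

theorem UsesBelow.mono {M N : ℕ} (h : M ≤ N) : ∀ {P : Prog}, P.UsesBelow M → P.UsesBelow N
  | skip, _ => trivial
  | push _ _, h' => lt_of_lt_of_le h' h
  | pop _, h' => lt_of_lt_of_le h' h
  | seq _ _, h' => ⟨h'.1.mono h, h'.2.mono h⟩
  | case _ _, h' => ⟨lt_of_lt_of_le h'.1 h, fun o => (h'.2 o).mono h⟩
  | loop _ _, h' => ⟨lt_of_lt_of_le h'.1 h, h'.2.mono h⟩

/-- The only infinite-looking case is the branching, but it has just one branch for each of the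
finitely many elements of `Option Symb`. -/
theorem exists_usesBelow : ∀ P : Prog, ∃ N, P.UsesBelow N
  | skip => ⟨0, trivial⟩
  | push t _ => ⟨t + 1, Nat.lt_succ_self t⟩
  | pop t => ⟨t + 1, Nat.lt_succ_self t⟩
  | seq P Q => by
      obtain ⟨M, hM⟩ := exists_usesBelow P
      obtain ⟨N, hN⟩ := exists_usesBelow Q
      exact ⟨max M N, hM.mono (le_max_left _ _), hN.mono (le_max_right _ _)⟩
  | case t f => by
      choose M hM using fun o => exists_usesBelow (f o)
      obtain ⟨N, hN⟩ := (Set.finite_range M).bddAbove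
      exact ⟨max (t + 1) N, lt_of_lt_of_le t.lt_succ_self (le_max_left _ _),
        fun o => (hM o).mono ((hN ⟨o, rfl⟩).trans (le_max_right _ _))⟩
  | loop t P => by
      obtain ⟨N, hN⟩ := exists_usesBelow P
      exact ⟨max (t + 1) N, lt_of_lt_of_le t.lt_succ_self (le_max_left _ _), hN.mono (le_max_right _ _)⟩

/-- The labels of the machine for a program. -/
def Label : Prog → Type
  | skip => Unit
  | push _ _ => Unit
  | pop _ => Unit
  | seq P Q => P.Label ⊕ Q.Label
  | case _ f => Option (Σ o, (f o).Label)
  | loop _ P => Option P.Label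

instance finite_label : ∀ P : Prog, Finite P.Label
  | skip => inferInstanceAs (Finite Unit)
  | push _ _ => inferInstanceAs (Finite Unit)
  | pop _ => inferInstanceAs (Finite Unit)
  | seq P Q => by
      have := finite_label P
      have := finite_label Q
      exact inferInstanceAs (Finite (P.Label ⊕ Q.Label))
  | case _ f => by
      have := fun o => finite_label (f o)
      exact inferInstanceAs (Finite (Option (Σ o, (f o).Label)))
  | loop _ P => by
      have := finite_label P
      exact inferInstanceAs (Finite (Option P.Label))

/-- The label at which the execution of a program starts. -/
def entry : (P : Prog) → P.Label
  | skip => ()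
  | push _ _ => ()
  | pop _ => ()
  | seq P _ => .inl P.entry
  | case _ _ => none
  | loop _ _ => none

/-- The stack alphabets: one Boolean output stack, and `N` work stacks. -/
abbrev Alphabet (N : ℕ) : Option (Fin N) → Type
  | none => Bool
  | some _ => Symb

/-- The machine code of a program. -/
def code (N : ℕ) [NeZero N] {L : Type} :
    (P : Prog) → (P.Label → L) → L → P.Label → TM2.Stmt (Alphabet N) L (Option Symb)
  | skip, _, x, _ => .goto fun _ => x
  | push t a, _, x, _ => .push (some (Fin.ofNat N t)) (fun _ => a) (.goto fun _ => x)
  | pop t, _, x, _ => .pop (some (Fin.ofNat N t)) (fun v _ => v) (.goto fun _ => x)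
  | seq P Q, emb, _, .inl l => P.code N (fun l => emb (.inl l)) (emb (.inr Q.entry)) l
  | seq _ Q, emb, x, .inr l => Q.code N (fun l => emb (.inr l)) x l
  | case t f, emb, _, none =>
      .peek (some (Fin.ofNat N t)) (fun _ o => o) (.goto fun o => emb (some ⟨o, (f o).entry⟩))
  | case _ f, emb, x, some ⟨o, l⟩ => (f o).code N (fun l => emb (some ⟨o, l⟩)) x l
  | loop t P, emb, x, none =>
      .peek (some (Fin.ofNat N t)) (fun _ o => o)
        (.goto fun o => if o.isSome then emb (some P.entry) else x)
  | loop _ P, emb, _, some l => P.code N (fun l => emb (some l)) (emb none) l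

/-- The stacks of the machine that hold `S` and the output `o`. -/
def machineStacks (N : ℕ) (o : List Bool) (S : Stacks) : (j : Option (Fin N)) → List (Alphabet N j)
  | none => o
  | some j => S j

theorem machineStacks_update {N t : ℕ} [NeZero N] (ht : t < N) (o : List Bool) (S : Stacks)
    (l : List Symb) :
    machineStacks N o (update S t l) =
      update (machineStacks N o S) (some (Fin.ofNat N t)) l := by
  funext j
  have hval : (Fin.ofNat N t : ℕ) = t := Nat.mod_eq_of_lt ht
  rcases j with _ | j
  · rw [Function.update_of_ne (by simp)]
    rfl
  · by_cases hj : j = Fin.ofNat N t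
    · subst hj
      rw [Function.update_self]
      change update S t l (Fin.ofNat N t : ℕ) = l
      rw [hval, Function.update_self]
    · rw [Function.update_of_ne (by simpa using hj)]
      change update S t l j = S j
      exact Function.update_of_ne (fun h => hj (Fin.ext (h.trans hval.symm))) _ _

theorem machineStacks_ofNat {N t : ℕ} [NeZero N] (ht : t < N) (o : List Bool) (S : Stacks) :
    machineStacks N o S (some (Fin.ofNat N t)) = S t :=
  congrArg S (Nat.mod_eq_of_lt ht)

/-- Running the machine for `n` steps leads from `c` to `c'`. -/
def Steps {N : ℕ} {L : Type} (M : L → TM2.Stmt (Alphabet N) L (Option Symb))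
    (c : TM2.Cfg (Alphabet N) L (Option Symb)) (n : ℕ)
    (c' : TM2.Cfg (Alphabet N) L (Option Symb)) : Prop :=
  (flip bind (TM2.step M))^[n] (some c) = some c'

section

variable {N : ℕ} {L : Type} {M : L → TM2.Stmt (Alphabet N) L (Option Symb)}
  {c c' c'' : TM2.Cfg (Alphabet N) L (Option Symb)} {m n : ℕ}

theorem Steps.trans (h₁ : Steps M c m c') (h₂ : Steps M c' n c'') : Steps M c (m + n) c'' := by
  unfold Steps at *
  rw [Nat.add_comm, Function.iterate_add_apply, h₁, h₂]

theorem Steps.single (h : TM2.step M c = some c') : Steps M c 1 c' := h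

end

/-- Correctness of the compilation, with the same number of steps. The code of a program depends on
an embedding `emb` of its labels into those of the whole machine and on an exit label `x`; because
both are arbitrary here, the induction hypotheses apply to subprograms in place. The body of a loop
exits to the test of that loop. -/
theorem Run.steps {N : ℕ} [NeZero N] {P : Prog} {S S' : Stacks} {n : ℕ} (h : Run P S S' n)
    (hN : P.UsesBelow N) {L : Type} {M : L → TM2.Stmt (Alphabet N) L (Option Symb)}
    (emb : P.Label → L) (x : L) (hM : ∀ l, M (emb l) = P.code N emb x l)
    (o : List Bool) (v : Option Symb) :
    ∃ v', Steps M ⟨some (emb P.entry), v, machineStacks N o S⟩ n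
      ⟨some x, v', machineStacks N o S'⟩ := by
  induction h generalizing L v with
  | skip S => exact ⟨v, .single (by simp [TM2.step, hM, code])⟩
  | push S t a =>
      refine ⟨v, .single ?_⟩
      rw [machineStacks_update hN, TM2.step, hM, ← machineStacks_ofNat hN o S]
      rfl
  | pop S t =>
      refine ⟨v, .single ?_⟩
      rw [machineStacks_update hN, TM2.step, hM, ← machineStacks_ofNat hN o S]
      rfl
  | seq h₁ h₂ ih₁ ih₂ =>
      obtain ⟨v₁, hv₁⟩ := ih₁ hN.1 (fun l => emb (.inl l)) _ (fun l => hM (.inl l)) v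
      obtain ⟨v₂, hv₂⟩ := ih₂ hN.2 (fun l => emb (.inr l)) x (fun l => hM (.inr l)) v₁
      exact ⟨v₂, hv₁.trans hv₂⟩
  | @case t f S S' n h ih =>
      obtain ⟨v₁, hv₁⟩ := ih (hN.2 _) (fun l => emb (some ⟨_, l⟩)) x (fun l => hM (some ⟨_, l⟩))
        (S t).head?
      refine ⟨v₁, .trans (.single ?_) hv₁⟩
      rw [TM2.step, hM, ← machineStacks_ofNat hN.1 o S]
      rfl
  | @loop_nil t P S h =>
      refine ⟨none, .single ?_⟩
      rw [← machineStacks_ofNat hN.1 o S] at h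
      rw [TM2.step, hM]
      simp only [code, entry, TM2.stepAux]
      rw [h]
      rfl
  | @loop_cons t P S S' S'' m n h h₁ h₂ ih₁ ih₂ =>
      obtain ⟨v₁, hv₁⟩ := ih₁ hN.2 (fun l => emb (some l)) _ (fun l => hM (some l)) (S t).head?
      obtain ⟨v₂, hv₂⟩ := ih₂ hN emb x hM v₁
      refine ⟨v₂, .trans (.trans (.single ?_) hv₁) hv₂⟩
      obtain ⟨a, l, hl⟩ := List.exists_cons_of_ne_nil h
      rw [hl, TM2.step, hM]
      rw [← machineStacks_ofNat hN.1 o S] at hl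
      simp only [code, entry, TM2.stepAux]
      rw [hl]
      rfl

/-- `Runs P S S' T`: the program `P` leads from `S` to `S'` in at most `T` steps. -/
def Runs (P : Prog) (S S' : Stacks) (T : ℕ) : Prop := ∃ n ≤ T, Run P S S' n

open Classical in
/-- A property is decidable in polynomial time if a program that finds the input on stack `1`
leaves the answer on stack `0`. -/
theorem decidableInPolyTime_of_runs {α : Type} {enc : α → List Symb} {p : α → Prop} (P : Prog)
    (T : Polynomial ℕ)
    (h : ∀ a, Runs P (update (fun _ => []) 1 (enc a))
      (update (fun _ => []) 0 [Symb.bit (decide (p a))]) (T.eval (enc a).length)) :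
    DecidableInPolyTime enc p := by
  refine ⟨fun a => decide (p a), fun a => decide_eq_true_iff, ?_⟩
  obtain ⟨N₀, hN₀⟩ := P.exists_usesBelow
  -- Stacks `0` and `1` must exist even if the program does not mention them.
  let N := N₀ + 2
  have : NeZero N := ⟨by omega⟩
  have hN : P.UsesBelow N := hN₀.mono (by omega)
  let M : Option P.Label → TM2.Stmt (Alphabet N) (Option P.Label) (Option Symb) := fun l =>
    match l with
    | some l => P.code N some none l
    -- After the program has ended, its answer is moved to the Boolean output stack. The internal
    -- state is reset to `none` because `haltList` asks for the initial state; all other stacks must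
    -- be empty by then.
    | none => .pop (some (Fin.ofNat N 0)) (fun _ o => o)
        (.push none (fun v => (decide (v = some (.bit true)) : Bool)) (.load (fun _ => none) .halt))
  let tm : FinTM2 :=
    { K := Option (Fin N)
      k₀ := some (Fin.ofNat N 1)
      k₁ := none
      Γ := Alphabet N
      Λ := Option P.Label
      main := some P.entry
      ΛFin := Fintype.ofFinite _
      σ := Option Symb
      initialState := none
      σFin := Fintype.ofFinite _
      Γk₀Fin := @Fintype.ofFinite Symb _
      m := M }
  refine ⟨{ tm := tm, inputAlphabet := Equiv.refl Symb, outputAlphabet := Equiv.refl Bool,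
            time := T + 1, outputsFun := fun a => ?_ }⟩
  choose n hn hrun using h
  have hinit : initList tm (List.map (Equiv.refl Symb).invFun (enc a)) =
      ⟨some (some P.entry), none, machineStacks N [] (update (fun _ => []) 1 (enc a))⟩ := by
    unfold initList
    congr 1
    funext j
    rw [machineStacks_update (by omega)]
    change dite (j = some (Fin.ofNat N 1)) _ _ = _
    split_ifs with hj
    · subst hj
      rw [Function.update_self]
      exact List.map_id _
    · rw [Function.update_of_ne hj]
      rcases j with _ | j <;> rfl
  have hhalt : (⟨none, none, machineStacks N [decide (p a)] (fun _ => [])⟩ :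
      TM2.Cfg (Alphabet N) (Option P.Label) (Option Symb)) =
      haltList tm (List.map (Equiv.refl Bool).invFun (Computability.encodeBool (decide (p a)))) := by
    unfold haltList
    congr 1
    funext j
    change _ = dite (j = none) _ _
    split_ifs with hj
    · subst hj
      rfl
    · rcases j with _ | j
      · exact absurd rfl hj
      · rfl
  have hsteps : Steps M ⟨some (some P.entry), none,
      machineStacks N [] (update (fun _ => []) 1 (enc a))⟩ (n a + 1)
      ⟨none, none, machineStacks N [decide (p a)] (fun _ => [])⟩ := by
    obtain ⟨v, hv⟩ := (hrun a).steps (M := M) hN some none (fun l => rfl) [] none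
    refine hv.trans (.single ?_)
    simp only [TM2.step, M, TM2.stepAux]
    rw [machineStacks_ofNat (by omega), Function.update_self, List.tail_cons,
      ← machineStacks_update (by omega)]
    congr 2
    funext j
    rcases j with _ | j
    · rw [Function.update_self]
      simp [machineStacks]
    · rw [Function.update_of_ne (by simp)]
      simp [machineStacks]
  exact
    { steps := n a + 1
      evals_in_steps := by
        rw [hinit, Option.map_some, ← hhalt]
        exact hsteps
      steps_le_m := by
        simp only [Polynomial.eval_add, Polynomial.eval_one]
        exact Nat.succ_le_succ (hn a) }

end Prog

end QCSP

namespace QCSP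

open Function (update)

namespace Prog

/-! ### Basic programs and their running times -/

section Runs

variable {P Q : Prog} {S S' S'' : Stacks} {m n : ℕ}

theorem Run.runs (h : Run P S S' n) : Runs P S S' n := ⟨n, le_rfl, h⟩

theorem Runs.mono (h : Runs P S S' m) (hmn : m ≤ n) : Runs P S S' n :=
  let ⟨k, hk, hr⟩ := h
  ⟨k, hk.trans hmn, hr⟩

theorem Runs.seq (h₁ : Runs P S S' m) (h₂ : Runs Q S' S'' n) : Runs (seq P Q) S S'' (m + n) :=
  let ⟨_, hk, hr⟩ := h₁
  let ⟨_, hl, hs⟩ := h₂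
  ⟨_, add_le_add hk hl, .seq hr hs⟩

theorem Runs.case {t : ℕ} {f : Option Symb → Prog} (h : Runs (f (S t).head?) S S' n) :
    Runs (case t f) S S' (1 + n) :=
  let ⟨_, hk, hr⟩ := h
  ⟨_, Nat.add_le_add_left hk 1, .case hr⟩

theorem Runs.cast {S₁ S₁' : Stacks} (h : Runs P S S' m) (hS : S = S₁) (hS' : S' = S₁')
    (hm : m ≤ n) : Runs P S₁ S₁' n := hS ▸ hS' ▸ h.mono hm

theorem Runs.push (t : ℕ) (a : Symb) (h : update S t (a :: S t) = S') : Runs (push t a) S S' 1 :=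
  h ▸ (Run.push S t a).runs

theorem Runs.pop (t : ℕ) (h : update S t (S t).tail = S') : Runs (pop t) S S' 1 :=
  h ▸ (Run.pop S t).runs

/-- The loop invariant is a function `F` of what remains on the controlling stack, so each round has
to remove exactly one symbol from it. -/
theorem Runs.loop {t T : ℕ} (F : List Symb → Stacks) (hF : ∀ l, F l t = l) (l : List Symb)
    (h : ∀ a s, a :: s <:+ l → Runs P (F (a :: s)) (F s) T) :
    Runs (loop t P) (F l) (F []) ((T + 1) * l.length + 1) := by
  induction l with
  | nil => exact (Run.loop_nil (hF [])).runs.mono (by simp)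
  | cons a l ih =>
      obtain ⟨k, hk, hr⟩ := h a l List.suffix_rfl
      obtain ⟨k', hk', hr'⟩ := ih fun b s hs => h b s (hs.trans (List.suffix_cons a l))
      refine ⟨_, ?_, .loop_cons (by simp [hF]) hr hr'⟩
      rw [List.length_cons]
      linarith

end Runs

/-- Move the top of stack `s` to stack `t`. -/
def moveTop (s t : ℕ) : Prog :=
  case s fun o => o.elim skip fun a => seq (pop s) (push t a)

/-- Move the content of stack `s`, in reverse order, to stack `t`. -/
def pour (s t : ℕ) : Prog := loop s (moveTop s t)

/-- Make stack `s` empty. -/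
def clear (s : ℕ) : Prog := loop s (pop s)

/-- Copy the content of stack `s` to the empty stack `t`, with the help of the empty stack `c`. -/
def copy (s t c : ℕ) : Prog :=
  seq (pour s c) (loop c (case c fun o => o.elim skip fun a =>
    seq (pop c) (seq (push s a) (push t a))))

/-- Apply a unary operation to the Boolean on top of stack `0`. -/
def op₁ (f : Bool → Bool) : Prog :=
  case 0 fun o => match o with
    | some (.bit x) => seq (pop 0) (push 0 (.bit (f x)))
    | _ => skip

/-- Apply a binary operation to the two topmost Booleans of stack `0`. -/
def op₂ (f : Bool → Bool → Bool) : Prog :=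
  case 0 fun o => match o with
    | some (.bit y) => seq (pop 0) (op₁ fun x => f x y)
    | _ => skip

/-- Execute `P` for each content of stack `c` that is a suffix of the content of stack `1`, from
the longest suffix to the shortest one. -/
def forSuffixes (c d : ℕ) (P : Prog) : Prog :=
  seq (copy 1 c d) (seq (loop c (seq P (pop c))) P)

variable {P Q : Prog} {S S' S'' : Stacks} {s t c d T : ℕ}

theorem runs_moveTop (hst : s ≠ t) {l : List Symb} {a : Symb} (h : S s = a :: l) :
    Runs (moveTop s t) S (update (update S s l) t (a :: S t)) 3 := by
  refine Runs.case (n := 2) ?_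
  rw [h]
  refine (Runs.pop s rfl).seq (Runs.push t a ?_)
  rw [h, Function.update_of_ne hst.symm, List.tail_cons]

theorem runs_pour (hst : s ≠ t) :
    Runs (pour s t) S (update (update S s []) t ((S s).reverse ++ S t))
      (4 * (S s).length + 1) := by
  obtain ⟨l, hl⟩ : ∃ l, l = S s := ⟨_, rfl⟩
  rw [← hl]
  induction l generalizing S with
  | nil =>
      refine (Run.loop_nil hl.symm).runs.cast rfl ?_ (by simp)
      funext j
      grind [Function.update_apply]
  | cons a l ih =>
      have h := runs_moveTop hst hl.symm
      have h' := ih (S := update (update S s l) t (a :: S t)) (by grind [Function.update_apply])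
      obtain ⟨k, hk, hr⟩ := h
      obtain ⟨k', hk', hr'⟩ := h'
      refine ⟨1 + k + k', ?_, .loop_cons (by simp [← hl]) hr ?_⟩
      · rw [List.length_cons]
        linarith
      · refine Eq.subst (motive := fun S' => Run (pour s t) _ S' _) ?_ hr'
        funext j
        grind [Function.update_apply]

theorem runs_clear : Runs (clear s) S (update S s []) (2 * (S s).length + 1) := by
  have h := Runs.loop (t := s) (P := pop s) (T := 1) (fun l => update S s l) (by simp) (S s)
    fun a l _ => Runs.pop s (by simp)
  rwa [Function.update_eq_self] at h

/-- Pouring to `c` reverses the content; while `l` remains on `c`, both `s` and `t` hold the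
original content without its first `l.length` symbols. -/
theorem runs_copy (hst : s ≠ t) (hsc : s ≠ c) (htc : t ≠ c) (ht : S t = []) (hc : S c = []) :
    Runs (copy s t c) S (update S t (S s)) (9 * (S s).length + 2) := by
  have h₁ := runs_pour (S := S) hsc
  have h₂ := Runs.loop (t := c) (T := 4)
    (P := case c fun o => o.elim skip fun a => seq (pop c) (seq (push s a) (push t a)))
    (fun l => update (update (update S c l) s ((S s).drop l.length)) t ((S s).drop l.length))
    (by intro l; grind [Function.update_apply]) (S s).reverse
    (by
      intro a l h
      refine Runs.case (n := 3) ?_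
      have htop : (update (update (update S c (a :: l)) s ((S s).drop (a :: l).length)) t
          ((S s).drop (a :: l).length)) c = a :: l := by grind [Function.update_apply]
      rw [htop]
      have hdrop : (S s).drop l.length = a :: (S s).drop (l.length + 1) := by
        obtain ⟨u, hu⟩ := h
        have hs : S s = l.reverse ++ a :: u.reverse := by
          rw [← List.reverse_reverse (S s), ← hu]
          simp
        simp [hs, List.drop_append, List.drop_eq_nil_of_le]
      refine (Runs.pop c rfl).seq ((Runs.push s a rfl).seq (Runs.push t a ?_))
      funext j
      grind [Function.update_apply])
  refine h₁.seq (h₂.cast (n := 5 * (S s).length + 1) ?_ rfl (by simp)) |>.cast rfl ?_ (by linarith)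
  all_goals
    funext j
    grind [Function.update_apply]


/-- `A` holds the abstract state between two rounds, and `f` is the effect of one round. The loop
stops as soon as `c` is empty, so the empty suffix is treated by one further execution of `P`.
Copying costs `9 * n + 2`, which the bound absorbs. -/
theorem runs_forSuffixes {A : Type} (St : A → Stacks) (f : A → List Symb → A) (w : List Symb)
    (hc : c ≠ 1) (hd : d ≠ 1) (hcd : c ≠ d) (a₀ : A) (hSc : ∀ a, St a c = []) (hSd : St a₀ d = [])
    (hw : St a₀ 1 = w)
    (h : ∀ a s, s <:+ w → Runs P (update (St a) c s) (update (St (f a s)) c s) T) :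
    Runs (forSuffixes c d P) (St a₀) (St (w.tails.foldl f a₀)) ((T + 11) * (w.length + 1)) := by
  have hmain : ∀ l, l <:+ w → ∀ a, Runs (seq (loop c (seq P (pop c))) P) (update (St a) c l)
      (St (l.tails.foldl f a)) ((T + 2) * l.length + 1 + T) := by
    intro l
    induction l with
    | nil =>
        intro hl a
        refine (Run.loop_nil (by simp)).runs.seq (h a [] hl) |>.cast rfl ?_ (by simp)
        simp only [List.tails, List.foldl_cons, List.foldl_nil]
        have h := Function.update_eq_self c (St (f a []))
        rwa [hSc] at h
    | cons x l ih =>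
        intro hl a
        obtain ⟨k, hk, hr⟩ := (h a _ hl).seq (Runs.pop c (S' := update (St (f a (x :: l))) c l)
          (by simp))
        obtain ⟨m, hm, hs⟩ := ih ((List.suffix_cons x l).trans hl) (f a (x :: l))
        -- The run is split into the loop and the final execution of `P`, so that one more round can
        -- be put in front of the loop.
        cases hs with
        | @seq _ _ _ S₁ _ m₁ m₂ hs₁ hs₂ =>
          refine ⟨(1 + k + m₁) + m₂, ?_, .seq (.loop_cons (by simp) hr hs₁) ?_⟩
          · rw [List.length_cons]
            linarith
          · simpa using hs₂
  refine (runs_copy (S := St a₀) (s := 1) hc.symm hd.symm hcd (hSc _) hSd).seq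
    (hmain _ List.suffix_rfl a₀ |>.cast (by rw [hw]) rfl le_rfl) |>.mono ?_
  rw [hw]
  linarith

theorem runs_op₁ {f : Bool → Bool} {x : Bool} {l : List Symb} (h : S 0 = .bit x :: l) :
    Runs (op₁ f) S (update S 0 (.bit (f x) :: l)) 3 := by
  refine Runs.case (n := 2) ?_
  rw [h]
  refine (Runs.pop 0 rfl).seq (Runs.push 0 _ ?_)
  simp [h]

theorem runs_op₂ {f : Bool → Bool → Bool} {x y : Bool} {l : List Symb}
    (h : S 0 = .bit y :: .bit x :: l) :
    Runs (op₂ f) S (update S 0 (.bit (f x y) :: l)) 5 := by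
  refine Runs.case (n := 4) ?_
  rw [h]
  refine (Runs.pop 0 rfl).seq ((runs_op₁ (x := x) (l := l) ?_).cast rfl ?_ le_rfl)
  · simp [h]
  · simp

end Prog

/-! ### Relations on suffixes that programs can evaluate -/

open Prog Classical

/-- The truth table of the relation `X` on the suffixes of `w`: the arguments in the list `ks`
range over all suffixes, the other ones are given by `v`. -/
noncomputable def table (w : List Symb) {κ : Type} :
    List κ → ((κ → List Symb) → Prop) → (κ → List Symb) → List Symb
  | [], X, v => [.bit (decide (X v))]
  | c :: ks, X, v => w.tails.reverse.flatMap fun s => table w ks X (update v c s)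

theorem length_table (w : List Symb) {κ : Type} (ks : List κ) (X : (κ → List Symb) → Prop)
    (v : κ → List Symb) : (table w ks X v).length = (w.length + 1) ^ ks.length := by
  induction ks generalizing v with
  | nil => rfl
  | cons c ks ih => simp [table, List.length_flatMap, ih, pow_succ, Nat.mul_comm]

/-- The truth table of a relation. -/
noncomputable def relTable (w : List Symb) {κ : Type} [Fintype κ] (X : (κ → List Symb) → Prop) :
    List Symb :=
  table w Finset.univ.toList X fun _ => []

/-- The arguments `v` are suffixes of `w`. -/
def AreSuffixes {κ : Type} (w : List Symb) (v : κ → List Symb) : Prop := ∀ c, v c <:+ w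

/-- `Ready w b S`: the input `w` is on stack `1`, and the stacks with numbers `≥ b` are free. -/
def Ready (w : List Symb) (b : ℕ) (S : Stacks) : Prop := S 1 = w ∧ ∀ j, b ≤ j → S j = []

/-- The stacks after the answer `p` has been put on stack `0`. -/
noncomputable def answer (S : Stacks) (p : Prop) : Stacks := update S 0 (.bit (decide p) :: S 0)

theorem answer_apply (S : Stacks) (p : Prop) (j : ℕ) :
    answer S p j = if j = 0 then .bit (decide p) :: S 0 else S j :=
  Function.update_apply _ _ _ _

/-- `PTX enc Φ`: a program can decide `Φ a X v` in polynomial time if it has access to `enc a`, to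
the suffixes `v` of `enc a`, and to the truth table of the relation `X`. -/
def PTX {α : Type} (enc : α → List Symb) {κ ι : Type} [Fintype κ]
    (Φ : α → ((κ → List Symb) → Prop) → (ι → List Symb) → Prop) : Prop :=
  ∀ (t b : ℕ) (e : ι → ℕ), 1 < t → t < b → (∀ i, 0 < e i ∧ e i < b ∧ e i ≠ t) →
    ∃ (P : Prog) (T : Polynomial ℕ), ∀ a X S, Ready (enc a) b S → S t = relTable (enc a) X →
      AreSuffixes (enc a) (fun i => S (e i)) →
      Runs P S (answer S (Φ a X fun i => S (e i))) (T.eval (enc a).length)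

/-- `PT enc R`: a program can decide `R a v` in polynomial time if it has access to `enc a` and to
the suffixes `v` of `enc a`. -/
def PT {α : Type} (enc : α → List Symb) {ι : Type} (R : α → (ι → List Symb) → Prop) : Prop :=
  ∀ (κ : Type) [Fintype κ], PTX enc fun a (_ : (κ → List Symb) → Prop) v => R a v

/-! ### Boolean operations and quantifiers over positions -/

section Closure

variable {α : Type} {enc : α → List Symb} {κ ι : Type} [Fintype κ]
  {Φ Ψ : α → ((κ → List Symb) → Prop) → (ι → List Symb) → Prop}

theorem PT.ptx {R : α → (ι → List Symb) → Prop} (h : PT enc R) :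
    PTX enc fun a (_ : (κ → List Symb) → Prop) v => R a v := h κ

theorem PTX.congr (h : PTX enc Φ)
    (hΦ : ∀ a X v, AreSuffixes (enc a) v → (Φ a X v ↔ Ψ a X v)) : PTX enc Ψ := by
  intro t b e ht hb he
  obtain ⟨P, T, hP⟩ := h t b e ht hb he
  refine ⟨P, T, fun a X S hS hX hv => ?_⟩
  rw [← propext (hΦ a X _ hv)]
  exact hP a X S hS hX hv

theorem PT.congr {R R' : α → (ι → List Symb) → Prop} (h : PT enc R)
    (hR : ∀ a v, AreSuffixes (enc a) v → (R a v ↔ R' a v)) : PT enc R' :=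
  fun κ _ => (h κ).congr fun a _ v hv => hR a v hv

theorem PTX.reindex {ι' : Type} (h : PTX enc Φ) (g : ι → ι') :
    PTX enc fun a X (v : ι' → List Symb) => Φ a X fun i => v (g i) := by
  intro t b e ht hb he
  obtain ⟨P, T, hP⟩ := h t b (fun i => e (g i)) ht hb fun i => he (g i)
  exact ⟨P, T, fun a X S hS hX hv => hP a X S hS hX fun i => hv (g i)⟩

theorem PT.reindex {ι' : Type} {R : α → (ι → List Symb) → Prop} (h : PT enc R) (g : ι → ι') :
    PT enc fun a (v : ι' → List Symb) => R a fun i => v (g i) :=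
  fun κ _ => PTX.reindex (h κ) g

theorem Ready.answer {w : List Symb} {b : ℕ} {S : Stacks} (h : Ready w b S) (hb : 0 < b)
    (p : Prop) : Ready w b (answer S p) := by
  refine ⟨?_, fun j hj => ?_⟩
  · rw [QCSP.answer, Function.update_of_ne (by omega), h.1]
  · rw [QCSP.answer, Function.update_of_ne (by omega), h.2 j hj]

theorem answer_of_pos {S : Stacks} {p : Prop} {j : ℕ} (h : 0 < j) : answer S p j = S j :=
  Function.update_of_ne h.ne' _ _

theorem PTX.not (h : PTX enc Φ) : PTX enc fun a X v => ¬ Φ a X v := by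
  intro t b e ht hb he
  obtain ⟨P, T, hP⟩ := h t b e ht hb he
  refine ⟨seq P (op₁ Bool.not), T + 3, fun a X S hS hX hv => ?_⟩
  refine (hP a X S hS hX hv).seq (runs_op₁ rfl) |>.cast rfl ?_ (by simp)
  simp [answer]

theorem PTX.and (h₁ : PTX enc Φ) (h₂ : PTX enc Ψ) : PTX enc fun a X v => Φ a X v ∧ Ψ a X v := by
  intro t b e ht hb he
  obtain ⟨P, T, hP⟩ := h₁ t b e ht hb he
  obtain ⟨Q, U, hQ⟩ := h₂ t b e ht hb he
  refine ⟨seq P (seq Q (op₂ Bool.and)), T + (U + 5), fun a X S hS hX hv => ?_⟩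
  have he' : ∀ p, (fun i => answer S p (e i)) = fun i => S (e i) := fun p =>
    funext fun i => answer_of_pos (he i).1
  have h := hQ a X (answer S (Φ a X fun i => S (e i))) (hS.answer (by omega) _)
    ((answer_of_pos (by omega)).trans hX) (by rwa [he'])
  rw [he'] at h
  refine (hP a X S hS hX hv).seq (h.seq (runs_op₂ rfl)) |>.cast rfl ?_ (by simp)
  simp [answer]

theorem PTX.or (h₁ : PTX enc Φ) (h₂ : PTX enc Ψ) : PTX enc fun a X v => Φ a X v ∨ Ψ a X v :=
  (h₁.not.and h₂.not).not.congr fun a X v _ => by tauto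

theorem PTX.imp (h₁ : PTX enc Φ) (h₂ : PTX enc Ψ) : PTX enc fun a X v => Φ a X v → Ψ a X v :=
  (h₁.not.or h₂).congr fun a X v _ => by tauto

theorem foldl_or (L : List (List Symb)) (p : List Symb → Prop) (x : Bool) :
    L.foldl (fun x s => x || decide (p s)) x = (x || decide (∃ s ∈ L, p s)) := by
  induction L generalizing x with
  | nil => simp
  | cons s L ih => simp [ih, Bool.or_assoc]

/-- The witness runs through all suffixes on the first free stack `b`, while the disjunction of the
answers so far is kept on top of stack `0`. The program for `Φ` therefore has its free stacks from
`b + 1` on, and the helper stack `b + 1` of the copy is empty again when it starts. -/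
theorem PTX.ex {Φ : α → ((κ → List Symb) → Prop) → (ι → List Symb) → List Symb → Prop}
    (h : PTX (ι := Option ι) enc fun a X v => Φ a X (fun i => v (some i)) (v none)) :
    PTX enc fun a X v => ∃ s, s <:+ enc a ∧ Φ a X v s := by
  intro t b e ht hb he
  obtain ⟨P, T, hP⟩ := h t (b + 1) (fun i => i.elim b e) ht (by omega) (by
    rintro (_ | i)
    · exact ⟨by change 0 < b; omega, by change b < b + 1; omega, by change b ≠ t; omega⟩
    · exact ⟨(he i).1, (he i).2.1.trans (Nat.lt_succ_self b), (he i).2.2⟩)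
  refine ⟨seq (push 0 (.bit false)) (forSuffixes b (b + 1) (seq P (op₂ Bool.or))),
    1 + (T + 5 + 11) * (Polynomial.X + 1), fun a X S hS hX hv => ?_⟩
  have hloop := runs_forSuffixes (P := seq P (op₂ Bool.or)) (c := b) (d := b + 1)
    (T := T.eval (enc a).length + 5) (fun x : Bool => update S 0 (.bit x :: S 0))
    (fun x s => x || decide (Φ a X (fun i => S (e i)) s)) (enc a) (by omega) (by omega) (by omega)
    false (fun x => by rw [Function.update_of_ne (by omega), hS.2 b le_rfl])
    (by rw [Function.update_of_ne (by omega), hS.2 _ (by omega)])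
    (by rw [Function.update_of_ne (by omega), hS.1]) (by
      intro x s hs
      have hval : ∀ i : Option ι, update (update S 0 (.bit x :: S 0)) b s (i.elim b e) =
          i.elim s fun i => S (e i) := by
        rintro (_ | i)
        · simp
        · have := he i
          change update (update S 0 (.bit x :: S 0)) b s (e i) = S (e i)
          rw [Function.update_of_ne (by omega), Function.update_of_ne (by omega)]
      have hr := hP a X (update (update S 0 (.bit x :: S 0)) b s)
        ⟨by rw [Function.update_of_ne (by omega), Function.update_of_ne (by omega), hS.1],
          fun j hj => by
            rw [Function.update_of_ne (by omega), Function.update_of_ne (by omega),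
              hS.2 j (by omega)]⟩
        (by rw [Function.update_of_ne (by omega), Function.update_of_ne (by omega), hX])
        (by
          intro i
          simp only [hval]
          rcases i with _ | i
          · exact hs
          · exact hv i)
      simp only [hval] at hr
      simp only [Option.elim_none, Option.elim_some] at hr
      refine hr.seq (runs_op₂ (x := x) (y := decide (Φ a X (fun i => S (e i)) s)) (l := S 0) ?_)
        |>.cast rfl ?_ le_rfl
      · simp only [answer, Function.update_self]
        rw [Function.update_of_ne (by omega), Function.update_self]
      · funext j
        grind [Function.update_apply, answer_apply])
  rw [foldl_or] at hloop
  refine (Runs.push 0 _ rfl).seq hloop |>.cast rfl ?_ (by simp)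
  simp [answer]

theorem PTX.all {Φ : α → ((κ → List Symb) → Prop) → (ι → List Symb) → List Symb → Prop}
    (h : PTX (ι := Option ι) enc fun a X v => Φ a X (fun i => v (some i)) (v none)) :
    PTX enc fun a X v => ∀ s, s <:+ enc a → Φ a X v s :=
  (PTX.ex (Φ := fun a X v s => ¬ Φ a X v s) h.not).not.congr fun a X v _ => by
    simp only [not_exists, not_and, not_not]

end Closure

end QCSP

namespace QCSP

open Function (update)
open Prog Classical

namespace Prog

/-! ### Access to truth tables -/

/-- The stacks after the first `i` items of stack `t` have been moved to stack `c`. -/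
def skipState (S : Stacks) (t c i : ℕ) : Stacks :=
  update (update S t ((S t).drop i)) c (((S t).take i).reverse ++ S c)

theorem skipState_apply (S : Stacks) (t c i j : ℕ) : skipState S t c i j =
    if j = c then ((S t).take i).reverse ++ S c else if j = t then (S t).drop i else S j := by
  simp only [skipState, Function.update_apply]

/-- Move `(n + 1) ^ d` items from stack `t` to stack `c`, where `n` is the length of the input. -/
def skipBlock (t c : ℕ) : ℕ → ℕ → Prog
  | 0, _ => moveTop t c
  | d + 1, m => forSuffixes m (m + 1) (skipBlock t c d (m + 1))

/-- The time for moving a block. -/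
noncomputable def nestTime (T : Polynomial ℕ) : ℕ → Polynomial ℕ
  | 0 => T
  | d + 1 => (nestTime T d + 11) * (Polynomial.X + 1)

/-- No arithmetic is needed: a loop over the `n + 1` suffixes of the input multiplies the number of
moved items by `n + 1`, and `d` loops are nested. `skipState` truncates at the end of stack `t`, so
`i` needs no upper bound. -/
theorem runs_skipBlock {t c d m : ℕ} {w : List Symb} {S : Stacks} (htc : t ≠ c) (ht : 1 < t)
    (hc : 1 < c) (htm : t < m) (hcm : c < m) (hw : S 1 = w) (hS : ∀ j, m ≤ j → S j = [])
    (i : ℕ) :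
    Runs (skipBlock t c d m) (skipState S t c i) (skipState S t c (i + (w.length + 1) ^ d))
      ((nestTime 3 d).eval w.length) := by
  induction d generalizing m S i with
  | zero =>
      have hval : skipState S t c i t = (S t).drop i := by grind [skipState_apply, Function.update_apply]
      rcases hl : (S t).drop i with _ | ⟨a, l⟩
      · refine (Runs.case (n := 1) ?_).mono (by simp [nestTime])
        rw [hval, hl]
        refine (Run.skip _).runs.cast rfl ?_ le_rfl
        have h : (S t).length ≤ i := List.drop_eq_nil_iff.1 hl
        simp only [skipState]
        rw [List.drop_eq_nil_of_le h, List.drop_eq_nil_of_le (by simp; omega),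
          List.take_of_length_le h, List.take_of_length_le (by simp; omega)]
      · refine (runs_moveTop htc (hval.trans hl)).cast rfl ?_ (by simp [nestTime])
        have hi : i < (S t).length := by
          by_contra h
          simp [List.drop_eq_nil_of_le (not_lt.1 h)] at hl
        have h₁ : (S t).drop (i + 1) = l := by
          rw [← List.drop_drop, hl]
          rfl
        have h₂ : (S t).take (i + 1) = (S t).take i ++ [a] := by
          rw [List.take_add_one, ← List.head?_drop, hl]
          rfl
        simp only [skipState, pow_zero, h₁, h₂]
        funext j
        grind [Function.update_apply]
  | succ d ih =>
      have h := fun hbody => runs_forSuffixes (P := skipBlock t c d (m + 1)) (c := m) (d := m + 1)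
        (T := (nestTime 3 d).eval w.length) (fun i => skipState S t c i)
        (fun i _ => i + (w.length + 1) ^ d) w (by omega) (by omega) (by omega) i
        (fun i => by clear ih; grind [skipState_apply, Function.update_apply])
        (by
          clear ih
          have := hS (m + 1) (by omega)
          grind [skipState_apply, Function.update_apply])
        (by clear ih; grind [skipState_apply, Function.update_apply]) hbody
      refine (h (by
          intro i s _
          refine (ih (m := m + 1) (S := update S m s) (by omega) (by omega) (by grind)
            (fun j hj => ?_) i).cast ?_ ?_ le_rfl
          · rw [Function.update_of_ne (by omega), hS j (by omega)]
          all_goals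
            clear ih h
            funext j
            grind [skipState_apply, Function.update_apply])).cast rfl ?_ (by simp [nestTime])
      simp [pow_succ, Nat.mul_comm]

/-- Move as many items from stack `t` to stack `c` as the index says that is given by the suffixes
on the stacks `xs`. -/
def skipArgs (t c m : ℕ) : List ℕ → Prog
  | [] => skip
  | x :: xs => seq (copy x m (m + 1))
      (seq (loop m (seq (pop m) (skipBlock t c xs.length (m + 1)))) (skipArgs t c m xs))

/-- The index of a tuple of suffixes in a truth table. -/
def index (n : ℕ) : List (List Symb) → ℕ
  | [] => 0
  | s :: L => s.length * (n + 1) ^ L.length + index n L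

/-- The index is a number in base `n + 1` whose digits are the lengths of the arguments. Each symbol
of an argument moves one block of the size of its place value, that is, `n + 1` to the number of the
arguments that follow. -/
theorem runs_skipArgs {t c m : ℕ} (htc : t ≠ c) (ht : 1 < t)
    (hc : 1 < c) (htm : t < m) (hcm : c < m) (xs : List ℕ) (hxs : ∀ x ∈ xs, x ≠ t ∧ x < c) :
    ∃ T : Polynomial ℕ, ∀ (w : List Symb) (S : Stacks), S 1 = w → (∀ j, m ≤ j → S j = []) →
      (∀ x ∈ xs, S x <:+ w) → ∀ i,
      Runs (skipArgs t c m xs) (skipState S t c i)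
        (skipState S t c (i + index w.length (xs.map S))) (T.eval w.length) := by
  induction xs with
  | nil => exact ⟨1, fun w S _ _ _ i => (Run.skip _).runs.mono (by simp)⟩
  | cons x xs ih =>
      obtain ⟨T, hT⟩ := ih fun y hy => hxs y (List.mem_cons_of_mem _ hy)
      refine ⟨9 * Polynomial.X + 2 + ((nestTime 3 xs.length + 2) * Polynomial.X + 1 + T),
        fun w S hw hS hsuf i => ?_⟩
      have hx := hxs x List.mem_cons_self
      have hlen := (hsuf x List.mem_cons_self).length_le
      have hcopy : Runs (copy x m (m + 1)) (skipState S t c i)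
          (update (skipState S t c i) m (S x)) (9 * (S x).length + 2) := by
        have h := runs_copy (S := skipState S t c i) (s := x) (t := m) (c := m + 1) (by omega)
          (by omega) (by omega) (by grind [skipState_apply, Function.update_apply])
          (by
            have := hS (m + 1) (by omega)
            grind [skipState_apply, Function.update_apply])
        have hval : skipState S t c i x = S x := by grind [skipState_apply, Function.update_apply]
        rwa [hval] at h
      have hloop := Runs.loop (t := m) (P := seq (pop m) (skipBlock t c xs.length (m + 1)))
        (T := 1 + (nestTime 3 xs.length).eval w.length)
        (fun l => update (skipState S t c
          (i + ((S x).length - l.length) * (w.length + 1) ^ xs.length)) m l)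
        (by simp) (S x) (by
          intro a l hl
          have hl' := hl.length_le
          rw [List.length_cons] at hl'
          refine (Runs.pop m rfl).seq ((runs_skipBlock (S := update S m l) htc ht hc
            (m := m + 1) (by omega) (by omega) (w := w) (by grind) (fun j hj => ?_)
            (i + ((S x).length - (a :: l).length) * (w.length + 1) ^ xs.length)).cast
              ?_ ?_ le_rfl)
          · rw [Function.update_of_ne (by omega), hS j (by omega)]
          · funext j
            grind [skipState_apply, Function.update_apply]
          · have : (S x).length - l.length = (S x).length - (a :: l).length + 1 := by
              rw [List.length_cons]
              omega
            rw [this, Nat.add_mul, Nat.one_mul, Nat.add_assoc]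
            funext j
            grind [skipState_apply, Function.update_apply])
      have hrest := hT w S hw hS (fun y hy => hsuf y (List.mem_cons_of_mem _ hy))
        (i + (S x).length * (w.length + 1) ^ xs.length)
      refine hcopy.seq ((hloop.cast ?_ rfl le_rfl).seq (hrest.cast ?_ rfl le_rfl)) |>.cast rfl ?_ ?_
      · simp
      · simp only [List.length_nil, Nat.sub_zero]
        funext j
        grind [skipState_apply, Function.update_apply]
      · simp [index, Nat.add_assoc]
      · simp only [Polynomial.eval_add, Polynomial.eval_mul, Polynomial.eval_X,
          Polynomial.eval_one, Polynomial.eval_ofNat]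
        have h₁ : ((nestTime 3 xs.length).eval w.length + 2) * (S x).length ≤
          ((nestTime 3 xs.length).eval w.length + 2) * w.length := Nat.mul_le_mul_left _ hlen
        linarith

end Prog

/-- With the shortest suffix first, a suffix `s` stands at the place `s.length`. This is why truth
tables use the reversed list of tails. -/
theorem exists_tails_reverse_eq {s w : List Symb} (h : s <:+ w) :
    ∃ A R, w.tails.reverse = A ++ s :: R ∧ A.length = s.length := by
  induction w with
  | nil =>
      obtain rfl := List.suffix_nil.1 h
      exact ⟨[], [], rfl, rfl⟩
  | cons x w ih =>
      rcases List.suffix_cons_iff.1 h with rfl | h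
      · exact ⟨w.tails.reverse, [], by simp, by simp⟩
      · obtain ⟨A, R, hAR, hA⟩ := ih h
        exact ⟨A, R ++ [x :: w], by simp [hAR], hA⟩

theorem exists_table_eq {w : List Symb} {κ : Type} (X : (κ → List Symb) → Prop)
    {u : κ → List Symb} (hu : AreSuffixes w u) (ks : List κ) (v : κ → List Symb) :
    ∃ A R, table w ks X v = A ++ .bit (decide (X fun c => if c ∈ ks then u c else v c)) :: R ∧
      A.length = index w.length (ks.map u) := by
  induction ks generalizing v with
  | nil => exact ⟨[], [], by simp [table], rfl⟩
  | cons c ks ih =>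
      obtain ⟨A, R, hAR, hA⟩ := exists_tails_reverse_eq (hu c)
      obtain ⟨A', R', hAR', hA'⟩ := ih (update v c (u c))
      refine ⟨A.flatMap (fun s => table w ks X (update v c s)) ++ A',
        R' ++ R.flatMap (fun s => table w ks X (update v c s)), ?_, ?_⟩
      · rw [table, hAR, List.flatMap_append, List.flatMap_cons, hAR']
        have : (fun c' => if c' ∈ ks then u c' else update v c (u c) c') =
            fun c' => if c' ∈ c :: ks then u c' else v c' := by
          funext c'
          by_cases h : c' = c
          · subst h
            simp
          · simp [h]
        rw [this]
        simp
      · simp [List.length_flatMap, length_table, hA, hA', index]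

theorem exists_relTable_eq {w : List Symb} {κ : Type} [Fintype κ] (X : (κ → List Symb) → Prop)
    {u : κ → List Symb} (hu : AreSuffixes w u) :
    ∃ A R, relTable w X = A ++ .bit (decide (X u)) :: R ∧
      A.length = index w.length (Finset.univ.toList.map u) := by
  simpa [relTable] using exists_table_eq X hu Finset.univ.toList fun _ => []

theorem length_relTable (w : List Symb) {κ : Type} [Fintype κ] (X : (κ → List Symb) → Prop) :
    (relTable w X).length = (w.length + 1) ^ Fintype.card κ := by
  simp [relTable, length_table]

section Closure

variable {α : Type} {enc : α → List Symb} {κ ι : Type} [Fintype κ]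
  {Φ Ψ : α → ((κ → List Symb) → Prop) → (ι → List Symb) → Prop}

/-- Random access to the table: everything above the wanted entry is moved to stack `b`, the entry
is copied to stack `0`, and the moved part is poured back. -/
theorem PTX.call (g : κ → ι) : PTX enc fun _ (X : (κ → List Symb) → Prop) v => X fun c => v (g c) := by
  intro t b e ht hb he
  obtain ⟨T, hT⟩ := runs_skipArgs (t := t) (c := b) (m := b + 1) (by omega) ht (by omega) (by omega)
    (by omega) (Finset.univ.toList.map fun c => e (g c)) (by
      intro x hx
      obtain ⟨c, -, rfl⟩ := List.mem_map.1 hx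
      have := he (g c)
      omega)
  refine ⟨seq (skipArgs t b (b + 1) (Finset.univ.toList.map fun c => e (g c)))
    (seq (case t fun o => o.elim skip (push 0)) (pour b t)),
    T + (2 + (4 * (Polynomial.X + 1) ^ Fintype.card κ + 1)), fun a X S hS hX hv => ?_⟩
  have hskip := hT (enc a) S hS.1 (fun j hj => hS.2 j (by omega)) (by
    intro x hx
    obtain ⟨c, -, rfl⟩ := List.mem_map.1 hx
    exact hv (g c)) 0
  obtain ⟨A, R, hAR, hA⟩ := exists_relTable_eq X (u := fun c => S (e (g c))) fun c => hv (g c)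
  have hlen := length_relTable (enc a) X
  rw [hAR, List.length_append] at hlen
  rw [List.map_map, Nat.zero_add] at hskip
  have hidx : index (enc a).length (List.map (S ∘ fun c => e (g c)) Finset.univ.toList) =
    A.length := hA.symm
  rw [hidx] at hskip
  have hbe := hS.2 b le_rfl
  let x : Symb := .bit (decide (X fun c => S (e (g c))))
  let S₁ : Stacks := update (update S t (x :: R)) b A.reverse
  let S₂ : Stacks := update S₁ 0 (x :: S 0)
  have h₁ : Runs _ S S₁ _ := hskip.cast (by
    simp only [skipState, List.drop_zero, List.take_zero]
    funext j
    grind [Function.update_apply]) (by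
    simp only [skipState, hX, hAR, List.drop_left, List.take_left, hbe, List.append_nil]
    rfl) le_rfl
  have h₂ : Runs (case t fun o => o.elim skip (push 0)) S₁ S₂ 2 := by
    refine Runs.case (n := 1) ?_
    have hval : S₁ t = x :: R := by grind [Function.update_apply]
    rw [hval]
    refine Runs.push 0 _ ?_
    have hval : S₁ 0 = S 0 := by grind [Function.update_apply]
    rw [hval]
  have h₃ : Runs (pour b t) S₂ _ _ := runs_pour (by omega)
  refine (h₁.seq (h₂.seq h₃)).cast rfl ?_ ?_
  · funext j
    grind [Function.update_apply, answer_apply]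
  · have hval : S₂ b = A.reverse := by grind [Function.update_apply]
    rw [hval]
    simp only [Polynomial.eval_add, Polynomial.eval_mul, Polynomial.eval_X, Polynomial.eval_pow,
          Polynomial.eval_one, Polynomial.eval_ofNat, List.length_reverse]
    omega

theorem PTX.head (i : ι) (p : Option Symb → Prop) :
    PTX enc fun _ (_ : (κ → List Symb) → Prop) v => p (v i).head? := by
  intro t b e ht hb he
  refine ⟨case (e i) fun o => push 0 (.bit (decide (p o))), 2, fun a X S hS hX hv => ?_⟩
  exact (Runs.case (n := 1) (Runs.push 0 _ rfl)).mono (by simp)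

theorem PTX.input {Φ : α → ((κ → List Symb) → Prop) → (ι → List Symb) → List Symb → Prop}
    (h : PTX (ι := Option ι) enc fun a X v => Φ a X (fun i => v (some i)) (v none)) :
    PTX enc fun a X v => Φ a X v (enc a) := by
  intro t b e ht hb he
  -- Stack `1` holds the input and is allowed as an argument stack, so nothing has to be copied.
  obtain ⟨P, T, hP⟩ := h t b (fun i => i.elim 1 e) ht (by omega) (by
    rintro (_ | i)
    · exact ⟨Nat.one_pos, by change 1 < b; omega, by change 1 ≠ t; omega⟩
    · exact he i)
  refine ⟨P, T, fun a X S hS hX hv => ?_⟩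
  have h := hP a X S hS hX (by
    rintro (_ | i)
    · exact hS.1 ▸ List.suffix_rfl
    · exact hv i)
  simp only [Option.elim_some, Option.elim_none, hS.1] at h
  exact h

/-- The argument stacks must survive, so the tail is taken on a copy, which is cleared afterwards.
-/
theorem PTX.tail {Φ : α → ((κ → List Symb) → Prop) → (ι → List Symb) → List Symb → Prop}
    (i : ι) (h : PTX (ι := Option ι) enc fun a X v => Φ a X (fun i => v (some i)) (v none)) :
    PTX enc fun a X v => Φ a X v (v i).tail := by
  intro t b e ht hb he
  obtain ⟨P, T, hP⟩ := h t (b + 1) (fun i => i.elim b e) ht (by omega) (by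
    rintro (_ | i)
    · exact ⟨by change 0 < b; omega, by change b < b + 1; omega, by change b ≠ t; omega⟩
    · exact ⟨(he i).1, (he i).2.1.trans (Nat.lt_succ_self b), (he i).2.2⟩)
  refine ⟨seq (copy (e i) b (b + 1)) (seq (pop b) (seq P (clear b))),
    9 * Polynomial.X + 2 + (1 + (T + (2 * Polynomial.X + 1))), fun a X S hS hX hv => ?_⟩
  have hei := he i
  have hlen : (S (e i)).length ≤ (enc a).length := (hv i).length_le
  have hb₀ := hS.2 b le_rfl
  have hval : ∀ i' : Option ι, update S b (S (e i)).tail (i'.elim b e) =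
      i'.elim (S (e i)).tail fun i => S (e i) := by
    rintro (_ | i')
    · simp
    · have := he i'
      change update S b (S (e i)).tail (e i') = S (e i')
      rw [Function.update_of_ne (by omega)]
  have hr := hP a X (update S b (S (e i)).tail)
    ⟨by rw [Function.update_of_ne (by omega), hS.1], fun j hj => by
      rw [Function.update_of_ne (by omega), hS.2 j (by omega)]⟩
    (by rw [Function.update_of_ne (by omega), hX])
    (by
      intro i'
      simp only [hval]
      rcases i' with _ | i'
      · exact (List.tail_suffix _).trans (hv i)
      · exact hv i')
  simp only [hval] at hr
  simp only [Option.elim_some, Option.elim_none] at hr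
  refine (runs_copy (S := S) (s := e i) (t := b) (c := b + 1) (by omega) (by omega) (by omega)
    hb₀ (hS.2 _ (by omega))).seq ((Runs.pop b ?_).seq (hr.seq runs_clear)) |>.cast rfl ?_ ?_
  · funext j
    grind [Function.update_apply]
  · funext j
    grind [Function.update_apply, answer_apply]
  · have hval' : answer (update S b (S (e i)).tail) (Φ a X (fun i => S (e i)) (S (e i)).tail) b =
        (S (e i)).tail := by
      grind [Function.update_apply, answer_apply]
    rw [hval', List.length_tail]
    simp only [Polynomial.eval_add, Polynomial.eval_mul, Polynomial.eval_X, Polynomial.eval_one,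
      Polynomial.eval_ofNat]
    omega

end Closure

end QCSP

namespace QCSP

open Function (update)
open Prog Classical

namespace Prog

/-! ### Computation of truth tables -/

/-- Execute `Q` for all tuples of suffixes of the input on the stacks `cs`. -/
def nest (d : ℕ) (Q : Prog) : List ℕ → Prog
  | [] => Q
  | c :: cs => forSuffixes c d (nest d Q cs)

theorem eval_nestTime_congr {T U : Polynomial ℕ} {n : ℕ} (h : T.eval n = U.eval n) (d : ℕ) :
    (nestTime T d).eval n = (nestTime U d).eval n := by
  induction d with
  | zero => exact h
  | succ d ih => simp only [nestTime, Polynomial.eval_mul, Polynomial.eval_add, ih,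
      Polynomial.eval_ofNat]

theorem foldl_append_left (L : List (List Symb)) (f : List Symb → List Symb) (x : List Symb) :
    L.foldl (fun x s => f s ++ x) x = L.reverse.flatMap f ++ x := by
  induction L generalizing x with
  | nil => rfl
  | cons s L ih => simp [ih]

/-- The loops run from the longest suffix to the shortest one and every answer is pushed on `o`;
hence the entries end up with the shortest suffixes on top, in the order of `table`. `Good` collects
what the body needs, and is stable under writing to `o` and to the argument stacks. -/
theorem runs_nest {κ : Type} {w : List Symb} {d o T : ℕ} {Q : Prog} {e : κ → ℕ}
    (he : Function.Injective e) (he' : ∀ c, e c ≠ 1 ∧ e c ≠ d ∧ e c ≠ o) (hd : d ≠ 1) (ho : o ≠ 1)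
    (hdo : d ≠ o)
    {Y : (κ → List Symb) → Prop} {Good : Stacks → Prop} (hgood₁ : ∀ S, Good S → S 1 = w ∧ S d = [])
    (hgood₂ : ∀ S l, Good S → Good (update S o l))
    (hgood₃ : ∀ S c s, Good S → s <:+ w → Good (update S (e c) s))
    (hQ : ∀ S, Good S →
      Runs Q S (update S o (.bit (decide (Y fun c => S (e c))) :: S o)) T)
    {ks : List κ} (hks : ks.Nodup) {S : Stacks} (hS : Good S) (hemp : ∀ c ∈ ks, S (e c) = []) :
    Runs (nest d Q (ks.map e)) S (update S o (table w ks Y (fun c => S (e c)) ++ S o))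
      ((nestTime T ks.length).eval w.length) := by
  induction ks generalizing S with
  | nil => simpa [nest, table, nestTime] using hQ S hS
  | cons c ks ih =>
      obtain ⟨hc, hks⟩ := List.nodup_cons.1 hks
      obtain ⟨h₁, h₂, h₃⟩ := he' c
      have h := fun hbody => runs_forSuffixes (P := nest d Q (ks.map e)) (c := e c) (d := d)
        (T := (nestTime T ks.length).eval w.length) (fun x => update S o x)
        (fun x s => table w ks Y (update (fun c => S (e c)) c s) ++ x) w h₁ hd h₂ (S o)
        (fun x => by rw [Function.update_of_ne h₃, hemp c List.mem_cons_self])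
        (by rw [Function.update_of_ne hdo, (hgood₁ S hS).2])
        (by rw [Function.update_of_ne ho.symm, (hgood₁ S hS).1]) hbody
      refine (h fun x s hs => ?_).cast (by simp) ?_ (by simp [nestTime])
      · have hfun : (fun c' => update (update S o x) (e c) s (e c')) =
            update (fun c => S (e c)) c s := by
          funext c'
          by_cases hcc : c' = c
          · subst hcc
            simp
          · rw [Function.update_of_ne (he.ne hcc), Function.update_of_ne hcc,
              Function.update_of_ne (he' c').2.2]
        have hr := ih hks (S := update (update S o x) (e c) s)
          (hgood₃ _ _ _ (hgood₂ _ _ hS) hs) (fun c' hc' => by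
            have hcc : c' ≠ c := fun h => hc (h ▸ hc')
            rw [Function.update_of_ne (he.ne hcc), Function.update_of_ne (he' c').2.2,
              hemp c' (List.mem_cons_of_mem _ hc')])
        rw [hfun] at hr
        refine hr.cast rfl ?_ le_rfl
        clear hfun hr ih h hQ hgood₁ hgood₂ hgood₃ hemp
        funext j
        grind [Function.update_apply]
      · rw [foldl_append_left]
        rfl

/-- Replace the content of stack `t` by the content of stack `o`. -/
def install (t o d : ℕ) : Prog := seq (clear t) (seq (pour o d) (pour d t))

theorem runs_install {t o d : ℕ} (hto : t ≠ o) (htd : t ≠ d) (hod : o ≠ d) {S : Stacks}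
    (hd : S d = []) :
    Runs (install t o d) S (update (update S t (S o)) o [])
      (2 * (S t).length + 8 * (S o).length + 3) := by
  have h₁ : Runs (clear t) S (update S t []) _ := runs_clear
  have h₂ : Runs (pour o d) (update S t []) (update (update (update S t []) o []) d (S o).reverse)
      (4 * (S o).length + 1) := (runs_pour hod).cast rfl
    (by
      funext j
      grind [Function.update_apply])
    (by rw [Function.update_of_ne hto.symm])
  refine (h₁.seq (h₂.seq (runs_pour htd.symm))).cast rfl ?_ ?_
  · funext j
    grind [Function.update_apply]
  · rw [Function.update_self, List.length_reverse]
    linarith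

end Prog

/-! ### Iteration of operators and least fixed points -/

section Closure

variable {α : Type} {enc : α → List Symb} {κ ι : Type} [Fintype κ]

/-- One step of the iteration of an operator on relations on suffixes. -/
def iterStep (enc : α → List Symb) (Φ : α → ((κ → List Symb) → Prop) → (κ → List Symb) → Prop)
    (a : α) (X : (κ → List Symb) → Prop) : (κ → List Symb) → Prop :=
  fun v => AreSuffixes (enc a) v ∧ Φ a X v

/-- The iterates of an operator on relations on suffixes. -/
def iter (enc : α → List Symb) (Φ : α → ((κ → List Symb) → Prop) → (κ → List Symb) → Prop)
    (a : α) (i : ℕ) : (κ → List Symb) → Prop :=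
  (iterStep enc Φ a)^[i] fun _ => False

/-- Each round evaluates `Φ` at all tuples of positions with the current table as `X`, builds the
next table on a separate stack and installs it. A copy of the first table serves as the clock, since
its length is the required number of rounds. The last table is then consulted at the given arguments
and removed. -/
theorem PTX.iter {Φ : α → ((κ → List Symb) → Prop) → (κ → List Symb) → Prop} (h : PTX enc Φ) :
    PT enc fun a v => iter enc Φ a (((enc a).length + 1) ^ Fintype.card κ) v := by
  intro κ' _ t' t e ht' htb he
  -- Layout above the stacks of the caller: `t` (the first free stack of the caller) holds the
  -- current table, `o` the next one, `q` the clock, the stacks `e' c` the loop variables, and the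
  -- stacks from `b` on are free. The table of the caller on `t'` is not touched.
  let r := Fintype.card κ
  let o := t + 1
  let q := t + 2
  let e' : κ → ℕ := fun c => t + 3 + Fintype.equivFin κ c
  let b := t + 3 + r
  have he'b : ∀ c, e' c < b := fun c => Nat.add_lt_add_left (Fin.is_lt _) _
  have he't : ∀ c, t + 3 ≤ e' c := fun c => Nat.le_add_right _ _
  have hinj : Function.Injective e' := fun c c' hcc =>
    (Fintype.equivFin κ).injective (Fin.ext (Nat.add_left_cancel hcc))
  obtain ⟨P, T, hP⟩ := h t b e' (by omega) (by omega) fun c => by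
    have := he'b c
    have := he't c
    omega
  obtain ⟨C, U, hC⟩ := PTX.call (enc := enc) (κ := κ) (ι := κ) id t (t + 1) e (by omega)
    (by omega) fun c => by
      have := he c
      omega
  let L := Finset.univ.toList.map e'
  let fill := nest b (seq P (moveTop 0 o)) L
  let init := nest b (push o (.bit false)) L
  let N : Polynomial ℕ := (Polynomial.X + 1) ^ r
  refine ⟨seq init (seq (install t o b) (seq (copy t q b)
    (seq (loop q (seq (seq fill (install t o b)) (pop q))) (seq C (clear t))))),
    nestTime 1 r + ((10 * N + 3) + ((9 * N + 2) +
      (((nestTime (T + 3) r + (10 * N + 3) + 1 + 1) * N + 1) + (U + (2 * N + 1))))),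
    fun a X S hS hX hv => ?_⟩
  obtain ⟨w, hw⟩ : ∃ w, w = enc a := ⟨_, rfl⟩
  rw [← hw] at hS hv ⊢
  let n := (w.length + 1) ^ r
  have hn : N.eval w.length = n := by simp [N, n]
  have hlen : ∀ X : (κ → List Symb) → Prop, (relTable w X).length = n := length_relTable w
  -- The computation of one table.
  have htab : ∀ (Q : Prog) (T : ℕ) (Y : (κ → List Symb) → Prop) (S' : Stacks) (tab : List Symb),
      (∀ j, t < j → j ≠ q → S' j = []) → S' 1 = w → S' t = tab →
      (∀ S'', Ready w b S'' → S'' t = tab → AreSuffixes w (fun c => S'' (e' c)) →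
        Runs Q S'' (update S'' o (.bit (decide (Y fun c => S'' (e' c))) :: S'' o)) T) →
      Runs (nest b Q L) S' (update S' o (relTable w Y))
        ((nestTime (Polynomial.C T) r).eval w.length) := by
    intro Q T Y S' tab hS' h1 htab hQ
    have hemp : ∀ c, S' (e' c) = [] := fun c => by
      have := he't c
      exact hS' _ (by omega) (by omega)
    have hk := runs_nest (w := w) (d := b) (o := o) (T := T) (Q := Q) (e := e') hinj
      (fun c => by
        have := he't c
        have := he'b c
        omega)
      (by omega) (by omega) (by omega) (Y := Y)
      (Good := fun S'' => Ready w b S'' ∧ S'' t = tab ∧ AreSuffixes w (fun c => S'' (e' c)))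
      (fun S'' h => ⟨h.1.1, h.1.2 b le_rfl⟩)
      (fun S'' l h => by
        refine ⟨⟨?_, fun j hj => ?_⟩, ?_, fun c => ?_⟩
        · rw [Function.update_of_ne (by omega), h.1.1]
        · rw [Function.update_of_ne (by omega), h.1.2 j hj]
        · rw [Function.update_of_ne (by omega), h.2.1]
        · have := he't c
          simp only
          rw [Function.update_of_ne (by omega)]
          exact h.2.2 c)
      (fun S'' c s h hs => by
        have := he't c
        have := he'b c
        refine ⟨⟨?_, fun j hj => ?_⟩, ?_, fun c' => ?_⟩
        · rw [Function.update_of_ne (by omega), h.1.1]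
        · rw [Function.update_of_ne (by omega), h.1.2 j hj]
        · rw [Function.update_of_ne (by omega), h.2.1]
        · by_cases hcc : c' = c
          · subst hcc
            simpa using hs
          · simp only
            rw [Function.update_of_ne (hinj.ne hcc)]
            exact h.2.2 c')
      (fun S'' h => hQ S'' h.1 h.2.1 h.2.2) (ks := Finset.univ.toList)
      (Finset.nodup_toList _) (S := S')
      ⟨⟨h1, fun j hj => hS' j (by omega) (by omega)⟩, htab, fun c => by
        simp only [hemp]
        exact List.nil_suffix⟩
      fun c _ => hemp c
    refine hk.cast rfl ?_ ?_
    · simp only [hemp, relTable]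
      rw [hS' o (by omega) (by omega), List.append_nil]
    · rw [Finset.length_toList, Finset.card_univ]
      exact (eval_nestTime_congr (by simp) _).ge
  have htn : t < q ∧ o < q ∧ q < b ∧ o ≠ t := by omega
  let tab : ℕ → List Symb := fun i => relTable w (QCSP.iter enc Φ a i)
  have htabl : ∀ i, (tab i).length = n := fun i => hlen _
  let base : ℕ → List Symb → Stacks := fun i l => update (update S t (tab i)) q l
  have hbq : ∀ i l, base i l q = l := fun i l => Function.update_self _ _ _
  have hbt : ∀ i l, base i l t = tab i := fun i l => by
    change update (update S t (tab i)) q l t = tab i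
    rw [Function.update_of_ne (by omega), Function.update_self]
  have hbo : ∀ i l j, j ≠ t → j ≠ q → base i l j = S j := fun i l j hjt hjq => by
    change update (update S t (tab i)) q l j = S j
    rw [Function.update_of_ne hjq, Function.update_of_ne hjt]
  have hSt : ∀ j, t ≤ j → S j = [] := hS.2
  have hSo : S o = [] := hSt o (by omega)
  have hSq : S q = [] := hSt q (by omega)
  have hSb : S b = [] := hSt b (by omega)
  have hinit : Runs init S (update S o (tab 0)) ((nestTime 1 r).eval w.length) := by
    have := htab (push o (.bit false)) 1 (fun _ => False) S [] (fun j hj _ => hSt j hj.le) hS.1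
      (hSt t le_rfl) fun S'' _ _ _ => (Runs.push o _ rfl).cast rfl (by simp) le_rfl
    rw [map_one] at this
    exact this
  have hinst : Runs (install t o b) (update S o (tab 0)) (update S t (tab 0))
      ((10 * N + 3).eval w.length) := by
    refine (runs_install (t := t) (o := o) (d := b) (by omega) (by omega) (by omega) ?_).cast
      rfl ?_ ?_
    · rw [Function.update_of_ne (by omega), hSb]
    · clear hC hP htab hv hX
      funext j
      grind [Function.update_apply]
    · rw [Function.update_of_ne (by omega), Function.update_self, hSt t le_rfl, htabl]
      simp only [Polynomial.eval_add, Polynomial.eval_mul, Polynomial.eval_ofNat, hn,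
        List.length_nil]
      omega
  have hcopy : Runs (copy t q b) (update S t (tab 0)) (base 0 (tab 0))
      ((9 * N + 2).eval w.length) := by
    refine (runs_copy (s := t) (t := q) (c := b) (by omega) (by omega) (by omega) ?_ ?_).cast
      rfl ?_ ?_
    · rw [Function.update_of_ne (by omega), hSq]
    · rw [Function.update_of_ne (by omega), hSb]
    · rw [Function.update_self]
    · rw [Function.update_self, htabl]
      simp [hn]
  have hround : ∀ i x l, Runs (seq (seq fill (install t o b)) (pop q)) (base i (x :: l))
      (base (i + 1) l) ((nestTime (T + 3) r + (10 * N + 3) + 1).eval w.length) := by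
    intro i x l
    have h₁ := htab (seq P (moveTop 0 o)) ((T + 3).eval w.length) (QCSP.iter enc Φ a (i + 1))
      (base i (x :: l)) (tab i)
      (fun j hj hjq => by rw [hbo i _ j hj.ne' hjq, hSt j hj.le])
      (by rw [hbo i _ 1 (by omega) (by omega), hS.1]) (hbt i _)
      (fun S'' hS'' htab'' hsuf => by
        rw [hw] at hS'' hsuf
        have h₁ := hP a (QCSP.iter enc Φ a i) S'' hS'' (by rw [htab'']; simp only [tab, hw]) hsuf
        have h₂ : Runs (moveTop 0 o) (answer S'' (Φ a (QCSP.iter enc Φ a i) fun c => S'' (e' c)))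
          _ _ := runs_moveTop (by omega) (Function.update_self _ _ _)
        have hiff : QCSP.iter enc Φ a (i + 1) (fun c => S'' (e' c)) ↔
            Φ a (QCSP.iter enc Φ a i) (fun c => S'' (e' c)) := by
          rw [QCSP.iter, Function.iterate_succ_apply', iterStep]
          exact and_iff_right hsuf
        rw [propext hiff]
        refine (h₁.seq h₂).cast rfl ?_ (by simp [hw])
        clear h₁ h₂ hiff hC hP htab hv hX hsuf hS''
        funext j
        grind [Function.update_apply, answer_apply])
    have h₂ : Runs (install t o b) (update (base i (x :: l)) o (tab (i + 1)))
        (base (i + 1) (x :: l)) ((10 * N + 3).eval w.length) := by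
      refine (runs_install (t := t) (o := o) (d := b) (by omega) (by omega) (by omega) ?_).cast
        rfl ?_ ?_
      · rw [Function.update_of_ne (by omega), hbo i _ b (by omega) (by omega), hSb]
      · clear h₁ hC hP htab hv hX hinit hinst hcopy
        funext j
        grind [Function.update_apply]
      · rw [Function.update_self, Function.update_of_ne (by omega), hbt, htabl, htabl]
        simp only [Polynomial.eval_add, Polynomial.eval_mul, Polynomial.eval_ofNat, hn]
        omega
    have h₃ : Runs (pop q) (base (i + 1) (x :: l)) (base (i + 1) l) 1 :=
      Runs.pop q (by
        rw [hbq, List.tail_cons]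
        exact Function.update_idem _ _ _)
    refine ((Runs.seq ?_ h₂).seq h₃).mono (m := (nestTime (T + 3) r).eval w.length + _ + 1)
      (by simp)
    refine h₁.mono (le_of_eq ?_)
    exact eval_nestTime_congr Polynomial.eval_C r
  have hloop : Runs (loop q (seq (seq fill (install t o b)) (pop q))) (base 0 (tab 0))
      (base n []) (((nestTime (T + 3) r + (10 * N + 3) + 1 + 1) * N + 1).eval w.length) := by
    have h := Runs.loop (t := q) (P := seq (seq fill (install t o b)) (pop q))
      (T := (nestTime (T + 3) r + (10 * N + 3) + 1).eval w.length)
      (fun l => base (n - l.length) l) (fun l => Function.update_self _ _ _) (tab 0) (by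
        intro x l hl
        have hl' := hl.length_le
        rw [htabl, List.length_cons] at hl'
        have : n - l.length = n - (x :: l).length + 1 := by
          rw [List.length_cons]
          omega
        rw [this]
        exact hround _ x l)
    refine h.cast ?_ rfl ?_
    · rw [htabl, Nat.sub_self]
    · rw [htabl]
      simp [hn]
  have hbase : base n [] = update S t (tab n) := by
    have : update S t (tab n) q = [] := by rw [Function.update_of_ne (by omega), hSq]
    rw [← this]
    exact Function.update_eq_self _ _
  have hval : ∀ i, update S t (tab n) (e i) = S (e i) := fun i => by
    have := he i
    rw [Function.update_of_ne (by omega)]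
  have hcall := hC a (QCSP.iter enc Φ a n) (update S t (tab n))
    ⟨by rw [Function.update_of_ne (by omega), hS.1, hw], fun j hj => by
      rw [Function.update_of_ne (by omega), hSt j (by omega)]⟩
    (by rw [Function.update_self]; simp only [tab, hw])
    (by simp only [hval]; rwa [← hw])
  simp only [hval] at hcall
  rw [← hw] at hcall
  refine hinit.seq (hinst.seq (hcopy.seq (hloop.seq
    (Runs.seq (hbase ▸ hcall) runs_clear)))) |>.cast rfl ?_ ?_
  · have hSt' := hSt t le_rfl
    clear hcall hloop hround hcopy hinst hinit hC hP htab hv hX hval hbase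
    funext j
    simp only [id, n, r]
    grind [Function.update_apply, answer_apply]
  · rw [answer_of_pos (by omega), hbt, htabl]
    simp [hn]

/-- A relation is definable if it is the least relation that is closed under a definable monotone
operator. -/
theorem PT.lfp {R : α → (κ → List Symb) → Prop}
    {Φ : α → ((κ → List Symb) → Prop) → (κ → List Symb) → Prop} (h : PTX enc Φ)
    (hmono : ∀ a X Y, (∀ v, X v → Y v) → ∀ v, Φ a X v → Φ a Y v)
    (hclosed : ∀ a v, AreSuffixes (enc a) v → Φ a (R a) v → R a v)
    (hleast : ∀ a X, (∀ v, AreSuffixes (enc a) v → Φ a X v → X v) →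
      ∀ v, AreSuffixes (enc a) v → R a v → X v) : PT enc R := by
  refine (PTX.iter h).congr fun a v hv => ?_
  let N := ((enc a).length + 1) ^ Fintype.card κ
  let Z : ℕ → Set (κ → List Symb) := fun i => {v | iter enc Φ a i v}
  have hZ : ∀ i v, v ∈ Z (i + 1) ↔ AreSuffixes (enc a) v ∧ Φ a (iter enc Φ a i) v := by
    intro i v
    change iter enc Φ a (i + 1) v ↔ _
    rw [iter, Function.iterate_succ_apply']
    rfl
  have hsub : ∀ i, Z i ⊆ Z (i + 1) := by
    intro i
    induction i with
    | zero => exact fun v hv => hv.elim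
    | succ i ih =>
        intro v hv
        rw [hZ] at hv ⊢
        exact ⟨hv.1, hmono a _ _ (fun v hv => ih hv) v hv.2⟩
  let A : Finset (κ → List Symb) := Fintype.piFinset fun _ => (enc a).tails.toFinset
  have hA : A.card ≤ N := by
    refine (Fintype.card_piFinset _).trans_le ?_
    rw [Finset.prod_const, Finset.card_univ]
    exact Nat.pow_le_pow_left ((List.toFinset_card_le _).trans (by simp)) _
  have hZA : ∀ i, Z i ⊆ A := by
    intro i v hv
    rcases i with _ | i
    · exact hv.elim
    · simpa [A, AreSuffixes] using ((hZ i v).1 hv).1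
  have hfin : ∀ i, (Z i).Finite := fun i => A.finite_toSet.subset (hZA i)
  -- The stages increase within a set of at most `N` tuples, so they cannot increase strictly `N +
  -- 1` times. The stage found here is closed under the operator.
  have hstab : ∃ i ≤ N, Z (i + 1) ⊆ Z i := by
    by_contra! hcon
    have hcard : ∀ i, i ≤ N + 1 → i ≤ (Z i).ncard := by
      intro i
      induction i with
      | zero => exact fun _ => Nat.zero_le _
      | succ i ih =>
          intro hi
          have := Set.ncard_lt_ncard ⟨hsub i, hcon i (by omega)⟩ (hfin (i + 1))
          have := ih (by omega)
          omega
    have h₁ := hcard (N + 1) le_rfl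
    have h₂ := Set.ncard_le_ncard (hZA (N + 1)) A.finite_toSet
    rw [Set.ncard_coe_finset] at h₂
    omega
  obtain ⟨i, hi, hstab⟩ := hstab
  have hmonoZ : Monotone Z := monotone_nat_of_le_succ hsub
  change v ∈ Z N ↔ _
  constructor
  · have hle : ∀ i, ∀ v ∈ Z i, R a v := by
      intro i
      induction i with
      | zero => exact fun v hv => hv.elim
      | succ i ih =>
          intro v hv
          rw [hZ] at hv
          exact hclosed a v hv.1 (hmono a _ _ (fun v hv => ih v hv) v hv.2)
    exact hle N v
  · intro hR
    exact hmonoZ hi (hleast a (iter enc Φ a i) (fun v hv hΦ => hstab ((hZ i v).2 ⟨hv, hΦ⟩)) v hv hR)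

end Closure

/-- A definable property is decidable in polynomial time. -/
theorem PT.decidableInPolyTime {α : Type} {enc : α → List Symb} {p : α → Prop}
    (h : PT (ι := Empty) enc fun a _ => p a) : DecidableInPolyTime enc p := by
  obtain ⟨P, T, hP⟩ := h Empty 2 3 (fun i => i.elim) (by omega) (by omega) fun i => i.elim
  -- `PT` always provides the table of some relation; a relation without arguments has a table with
  -- the single entry `false`, which is put on stack `2`.
  let X : (Empty → List Symb) → Prop := fun _ => False
  refine decidableInPolyTime_of_runs
    (seq (push 2 (.bit false)) (seq P (seq (pop 2) (clear 1))))
    (1 + (T + (1 + (2 * Polynomial.X + 1)))) fun a => ?_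
  have hS : update (update (fun _ => []) 1 (enc a)) 2 [.bit false] 1 = enc a := by
    rw [Function.update_of_ne (by omega), Function.update_self]
  have hr := hP a X (update (update (fun _ => []) 1 (enc a)) 2 [.bit false])
    ⟨hS, fun j hj => by rw [Function.update_of_ne (by omega), Function.update_of_ne (by omega)]⟩
    (by simp [relTable, table, X]) fun i => i.elim
  refine ((Runs.push 2 _ (by simp)).seq (hr.seq ((Runs.pop 2 rfl).seq runs_clear))).cast rfl ?_ ?_
  · clear hr hS hP
    funext j
    grind [Function.update_apply, answer_apply]
  · rw [Function.update_of_ne (by omega), answer_of_pos (by omega), hS]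
    simp

/-! ### Finite combinations, tuples of positions, and equality -/

section Closure

variable {α : Type} {enc : α → List Symb} {κ ι : Type} [Fintype κ]

theorem PTX.const (p : Prop) :
    PTX enc fun _ (_ : (κ → List Symb) → Prop) (_ : ι → List Symb) => p := by
  intro t b e ht hb he
  exact ⟨push 0 (.bit (decide p)), 1, fun a X S hS hX hv => (Runs.push 0 _ rfl).mono (by simp)⟩

theorem PTX.forallFin {k : ℕ} {Φ : Fin k → α → ((κ → List Symb) → Prop) → (ι → List Symb) → Prop}
    (h : ∀ j, PTX enc (Φ j)) : PTX enc fun a X v => ∀ j, Φ j a X v := by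
  induction k with
  | zero => exact (PTX.const True).congr fun a X v _ => by simp
  | succ k ih =>
      exact ((h 0).and (ih fun j => h j.succ)).congr fun a X v _ => by rw [Fin.forall_fin_succ]

theorem PTX.existsFin {k : ℕ} {Φ : Fin k → α → ((κ → List Symb) → Prop) → (ι → List Symb) → Prop}
    (h : ∀ j, PTX enc (Φ j)) : PTX enc fun a X v => ∃ j, Φ j a X v :=
  (PTX.forallFin fun j => (h j).not).not.congr fun a X v _ => by simp

theorem PTX.exTuple {k : ℕ}
    {Φ : α → ((κ → List Symb) → Prop) → (ι → List Symb) → (Fin k → List Symb) → Prop}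
    (h : PTX (ι := ι ⊕ Fin k) enc
      fun a X v => Φ a X (fun i => v (.inl i)) (fun j => v (.inr j))) :
    PTX enc fun a X v => ∃ x, AreSuffixes (enc a) x ∧ Φ a X v x := by
  induction k generalizing ι with
  | zero =>
      refine PTX.congr (PTX.reindex h fun i => i.elim id Fin.elim0) fun a X v _ => ?_
      constructor
      · exact fun h => ⟨_, fun j => j.elim0, h⟩
      · rintro ⟨x, -, h⟩
        obtain rfl : x = fun j => j.elim0 := Subsingleton.elim _ _
        exact (congrArg (Φ a X v) (Subsingleton.elim _ _)).mp h
  | succ k ih =>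
      have h' := PTX.ex (Φ := fun a X v s => ∃ x : Fin k → List Symb, AreSuffixes (enc a) x ∧
        Φ a X v (Fin.cons s x)) (ι := ι) (enc := enc) (κ := κ) (by
          refine ih (Φ := fun a X v x => Φ a X (fun i => v (some i)) (Fin.cons (v none) x)) ?_
          refine (PTX.reindex h fun i => i.elim (fun i => .inl (some i)) fun j =>
            Fin.cases (.inl none) .inr j).congr fun a X v _ => ?_
          simp only [Sum.elim_inl, Sum.elim_inr]
          have : (fun j : Fin (k + 1) => v (Fin.cases (.inl none) .inr j)) =
              Fin.cons (v (.inl none)) fun j => v (.inr j) := by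
            funext j
            cases j using Fin.cases <;> rfl
          rw [← this])
      refine h'.congr fun a X v _ => ?_
      constructor
      · rintro ⟨s, hs, x, hx, h⟩
        refine ⟨_, fun j => ?_, h⟩
        cases j using Fin.cases
        · exact hs
        · exact hx _
      · rintro ⟨x, hx, h⟩
        refine ⟨x 0, hx 0, Fin.tail x, fun j => hx j.succ, ?_⟩
        rwa [Fin.cons_self_tail]

theorem PTX.allTuple {k : ℕ}
    {Φ : α → ((κ → List Symb) → Prop) → (ι → List Symb) → (Fin k → List Symb) → Prop}
    (h : PTX (ι := ι ⊕ Fin k) enc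
      fun a X v => Φ a X (fun i => v (.inl i)) (fun j => v (.inr j))) :
    PTX enc fun a X v => ∀ x, AreSuffixes (enc a) x → Φ a X v x :=
  (PTX.exTuple (Φ := fun a X v x => ¬ Φ a X v x) h.not).not.congr fun a X v _ => by
    simp only [not_exists, not_and, not_not]

theorem isSuffix_eq_of_length_eq {s s' w : List Symb} (hs : s <:+ w) (hs' : s' <:+ w)
    (h : s.length = s'.length) : s = s' := by
  obtain ⟨u, rfl⟩ := hs
  obtain ⟨u', hu'⟩ := hs'
  exact (List.append_inj' hu' h.symm).2.symm

/-- Suffixes of the same word are equal as soon as they have the same length, so both arguments are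
shortened simultaneously and the symbols need not be compared. -/
theorem PT.eq : PT enc fun _ (v : Fin 2 → List Symb) => v 0 = v 1 := by
  refine PT.lfp (Φ := fun _ X v => ((v 0).head? = none ∧ (v 1).head? = none) ∨
    ((v 0).head? ≠ none ∧ (v 1).head? ≠ none ∧ X ![(v 0).tail, (v 1).tail])) ?_ ?_ ?_ ?_
  · refine ((PTX.head 0 (· = none)).and (PTX.head 1 (· = none))).or
      ((PTX.head 0 (· ≠ none)).and ((PTX.head 1 (· ≠ none)).and ?_))
    refine PTX.tail (Φ := fun _ X v s => X ![s, (v 1).tail]) 0 ?_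
    refine PTX.tail (Φ := fun _ X v s => X ![v none, s]) (some 1) ?_
    refine (PTX.call (ι := Option (Option (Fin 2))) ![some none, none]).congr fun a X v _ => ?_
    rw [show (fun c => v (![some none, none] c)) = ![v (some none), v none] by
      funext c; fin_cases c <;> rfl]
  · rintro a X Y h v (h' | ⟨h₁, h₂, h'⟩)
    · exact .inl h'
    · exact .inr ⟨h₁, h₂, h _ h'⟩
  · rintro a v hv (⟨h₁, h₂⟩ | ⟨h₁, h₂, h⟩)
    · rw [List.head?_eq_none_iff.1 h₁, List.head?_eq_none_iff.1 h₂]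
    · refine isSuffix_eq_of_length_eq (hv 0) (hv 1) ?_
      rcases h₀ : v 0 with _ | ⟨x, l⟩
      · simp [h₀] at h₁
      rcases h₁ : v 1 with _ | ⟨x, l⟩
      · simp [h₁] at h₂
      simpa [h₀, h₁] using congrArg List.length h
  · intro a X hX
    have : ∀ s, s <:+ enc a → X ![s, s] := by
      intro s
      induction s with
      | nil => exact fun hs => hX _ (fun i => by fin_cases i <;> exact hs) (.inl ⟨rfl, rfl⟩)
      | cons x s ih =>
          refine fun hs => hX _ (fun i => by fin_cases i <;> exact hs)
            (.inr ⟨by simp, by simp, ih ((List.suffix_cons x s).trans hs)⟩)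
    intro v hv h
    have := this _ (hv 0)
    rwa [show ![v 0, v 0] = v by funext i; fin_cases i; exacts [rfl, h]] at this

end Closure

end QCSP

namespace QCSP

open Classical

/-! ### Parsing -/

section Parse

variable {α : Type} {enc : α → List Symb}

/-- `Skip L p r`: the rest `r` remains when a word of the language `L` is read from `p`. -/
def Skip (L : Language Symb) (p r : List Symb) : Prop := ∃ u ∈ L, p = u ++ r

/-- It is decidable in polynomial time whether `Skip L p r`. -/
def Recog (enc : α → List Symb) (L : Language Symb) : Prop :=
  PT enc fun _ (v : Fin 2 → List Symb) => Skip L (v 0) (v 1)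

variable {κ ι : Type} [Fintype κ] {L M : Language Symb} {p q r s : List Symb}

theorem PT.ptx₂ {R : α → List Symb → List Symb → Prop}
    (h : PT enc fun a (v : Fin 2 → List Symb) => R a (v 0) (v 1)) (i j : ι) :
    PTX enc fun a (_ : (κ → List Symb) → Prop) v => R a (v i) (v j) :=
  PT.ptx (PT.reindex h ![i, j])

theorem PTX.call₂ (i j : ι) :
    PTX enc fun _ (X : (Fin 2 → List Symb) → Prop) v => X ![v i, v j] :=
  (PTX.call ![i, j]).congr fun a X v _ => by
    rw [show (fun c => v (![i, j] c)) = ![v i, v j] by funext c; fin_cases c <;> rfl]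

theorem PTX.eq (i j : ι) : PTX enc fun _ (_ : (κ → List Symb) → Prop) v => v i = v j :=
  PT.ptx₂ (R := fun _ p q => p = q) PT.eq i j

theorem PTX.eqCons (c : Symb) (i j : ι) :
    PTX enc fun _ (_ : (κ → List Symb) → Prop) v => v i = c :: v j := by
  have h : PTX enc fun _ (_ : (κ → List Symb) → Prop) (v : ι → List Symb) =>
      (v i).tail = v j :=
    PTX.tail (Φ := fun _ _ v s => s = v j) i (PTX.eq none (some j))
  refine ((PTX.head i (· = some c)).and h).congr fun a X v _ => ?_
  rcases hv : v i with _ | ⟨x, l⟩ <;> simp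

theorem PTX.eqInput (i : ι) : PTX enc fun a (_ : (κ → List Symb) → Prop) v => v i = enc a :=
  PTX.input (Φ := fun _ _ v s => v i = s) (PTX.eq (some i) none)

theorem Recog.ptx (h : Recog enc L) (i j : ι) :
    PTX enc fun _ (_ : (κ → List Symb) → Prop) v => Skip L (v i) (v j) :=
  PT.ptx₂ (R := fun _ => Skip L) h i j

theorem Skip.suffix (h : Skip L p r) : r <:+ p := by
  obtain ⟨u, -, rfl⟩ := h
  exact ⟨u, rfl⟩

theorem skip_one : Skip 1 p r ↔ p = r := by
  simp [Skip, Language.mem_one]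

theorem skip_mul : Skip (L * M) p r ↔ ∃ q, Skip L p q ∧ Skip M q r := by
  constructor
  · rintro ⟨_, hu, rfl⟩
    obtain ⟨x, hx, y, hy, rfl⟩ := Language.mem_mul.1 hu
    exact ⟨y ++ r, ⟨x, hx, by simp⟩, ⟨y, hy, rfl⟩⟩
  · rintro ⟨_, ⟨x, hx, rfl⟩, ⟨y, hy, rfl⟩⟩
    exact ⟨x ++ y, Language.mem_mul.2 ⟨x, hx, y, hy, rfl⟩, by simp⟩

theorem skip_add : Skip (L + M) p r ↔ Skip L p r ∨ Skip M p r := by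
  simp [Skip, Language.mem_add, or_and_right, exists_or]

theorem Recog.mul (hL : Recog enc L) (hM : Recog enc M) : Recog enc (L * M) := by
  intro κ _
  refine (PTX.ex (Φ := fun _ _ v q => Skip L (v 0) q ∧ Skip M q (v 1))
    ((hL.ptx (some 0) none).and (hM.ptx none (some 1)))).congr fun a X v hv => ?_
  refine .trans ?_ skip_mul.symm
  exact ⟨fun ⟨q, _, h⟩ => ⟨q, h⟩, fun ⟨q, h⟩ => ⟨q, h.1.suffix.trans (hv 0), h⟩⟩

theorem Recog.add (hL : Recog enc L) (hM : Recog enc M) : Recog enc (L + M) := by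
  intro κ _
  exact ((hL.ptx 0 1).or (hM.ptx 0 1)).congr fun a X v _ => skip_add.symm

/-- The language that consists of one symbol. -/
def symb (c : Symb) : Language Symb := {[c]}

theorem skip_symb {c : Symb} : Skip (symb c) p r ↔ p = c :: r := by
  constructor
  · rintro ⟨u, rfl, rfl⟩
    rfl
  · rintro rfl
    exact ⟨[c], rfl, rfl⟩

theorem Recog.symb (c : Symb) : Recog enc (symb c) := fun _ _ =>
  (PTX.eqCons c 0 1).congr fun _ _ _ _ => skip_symb.symm

open Computability in
theorem skip_kstar : Skip L∗ p r ↔ p = r ∨ ∃ q, Skip L p q ∧ Skip L∗ q r := by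
  rw [← skip_mul, ← skip_one, ← skip_add, Language.one_add_self_mul_kstar_eq_kstar]

open Computability in
-- Reading a word of `L∗` is reachability along steps that read a word of `L`, a least fixed point.
theorem Recog.kstar (hL : Recog enc L) : Recog enc L∗ := by
  refine PT.lfp (Φ := fun a X v => v 0 = v 1 ∨ ∃ q, q <:+ enc a ∧ (Skip L (v 0) q ∧ X ![q, v 1]))
    ?_ ?_ ?_ ?_
  · exact (PTX.eq 0 1).or (PTX.ex (Φ := fun a X v q => Skip L (v 0) q ∧ X ![q, v 1])
      ((hL.ptx (some 0) none).and (PTX.call₂ none (some 1))))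
  · rintro a X Y h v (h' | ⟨q, hq, h₁, h₂⟩)
    · exact .inl h'
    · exact .inr ⟨q, hq, h₁, h _ h₂⟩
  · rintro a v hv (h | ⟨q, hq, h₁, h₂⟩)
    · exact skip_kstar.2 (.inl h)
    · exact skip_kstar.2 (.inr ⟨q, h₁, h₂⟩)
  · intro a X hX
    have : ∀ l : List (List Symb), (∀ u ∈ l, u ∈ L) → ∀ p r, p <:+ enc a → r <:+ enc a →
        p = l.flatten ++ r → X ![p, r] := by
      intro l
      induction l with
      | nil =>
          intro _ p r hp hr h
          refine hX _ (fun i => ?_) (.inl h)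
          fin_cases i
          exacts [hp, hr]
      | cons u l ih =>
          intro hl p r hp hr h
          have hsuf : Skip L p (l.flatten ++ r) := ⟨u, hl u List.mem_cons_self, by simpa using h⟩
          refine hX _ (fun i => ?_) (.inr ⟨l.flatten ++ r, hsuf.suffix.trans hp, hsuf, ?_⟩)
          · fin_cases i
            exacts [hp, hr]
          · exact ih (fun u hu => hl u (List.mem_cons_of_mem _ hu)) _ _ (hsuf.suffix.trans hp) hr rfl
    rintro v hv ⟨u, hu, h⟩
    obtain ⟨l, rfl, hl⟩ := Language.mem_kstar.1 hu
    have h' := this l hl _ _ (hv 0) (hv 1) h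
    rwa [show ![v 0, v 1] = v by funext i; fin_cases i <;> rfl] at h'

/-! The languages of the encodings -/

open Computability in
/-- Strings of bits, followed by a separator. -/
def numL : Language Symb := (symb (.bit false) + symb (.bit true))∗ * symb .sep

open Computability in
/-- Lists of words of `L`. -/
def listL (L : Language Symb) : Language Symb := symb .opn * (L∗ * symb .cls)

/-- Encodings of variables. -/
def varL : Language Symb := numL * numL

/-- Encodings of sort tables. -/
def sortL : Language Symb := numL * listL numL

/-- Encodings of relation tables. -/
def relL : Language Symb := numL * (listL numL * listL (listL numL))

/-- Encodings of atoms. -/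
def atomL : Language Symb := symb .atom * (numL * listL varL)

theorem recog_numL : Recog enc numL := (((Recog.symb _).add (Recog.symb _)).kstar).mul (Recog.symb _)

theorem Recog.listL (h : Recog enc L) : Recog enc (listL L) :=
  (Recog.symb _).mul (h.kstar.mul (Recog.symb _))

theorem recog_varL : Recog enc varL := recog_numL.mul recog_numL

theorem recog_sortL : Recog enc sortL := recog_numL.mul recog_numL.listL

theorem recog_relL : Recog enc relL :=
  recog_numL.mul (recog_numL.listL.mul recog_numL.listL.listL)

theorem recog_atomL : Recog enc atomL := (Recog.symb _).mul (recog_numL.mul recog_varL.listL)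

/-- The words of `L` are non-empty, do not start with a closing bracket, and none of them is a
proper prefix of another one. -/
structure Prefix (L : Language Symb) : Prop where
  unique : ∀ u ∈ L, ∀ v ∈ L, ∀ r s, u ++ r = v ++ s → u = v ∧ r = s
  head : ∀ u ∈ L, u.head? ≠ none ∧ u.head? ≠ some .cls

theorem Prefix.skip_unique (hL : Prefix L) (h : Skip L p r) (h' : Skip L p s) : r = s := by
  obtain ⟨u, hu, rfl⟩ := h
  obtain ⟨v, hv, h⟩ := h'
  exact (hL.unique u hu v hv r s h).2

theorem Prefix.skip_head (hL : Prefix L) (h : Skip L p r) :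
    p.head? ≠ none ∧ p.head? ≠ some .cls := by
  obtain ⟨u, hu, rfl⟩ := h
  have := hL.head u hu
  rcases u with _ | ⟨x, u⟩
  · simp at this
  · simpa using this

theorem Prefix.mul (hL : Prefix L)
    (hM : ∀ u ∈ M, ∀ v ∈ M, ∀ r s, u ++ r = v ++ s → u = v ∧ r = s) : Prefix (L * M) := by
  constructor
  · intro u hu v hv r s h
    obtain ⟨u₁, hu₁, u₂, hu₂, rfl⟩ := Language.mem_mul.1 hu
    obtain ⟨v₁, hv₁, v₂, hv₂, rfl⟩ := Language.mem_mul.1 hv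
    obtain ⟨rfl, h'⟩ := hL.unique u₁ hu₁ v₁ hv₁ (u₂ ++ r) (v₂ ++ s) (by simpa using h)
    obtain ⟨rfl, h''⟩ := hM u₂ hu₂ v₂ hv₂ r s h'
    exact ⟨rfl, h''⟩
  · intro u hu
    obtain ⟨u₁, hu₁, u₂, hu₂, rfl⟩ := Language.mem_mul.1 hu
    have := hL.head u₁ hu₁
    rcases u₁ with _ | ⟨x, u⟩
    · simp at this
    · simpa using this

theorem symb_unique {c : Symb} : ∀ u ∈ symb c, ∀ v ∈ symb c, ∀ r s : List Symb,
    u ++ r = v ++ s → u = v ∧ r = s := by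
  rintro u rfl v rfl r s h
  exact ⟨rfl, by simpa using h⟩

theorem Prefix.symb {c : Symb} (hc : c ≠ .cls) : Prefix (symb c) :=
  ⟨symb_unique, by
    rintro u rfl
    simpa using hc⟩

open Computability in
-- A reader always knows how to go on: `c` signals the end because no word of `L` begins with it,
-- and otherwise the next word of `L` is determined. This makes numbers and bracketed lists uniquely
-- readable.
theorem Prefix.kstar_mul_unique (hL : Prefix L) {c : Symb} (hc : ∀ u ∈ L, u.head? ≠ some c) :
    ∀ u ∈ L∗ * QCSP.symb c, ∀ v ∈ L∗ * QCSP.symb c, ∀ r s : List Symb,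
    u ++ r = v ++ s → u = v ∧ r = s := by
  intro u hu v hv r s h
  obtain ⟨_, hu', _, rfl, rfl⟩ := Language.mem_mul.1 hu
  obtain ⟨_, hv', _, rfl, rfl⟩ := Language.mem_mul.1 hv
  obtain ⟨l, rfl, hl⟩ := Language.mem_kstar.1 hu'
  obtain ⟨m, rfl, hm⟩ := Language.mem_kstar.1 hv'
  clear hu hu' hv hv'
  revert hm
  have hne : ∀ u ∈ L, ∀ x y : List Symb, u ++ x ≠ c :: y := by
    rintro u hu x y h
    have h₁ := hL.head u hu
    have h₂ := hc u hu
    rcases u with _ | ⟨z, u⟩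
    · simp at h₁
    · simp only [List.cons_append, List.cons.injEq] at h
      simp [h.1] at h₂
  induction l generalizing m with
  | nil =>
      intro hm
      rcases m with _ | ⟨v, m⟩
      · exact ⟨rfl, by simpa using h⟩
      · exact absurd (by simpa using h.symm) (hne v (hm v List.mem_cons_self) (m.flatten ++ [c] ++ s) r)
  | cons u l ih =>
      intro hm
      rcases m with _ | ⟨v, m⟩
      · exact absurd (by simpa using h) (hne u (hl u List.mem_cons_self) (l.flatten ++ [c] ++ r) s)
      · obtain ⟨rfl, h'⟩ := hL.unique u (hl u List.mem_cons_self) v (hm v List.mem_cons_self)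
          (l.flatten ++ [c] ++ r) (m.flatten ++ [c] ++ s) (by simpa using h)
        obtain ⟨h₁, h₂⟩ := ih (fun u hu => hl u (List.mem_cons_of_mem _ hu)) m (by simpa using h')
          (fun u hu => hm u (List.mem_cons_of_mem _ hu))
        exact ⟨by simpa using h₁, h₂⟩

open Computability in
theorem Prefix.numL : Prefix numL := by
  have hbit : Prefix (QCSP.symb (.bit false) + QCSP.symb (.bit true)) := by
    constructor
    · rintro u (rfl | rfl) v (rfl | rfl) r s h <;> simp at h ⊢ <;> exact h
    · rintro u (rfl | rfl) <;> simp
  have huni := hbit.kstar_mul_unique (c := .sep) (by rintro u (rfl | rfl) <;> simp)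
  refine ⟨huni, fun u hu => ?_⟩
  obtain ⟨_, hu', _, rfl, rfl⟩ := Language.mem_mul.1 hu
  obtain ⟨l, rfl, hl⟩ := Language.mem_kstar.1 hu'
  rcases l with _ | ⟨v, l⟩
  · simp
  · rcases hl v List.mem_cons_self with rfl | rfl <;> simp

theorem Prefix.listL (hL : Prefix L) : Prefix (listL L) :=
  (Prefix.symb (by simp)).mul (hL.kstar_mul_unique fun u hu => (hL.head u hu).2)

theorem Prefix.varL : Prefix varL := Prefix.numL.mul Prefix.numL.unique

theorem Prefix.sortL : Prefix sortL := Prefix.numL.mul Prefix.numL.listL.unique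

theorem Prefix.relL : Prefix relL :=
  Prefix.numL.mul (Prefix.numL.listL.mul Prefix.numL.listL.listL.unique).unique

open Computability in
/-- The positions in the encoding of a list. -/
theorem Prefix.skip_kstar_flatMap (hL : Prefix L) {A : Type} {f : A → List Symb}
    (hf : ∀ x, f x ∈ L) (l : List A) (r e : List Symb) :
    Skip L∗ (l.flatMap f ++ .cls :: r) e ↔
      ∃ l₁ l₂, l = l₁ ++ l₂ ∧ e = l₂.flatMap f ++ .cls :: r := by
  constructor
  · rintro ⟨_, hu, h⟩
    obtain ⟨m, rfl, hm⟩ := Language.mem_kstar.1 hu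
    clear hu
    induction m generalizing l with
    | nil => exact ⟨[], l, rfl, by simpa using h.symm⟩
    | cons u m ih =>
        have hu := hm u List.mem_cons_self
        rcases l with _ | ⟨x, l⟩
        · have h₁ := hL.head u hu
          rcases u with _ | ⟨y, u⟩
          · simp at h₁
          · simp only [List.flatMap_nil, List.nil_append, List.flatten_cons, List.cons_append,
              List.cons.injEq] at h
            simp [← h.1] at h₁
        · obtain ⟨-, h'⟩ := hL.unique (f x) (hf x) u hu (l.flatMap f ++ .cls :: r)
            (m.flatten ++ e) (by simpa using h)
          obtain ⟨l₁, l₂, rfl, rfl⟩ := ih l (fun u hu => hm u (List.mem_cons_of_mem _ hu)) h'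
          exact ⟨x :: l₁, l₂, rfl, rfl⟩
  · rintro ⟨l₁, l₂, rfl, rfl⟩
    refine ⟨l₁.flatMap f, Language.mem_kstar.2 ⟨l₁.map f, by simp [List.flatMap], ?_⟩, by simp⟩
    intro u hu
    obtain ⟨x, -, rfl⟩ := List.mem_map.1 hu
    exact hf x

open Computability in
theorem encodeNat_mem (n : ℕ) : encodeNat n ∈ numL := by
  refine Language.mem_mul.2 ⟨_, Language.mem_kstar.2 ⟨n.bits.map fun b => [.bit b], rfl, ?_⟩, _,
    rfl, ?_⟩
  · intro u hu
    obtain ⟨b, -, rfl⟩ := List.mem_map.1 hu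
    rcases b with _ | _
    exacts [.inl rfl, .inr rfl]
  · rw [encodeNat, ← List.flatMap_def, ← List.map_eq_flatMap]

open Computability in
theorem encodeList_mem {A : Type} {f : A → List Symb} {l : List A} (hf : ∀ x ∈ l, f x ∈ L) :
    encodeList f l ∈ listL L := by
  refine Language.mem_mul.2 ⟨[.opn], rfl, l.flatMap f ++ [.cls],
    Language.mem_mul.2 ⟨l.flatMap f, Language.mem_kstar.2 ⟨l.map f, rfl, ?_⟩, [.cls], rfl, rfl⟩, rfl⟩
  intro u hu
  obtain ⟨x, hx, rfl⟩ := List.mem_map.1 hu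
  exact hf x hx

theorem Var.encode_mem (x : Var) : x.encode ∈ varL :=
  Language.mem_mul.2 ⟨_, encodeNat_mem _, _, encodeNat_mem _, rfl⟩

theorem SortTable.encode_mem (T : SortTable) : T.encode ∈ sortL :=
  Language.mem_mul.2 ⟨_, encodeNat_mem _, _, encodeList_mem fun _ _ => encodeNat_mem _, rfl⟩

theorem RelTable.encode_mem (T : RelTable) : T.encode ∈ relL :=
  Language.mem_mul.2 ⟨_, encodeNat_mem T.symbol, _, Language.mem_mul.2
    ⟨_, encodeList_mem (l := T.arity) fun _ _ => encodeNat_mem _, _,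
      encodeList_mem (l := T.tuples) fun _ _ => encodeList_mem fun _ _ => encodeNat_mem _, rfl⟩,
    (List.append_assoc _ _ _).symm⟩

theorem encodeNat_injective : Function.Injective encodeNat := by
  intro m n h
  have h' := List.append_cancel_right h
  have hinj : Function.Injective Symb.bit := fun a b h => by simpa using h
  have h₂ := List.map_injective_iff.2 hinj h'
  exact Nat.digits_inj_iff.1 (by rw [Nat.digits_two_eq_bits, Nat.digits_two_eq_bits, h₂])

theorem encodeNat_append_inj {m n : ℕ} (h : encodeNat m ++ r = encodeNat n ++ s) :
    m = n ∧ r = s := by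
  obtain ⟨h₁, h₂⟩ := Prefix.numL.unique _ (encodeNat_mem m) _ (encodeNat_mem n) _ _ h
  exact ⟨encodeNat_injective h₁, h₂⟩

theorem Var.encode_append_inj {x y : Var} (h : x.encode ++ r = y.encode ++ s) :
    x = y ∧ r = s := by
  simp only [Var.encode, List.append_assoc] at h
  obtain ⟨h₁, h⟩ := encodeNat_append_inj h
  obtain ⟨h₂, h⟩ := encodeNat_append_inj h
  exact ⟨Var.ext h₁ h₂, h⟩

/-- The same word of `L` is read from `p` and from `q`. -/
def Same (L : Language Symb) (p q : List Symb) : Prop :=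
  ∃ u ∈ L, ∃ r s, p = u ++ r ∧ q = u ++ s

end Parse

end QCSP

namespace QCSP

open Classical

/-! ### Formulas as words -/

section Forms

variable {α : Type} {enc : α → List Symb} {κ ι : Type} [Fintype κ] {L M : Language Symb}
  {p q r s u : List Symb}

open Computability in
theorem mem_numL : u ∈ numL ↔ ∃ l : List Bool, u = l.map .bit ++ [.sep] := by
  constructor
  · intro hu
    obtain ⟨_, hu', _, rfl, rfl⟩ := Language.mem_mul.1 hu
    obtain ⟨l, rfl, hl⟩ := Language.mem_kstar.1 hu'
    clear hu hu'
    induction l with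
    | nil => exact ⟨[], rfl⟩
    | cons v l ih =>
        obtain ⟨m, hm⟩ := ih fun u hu => hl u (List.mem_cons_of_mem _ hu)
        rcases hl v List.mem_cons_self with rfl | rfl
        · exact ⟨false :: m, by simpa using hm⟩
        · exact ⟨true :: m, by simpa using hm⟩
  · rintro ⟨l, rfl⟩
    refine Language.mem_mul.2 ⟨_, Language.mem_kstar.2 ⟨l.map fun b => [.bit b], rfl, ?_⟩, _,
      rfl, ?_⟩
    · intro u hu
      obtain ⟨b, -, rfl⟩ := List.mem_map.1 hu
      rcases b with _ | _
      exacts [.inl rfl, .inr rfl]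
    · simp [← List.flatMap_def, ← List.map_eq_flatMap]

/-- The recursion behind the fixed point that compares two numbers bit by bit. -/
theorem same_numL_iff : Same numL p q ↔ (p.head? = some .sep ∧ q.head? = some .sep) ∨
    ∃ b p' q', p = .bit b :: p' ∧ q = .bit b :: q' ∧ Same numL p' q' := by
  simp only [Same, mem_numL]
  constructor
  · rintro ⟨_, ⟨l, rfl⟩, r, s, rfl, rfl⟩
    rcases l with _ | ⟨b, l⟩
    · simp
    · exact .inr ⟨b, _, _, rfl, rfl, _, ⟨l, rfl⟩, _, _, rfl, rfl⟩
  · rintro (⟨h₁, h₂⟩ | ⟨b, _, _, rfl, rfl, _, ⟨l, rfl⟩, r, s, rfl, rfl⟩)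
    · obtain ⟨p', rfl⟩ := List.head?_eq_some_iff.1 h₁
      obtain ⟨q', rfl⟩ := List.head?_eq_some_iff.1 h₂
      exact ⟨_, ⟨[], rfl⟩, p', q', rfl, rfl⟩
    · exact ⟨_, ⟨b :: l, rfl⟩, r, s, rfl, rfl⟩

theorem pt_same_numL : PT enc fun _ (v : Fin 2 → List Symb) => Same numL (v 0) (v 1) := by
  have step : ∀ b : Bool, PTX enc fun a (X : (Fin 2 → List Symb) → Prop) (v : Fin 2 → _) =>
      ∃ p, p <:+ enc a ∧ ∃ q, q <:+ enc a ∧ (v 0 = .bit b :: p ∧ v 1 = .bit b :: q ∧ X ![p, q]) :=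
    fun b => PTX.ex (Φ := fun a X v p => ∃ q, q <:+ enc a ∧
        (v 0 = .bit b :: p ∧ v 1 = .bit b :: q ∧ X ![p, q]))
      (PTX.ex (Φ := fun a X v q =>
        (v (some 0) = .bit b :: v none ∧ v (some 1) = .bit b :: q ∧ X ![v none, q]))
      ((PTX.eqCons _ (some (some 0)) (some none)).and
        ((PTX.eqCons _ (some (some 1)) none).and (PTX.call₂ (some none) none))))
  refine PT.lfp ((((PTX.head 0 (· = some .sep)).and (PTX.head 1 (· = some .sep))).or
    ((step false).or (step true)))) ?_ ?_ ?_
  · rintro a X Y h v (h' | ⟨p, hp, q, hq, h₁, h₂, h₃⟩ | ⟨p, hp, q, hq, h₁, h₂, h₃⟩)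
    · exact .inl h'
    · exact .inr (.inl ⟨p, hp, q, hq, h₁, h₂, h _ h₃⟩)
    · exact .inr (.inr ⟨p, hp, q, hq, h₁, h₂, h _ h₃⟩)
  · rintro a v hv (h' | ⟨p, hp, q, hq, h₁, h₂, h₃⟩ | ⟨p, hp, q, hq, h₁, h₂, h₃⟩) <;>
      rw [same_numL_iff]
    · exact .inl h'
    · exact .inr ⟨_, _, _, h₁, h₂, h₃⟩
    · exact .inr ⟨_, _, _, h₁, h₂, h₃⟩
  · intro a X hX
    have : ∀ l : List Bool, ∀ p q r s, p <:+ enc a → q <:+ enc a → p = l.map .bit ++ .sep :: r →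
        q = l.map .bit ++ .sep :: s → X ![p, q] := by
      intro l
      induction l with
      | nil =>
          rintro _ _ r s hp hq rfl rfl
          refine hX _ (fun i => ?_) (.inl ⟨rfl, rfl⟩)
          fin_cases i
          exacts [hp, hq]
      | cons b l ih =>
          rintro _ _ r s hp hq rfl rfl
          have hp' := (List.suffix_cons _ _).trans hp
          have hq' := (List.suffix_cons _ _).trans hq
          have hX' := ih _ _ r s hp' hq' rfl rfl
          refine hX _ (fun i => ?_) (.inr ?_)
          · fin_cases i
            exacts [hp, hq]
          · rcases b with _ | _
            exacts [.inl ⟨_, hp', _, hq', rfl, rfl, hX'⟩, .inr ⟨_, hp', _, hq', rfl, rfl, hX'⟩]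
    rintro v hv ⟨_, hu, r, s, h₁, h₂⟩
    obtain ⟨l, rfl⟩ := mem_numL.1 hu
    have h' := this l _ _ r s (hv 0) (hv 1) (by simpa using h₁) (by simpa using h₂)
    rwa [show ![v 0, v 1] = v by funext i; fin_cases i <;> rfl] at h'

theorem same_mul : Same (L * M) p q ↔
    ∃ u ∈ L, ∃ r s, p = u ++ r ∧ q = u ++ s ∧ Same M r s := by
  constructor
  · rintro ⟨_, hu, r, s, rfl, rfl⟩
    obtain ⟨u, hu', v, hv, rfl⟩ := Language.mem_mul.1 hu
    exact ⟨u, hu', v ++ r, v ++ s, by simp, by simp, v, hv, r, s, rfl, rfl⟩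
  · rintro ⟨u, hu, _, _, rfl, rfl, v, hv, r, s, rfl, rfl⟩
    exact ⟨u ++ v, Language.mem_mul.2 ⟨u, hu, v, hv, rfl⟩, r, s, by simp, by simp⟩

/-- Since `numL` is uniquely readable, the two components of a variable can be compared one after
the other, from the positions where they start. -/
theorem same_varL_iff : Same varL p q ↔
    Same numL p q ∧ ∃ r, Skip numL p r ∧ ∃ s, Skip numL q s ∧ Same numL r s := by
  rw [varL, same_mul]
  constructor
  · rintro ⟨u, hu, r, s, rfl, rfl, h⟩
    exact ⟨⟨u, hu, r, s, rfl, rfl⟩, r, ⟨u, hu, rfl⟩, s, ⟨u, hu, rfl⟩, h⟩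
  · rintro ⟨⟨u, hu, r, s, rfl, rfl⟩, r', h₁, s', h₂, h⟩
    rw [Prefix.numL.skip_unique h₁ ⟨u, hu, rfl⟩, Prefix.numL.skip_unique h₂ ⟨u, hu, rfl⟩] at h
    exact ⟨u, hu, r, s, rfl, rfl, h⟩

theorem pt_same_varL : PT enc fun _ (v : Fin 2 → List Symb) => Same varL (v 0) (v 1) := by
  intro κ _
  refine (PTX.and (PT.ptx₂ (R := fun _ => Same numL) pt_same_numL 0 1)
    (PTX.ex (Φ := fun a _ v r => Skip numL (v 0) r ∧ ∃ s, s <:+ enc a ∧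
      (Skip numL (v 1) s ∧ Same numL r s))
    ((recog_numL.ptx (some 0) none).and
      (PTX.ex (Φ := fun a _ v s => Skip numL (v (some 1)) s ∧ Same numL (v none) s)
      ((recog_numL.ptx (some (some 1)) none).and
        (PT.ptx₂ (R := fun _ => Same numL) pt_same_numL (some none) none)))))).congr ?_
  intro a X v hv
  refine .trans ?_ same_varL_iff.symm
  constructor
  · rintro ⟨h, r, -, h₁, s, -, h₂, h₃⟩
    exact ⟨h, r, h₁, s, h₂, h₃⟩
  · rintro ⟨h, r, h₁, s, h₂, h₃⟩
    exact ⟨h, r, h₁.suffix.trans (hv 0), h₁, s, h₂.suffix.trans (hv 1), h₂, h₃⟩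

/-- The number `c` is written at `b`. -/
def ReadsNat (b : List Symb) (c : ℕ) : Prop := ∃ r, b = encodeNat c ++ r

/-- The variable `u` is written at `x`. -/
def Reads (x : List Symb) (u : Var) : Prop := ∃ r, x = u.encode ++ r

theorem ReadsNat.unique {b : List Symb} {c d : ℕ} (h : ReadsNat b c) (h' : ReadsNat b d) :
    c = d := by
  obtain ⟨r, rfl⟩ := h
  obtain ⟨s, h⟩ := h'
  exact (encodeNat_append_inj h).1

theorem Reads.unique {x : List Symb} {u v : Var} (h : Reads x u) (h' : Reads x v) : u = v := by
  obtain ⟨r, rfl⟩ := h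
  obtain ⟨s, h⟩ := h'
  exact (Var.encode_append_inj h).1

theorem Reads.ne_nil {x : List Symb} {u : Var} (h : Reads x u) : x ≠ [] := by
  rintro rfl
  obtain ⟨r, h⟩ := h
  simp [Var.encode, encodeNat] at h

theorem same_numL_left {c : ℕ} : Same numL (encodeNat c ++ r) q ↔ ReadsNat q c := by
  constructor
  · rintro ⟨u, hu, r', s, h, rfl⟩
    obtain ⟨rfl, -⟩ := Prefix.numL.unique _ (encodeNat_mem c) _ hu _ _ h
    exact ⟨s, rfl⟩
  · rintro ⟨s, rfl⟩
    exact ⟨_, encodeNat_mem c, r, s, rfl, rfl⟩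

theorem same_varL_left {v : Var} : Same varL (v.encode ++ r) q ↔ Reads q v := by
  constructor
  · rintro ⟨u, hu, r', s, h, rfl⟩
    obtain ⟨rfl, -⟩ := Prefix.varL.unique _ v.encode_mem _ hu _ _ h
    exact ⟨s, rfl⟩
  · rintro ⟨s, rfl⟩
    exact ⟨_, v.encode_mem, r, s, rfl, rfl⟩

/-- Words that have the shape of a formula of depth at most `n`. -/
def formOfDepth : ℕ → Language Symb
  | 0 => 0
  | n + 1 => atomL + (symb .all * (varL * formOfDepth n) + (symb .ex * (varL * formOfDepth n) +
      symb .conj * listL (formOfDepth n)))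

/-- Words that have the shape of a formula. -/
def formL : Language Symb := {u | ∃ n, u ∈ formOfDepth n}

theorem listL_mono (h : L ≤ M) : listL L ≤ listL M := by
  unfold listL
  gcongr

theorem formOfDepth_mono : Monotone formOfDepth := by
  refine monotone_nat_of_le_succ fun n => ?_
  induction n with
  | zero => exact bot_le
  | succ n ih =>
      have := listL_mono ih
      rw [formOfDepth, formOfDepth]
      gcongr

theorem head_symb_mul {c : Symb} (h : u ∈ symb c * L) : u.head? = some c := by
  obtain ⟨_, rfl, v, -, rfl⟩ := Language.mem_mul.1 h
  rfl

theorem Prefix.add (hL : Prefix L) (hM : Prefix M)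
    (h : ∀ u ∈ L, ∀ v ∈ M, u.head? ≠ v.head?) : Prefix (L + M) := by
  have key : ∀ u ∈ L, ∀ v ∈ M, ∀ r s : List Symb, u ++ r ≠ v ++ s := by
    intro u hu v hv r s e
    have h₁ := hL.head u hu
    have h₂ := hM.head v hv
    have h₃ := h u hu v hv
    rcases u with _ | ⟨x, u⟩
    · simp at h₁
    · rcases v with _ | ⟨y, v⟩
      · simp at h₂
      · simp at e h₃
        exact h₃ e.1
  constructor
  · rintro u (hu | hu) v (hv | hv) r s e
    · exact hL.unique u hu v hv r s e
    · exact absurd e (key u hu v hv r s)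
    · exact absurd e.symm (key v hv u hu s r)
    · exact hM.unique u hu v hv r s e
  · rintro u (hu | hu)
    exacts [hL.head u hu, hM.head u hu]

/-- The first symbol tells the four kinds of formulas apart, and each kind is a product of uniquely
readable parts of smaller depth. -/
theorem Prefix.formOfDepth (n : ℕ) : Prefix (formOfDepth n) := by
  induction n with
  | zero => exact ⟨fun u hu => hu.elim, fun u hu => hu.elim⟩
  | succ n ih =>
      have hv := (Prefix.varL.mul ih.unique).unique
      refine .add ((Prefix.symb (by simp)).mul (Prefix.numL.mul Prefix.varL.listL.unique).unique)
        (.add ((Prefix.symb (by simp)).mul hv) (.add ((Prefix.symb (by simp)).mul hv)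
        ((Prefix.symb (by simp)).mul ih.listL.unique) ?_) ?_) ?_
      · intro u hu v hv
        simp [head_symb_mul hu, head_symb_mul hv]
      · rintro u hu v (hv | hv) <;> simp [head_symb_mul hu, head_symb_mul hv]
      · intro u hu v hv
        have hu' : u.head? = some .atom := head_symb_mul hu
        rcases hv with hv | hv | hv <;> simp [hu', head_symb_mul hv]

theorem Prefix.formL : Prefix formL := by
  constructor
  · rintro u ⟨m, hu⟩ v ⟨n, hv⟩
    exact (Prefix.formOfDepth (max m n)).unique u (formOfDepth_mono (le_max_left m n) hu) v
      (formOfDepth_mono (le_max_right m n) hv)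
  · rintro u ⟨m, hu⟩
    exact (Prefix.formOfDepth m).head u hu

theorem atomL_le : atomL ≤ formL := fun _ hu => ⟨1, .inl hu⟩

theorem all_le : symb .all * (varL * formL) ≤ formL := by
  intro u hu
  obtain ⟨a, ha, b, hb, rfl⟩ := Language.mem_mul.1 hu
  obtain ⟨v, hv, w, ⟨n, hw⟩, rfl⟩ := Language.mem_mul.1 hb
  exact ⟨n + 1, .inr (.inl ⟨a, ha, _, ⟨v, hv, w, hw, rfl⟩, rfl⟩)⟩

theorem ex_le : symb .ex * (varL * formL) ≤ formL := by
  intro u hu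
  obtain ⟨a, ha, b, hb, rfl⟩ := Language.mem_mul.1 hu
  obtain ⟨v, hv, w, ⟨n, hw⟩, rfl⟩ := Language.mem_mul.1 hb
  exact ⟨n + 1, .inr (.inr (.inl ⟨a, ha, _, ⟨v, hv, w, hw, rfl⟩, rfl⟩))⟩

open Computability in
theorem conj_le : symb .conj * listL formL ≤ formL := by
  intro u hu
  obtain ⟨a, ha, b, hb, rfl⟩ := Language.mem_mul.1 hu
  obtain ⟨o, ho, b', hb', rfl⟩ := Language.mem_mul.1 hb
  obtain ⟨l, hl, d, hd, rfl⟩ := Language.mem_mul.1 hb'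
  obtain ⟨l, rfl, hl'⟩ := Language.mem_kstar.1 hl
  have : ∃ n, ∀ u ∈ l, u ∈ formOfDepth n := by
    clear hb hu hb' hl
    induction l with
    | nil => exact ⟨0, by simp⟩
    | cons v l ih =>
        obtain ⟨n, hn⟩ := ih fun u hu => hl' u (List.mem_cons_of_mem _ hu)
        obtain ⟨m, hm⟩ := hl' v List.mem_cons_self
        refine ⟨max m n, fun u hu => ?_⟩
        rcases List.mem_cons.1 hu with rfl | hu
        · exact formOfDepth_mono (le_max_left m n) hm
        · exact formOfDepth_mono (le_max_right m n) (hn u hu)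
  obtain ⟨n, hn⟩ := this
  exact ⟨n + 1, .inr (.inr (.inr ⟨a, ha, _, ⟨o, ho, _, ⟨_, Language.mem_kstar.2 ⟨l, rfl, hn⟩, d, hd,
    rfl⟩, rfl⟩, rfl⟩))⟩

theorem QCFormula.encode_mem (φ : QCFormula) : φ.encode ∈ formL := by
  induction φ with
  | atom R vs =>
      exact atomL_le (Language.mem_mul.2 ⟨_, rfl, _, Language.mem_mul.2 ⟨_, encodeNat_mem R, _,
        encodeList_mem (l := vs) fun x _ => x.encode_mem, rfl⟩, rfl⟩)
  | conj n ψ ih =>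
      refine conj_le (Language.mem_mul.2 ⟨_, rfl, _, encodeList_mem (f := id) ?_, rfl⟩)
      intro u hu
      obtain ⟨c, rfl⟩ := List.mem_ofFn.1 hu
      exact ih c
  | all y ψ ih =>
      exact all_le (Language.mem_mul.2 ⟨_, rfl, _, Language.mem_mul.2 ⟨_, y.encode_mem, _, ih, rfl⟩,
        rfl⟩)
  | ex y ψ ih =>
      exact ex_le (Language.mem_mul.2 ⟨_, rfl, _, Language.mem_mul.2 ⟨_, y.encode_mem, _, ih, rfl⟩,
        rfl⟩)

theorem Skip.mono (hLM : L ≤ M) (h : Skip L p r) : Skip M p r := by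
  obtain ⟨u, hu, rfl⟩ := h
  exact ⟨u, hLM hu, rfl⟩

open Computability in
-- Sequences of formulas are easier to recognise than single ones, because one binary relation then
-- serves both for the arguments of conjunctions and for what follows. A quantifier with its
-- variable may be put in front of a non-empty sequence, where it binds the first formula; the
-- condition `¬ q = v 1` says that the sequence is non-empty. A conjunction is a bracketed sequence,
-- followed by another sequence.
theorem Recog.formL : Recog enc formL∗ := by
  have quant : ∀ c : Symb, PTX enc fun a (X : (Fin 2 → List Symb) → Prop) (v : Fin 2 → _) =>
      ∃ q, q <:+ enc a ∧ (Skip (QCSP.symb c * varL) (v 0) q ∧ ¬ q = v 1 ∧ X ![q, v 1]) := fun c =>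
    PTX.ex (Φ := fun a X v q => Skip (QCSP.symb c * varL) (v 0) q ∧ ¬ q = v 1 ∧ X ![q, v 1])
      ((((Recog.symb c).mul recog_varL).ptx (some 0) none).and
        ((PTX.eq none (some 1)).not.and (PTX.call₂ none (some 1))))
  have atm : PTX enc fun a (X : (Fin 2 → List Symb) → Prop) (v : Fin 2 → _) =>
      ∃ q, q <:+ enc a ∧ (Skip atomL (v 0) q ∧ X ![q, v 1]) :=
    PTX.ex (Φ := fun a X v q => Skip atomL (v 0) q ∧ X ![q, v 1])
      ((recog_atomL.ptx (some 0) none).and (PTX.call₂ none (some 1)))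
  have cnj : PTX enc fun a (X : (Fin 2 → List Symb) → Prop) (v : Fin 2 → _) =>
      ∃ q, q <:+ enc a ∧ (Skip (QCSP.symb .conj * QCSP.symb .opn) (v 0) q ∧ ∃ s, s <:+ enc a ∧
        (X ![q, s] ∧ ∃ s', s' <:+ enc a ∧ (s = .cls :: s' ∧ X ![s', v 1]))) :=
    PTX.ex (Φ := fun a X v q => Skip (QCSP.symb .conj * QCSP.symb .opn) (v 0) q ∧ ∃ s, s <:+ enc a ∧
        (X ![q, s] ∧ ∃ s', s' <:+ enc a ∧ (s = .cls :: s' ∧ X ![s', v 1])))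
      ((((Recog.symb .conj).mul (Recog.symb .opn)).ptx (some 0) none).and
        (PTX.ex (Φ := fun a X v s => X ![v none, s] ∧ ∃ s', s' <:+ enc a ∧
          (s = .cls :: s' ∧ X ![s', v (some 1)]))
        ((PTX.call₂ (some none) none).and
          (PTX.ex (Φ := fun a X v s' => v none = .cls :: s' ∧ X ![s', v (some (some 1))])
          ((PTX.eqCons .cls (some none) none).and (PTX.call₂ none (some (some (some 1)))))))))
  refine PT.lfp (Φ := fun a X v => _) ((PTX.eq 0 1).or (atm.or ((quant .all).or ((quant .ex).or cnj))))
    ?_ ?_ ?_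
  · rintro a X Y h v (h' | ⟨q, hq, h₁, h₂⟩ | ⟨q, hq, h₁, h₂, h₃⟩ | ⟨q, hq, h₁, h₂, h₃⟩ |
      ⟨q, hq, h₁, s, hs, h₂, s', hs', h₃, h₄⟩)
    · exact .inl h'
    · exact .inr (.inl ⟨q, hq, h₁, h _ h₂⟩)
    · exact .inr (.inr (.inl ⟨q, hq, h₁, h₂, h _ h₃⟩))
    · exact .inr (.inr (.inr (.inl ⟨q, hq, h₁, h₂, h _ h₃⟩)))
    · exact .inr (.inr (.inr (.inr ⟨q, hq, h₁, s, hs, h _ h₂, s', hs', h₃, h _ h₄⟩)))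
  · rintro a v hv (h' | ⟨q, hq, h₁, h₂⟩ | ⟨q, hq, h₁, h₂, h₃⟩ | ⟨q, hq, h₁, h₂, h₃⟩ |
      ⟨q, hq, h₁, s, hs, h₂, s', hs', h₃, h₄⟩)
    · exact skip_kstar.2 (.inl h')
    · exact skip_kstar.2 (.inr ⟨q, h₁.mono atomL_le, h₂⟩)
    · obtain h | ⟨q', h, h'⟩ := skip_kstar.1 h₃
      · exact absurd h h₂
      · exact skip_kstar.2 (.inr ⟨q', (skip_mul.2 ⟨q, h₁, h⟩).mono ((mul_assoc _ _ _).trans_le all_le),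
          h'⟩)
    · obtain h | ⟨q', h, h'⟩ := skip_kstar.1 h₃
      · exact absurd h h₂
      · exact skip_kstar.2 (.inr ⟨q', (skip_mul.2 ⟨q, h₁, h⟩).mono ((mul_assoc _ _ _).trans_le ex_le),
          h'⟩)
    · have : Skip (QCSP.symb .conj * QCSP.symb .opn * (QCSP.formL∗ * QCSP.symb .cls)) (v 0) s' :=
        skip_mul.2 ⟨q, h₁, skip_mul.2 ⟨s, h₂, skip_symb.2 h₃⟩⟩
      exact skip_kstar.2 (.inr ⟨s', this.mono ((mul_assoc _ _ _).trans_le conj_le), h₄⟩)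
  · intro a X hX
    have hX' : ∀ p r, p <:+ enc a → r <:+ enc a → _ → X ![p, r] := fun p r hp hr h =>
      hX ![p, r] (fun i => by fin_cases i; exacts [hp, hr]) h
    clear hX
    -- Induction on the length of the string that is read, since the rules split the first formula
    -- and not only the sequence.
    have : ∀ N, ∀ p r, p.length ≤ N → p <:+ enc a → Skip QCSP.formL∗ p r → X ![p, r] := by
      intro N
      induction N with
      | zero =>
          intro p r hN hp h
          obtain rfl : p = [] := List.length_eq_zero_iff.1 (by omega)
          obtain rfl : r = [] := List.suffix_nil.1 h.suffix
          exact hX' _ _ hp hp (.inl rfl)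
      | succ N ih =>
          intro p r hN hp h
          have hr := h.suffix.trans hp
          obtain rfl | ⟨t, ⟨u, ⟨n, hu⟩, rfl⟩, ht⟩ := skip_kstar.1 h
          · exact hX' _ _ hp hp (.inl rfl)
          have hts : t <:+ enc a := (List.suffix_append u t).trans hp
          have quant : ∀ c : Symb, u ∈ QCSP.symb c * (varL * formOfDepth (n - 1)) →
              ∃ q, q <:+ enc a ∧ (Skip (QCSP.symb c * varL) (u ++ t) q ∧ ¬ q = r ∧ X ![q, r]) := by
            intro c hu
            obtain ⟨_, rfl, _, hvw, rfl⟩ := Language.mem_mul.1 hu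
            obtain ⟨v, hv, w, hw, rfl⟩ := Language.mem_mul.1 hvw
            have hq : w ++ t <:+ enc a := .trans ⟨[c] ++ v, by simp⟩ hp
            have hw' := (Prefix.formOfDepth _).head w hw
            refine ⟨w ++ t, hq, ⟨[c] ++ v, Language.mem_mul.2 ⟨_, rfl, v, hv, rfl⟩, by simp⟩, ?_,
              ih _ _ ?_ hq (skip_kstar.2 (.inr ⟨t, ⟨w, ⟨_, hw⟩, rfl⟩, ht⟩))⟩
            -- The body of the quantifier is not the empty word, so at least one formula is read
            -- before `r`.
            · rintro rfl
              have := ht.suffix.length_le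
              rcases w with _ | ⟨x, w⟩
              · simp at hw'
              · simp at this
            · simp at hN ⊢
              omega
          refine hX' _ _ hp hr (.inr ?_)
          rcases n with _ | n
          · exact hu.elim
          rcases hu with hu | hu | hu | hu
          · refine .inl ⟨t, hts, ⟨u, hu, rfl⟩, ih _ _ ?_ hts ht⟩
            have : u.head? = some .atom := head_symb_mul hu
            rcases u with _ | ⟨x, u⟩
            · simp at this
            · simp at hN ⊢
              omega
          · exact .inr (.inl (quant .all hu))
          · exact .inr (.inr (.inl (quant .ex hu)))
          · obtain ⟨_, rfl, _, h₁, rfl⟩ := Language.mem_mul.1 hu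
            obtain ⟨_, rfl, _, h₂, rfl⟩ := Language.mem_mul.1 h₁
            obtain ⟨w, hw, _, rfl, rfl⟩ := Language.mem_mul.1 h₂
            have hq : w ++ (.cls :: t) <:+ enc a := .trans ⟨[.conj, .opn], by simp⟩ hp
            refine .inr (.inr (.inr ⟨w ++ (.cls :: t), hq, ⟨[.conj, .opn], ⟨_, rfl, _, rfl, rfl⟩,
              by simp⟩, .cls :: t, (List.suffix_append _ _).trans hq, ih _ _ ?_ hq ⟨w, ?_, rfl⟩, t,
              hts, rfl, ih _ _ ?_ hts ht⟩))
            · simp at hN ⊢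
              omega
            · exact kstar_mono (show formOfDepth n ≤ QCSP.formL from fun u hu => ⟨n, hu⟩) hw
            · simp at hN ⊢
              omega
    intro v hv h
    have h' := this _ _ _ le_rfl (hv 0) h
    rwa [show ![v 0, v 1] = v by funext i; fin_cases i <;> rfl] at h'

end Forms

end QCSP

namespace QCSP

open Classical

/-! ### Positions of the nodes -/

namespace QCFormula

variable {φ ψ χ : QCFormula} {c d : ℕ} {p q : List ℕ} {r : List Symb}

/-- What follows the encoding of the child `c`, if `r` follows the encoding of the formula. -/
def childRest : QCFormula → ℕ → List Symb → List Symb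
  | conj n ψ, c, r =>
      ((List.finRange n).drop (c + 1)).flatMap (fun d => (ψ d).encode) ++ .cls :: r
  | _, _, r => r

/-- What follows the encoding of the subformula at `p`, if `r` follows the encoding of the
formula. -/
def restAt : QCFormula → List ℕ → List Symb → List Symb
  | _, [], r => r
  | φ, c :: p, r => match φ.child c with
    | none => r
    | some ψ => ψ.restAt p (φ.childRest c r)

theorem encode_conj (n : ℕ) (ψ : Fin n → QCFormula) : (conj n ψ).encode =
    .conj :: .opn :: ((List.finRange n).flatMap (fun d => (ψ d).encode) ++ [.cls]) := by
  rw [encode, encodeList, List.ofFn_eq_map, List.flatMap_id, List.flatMap]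
  rfl

theorem child_conj {n : ℕ} {ψ : Fin n → QCFormula} :
    (conj n ψ).child c = some χ ↔ ∃ h : c < n, ψ ⟨c, h⟩ = χ := by
  rw [child]
  split <;> simp [*]

theorem finRange_drop {n : ℕ} (h : c < n) :
    (List.finRange n).drop c = ⟨c, h⟩ :: (List.finRange n).drop (c + 1) := by
  rw [List.drop_eq_getElem_cons (by simpa using h)]
  simp

theorem childRest_suffix (φ : QCFormula) (c : ℕ) (r : List Symb) : r <:+ φ.childRest c r := by
  cases φ with
  | conj n ψ => exact (List.suffix_cons _ _).trans (List.suffix_append _ _)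
  | _ => exact List.suffix_rfl

theorem encode_child (h : φ.child c = some ψ) (r : List Symb) :
    ∃ l, l ≠ [] ∧ φ.encode ++ r = l ++ (ψ.encode ++ φ.childRest c r) := by
  cases φ with
  | atom R vs => simp [child] at h
  | conj n χ =>
      obtain ⟨hc, rfl⟩ := child_conj.1 h
      refine ⟨.conj :: .opn :: ((List.finRange n).take c).flatMap (fun d => (χ d).encode), by simp, ?_⟩
      rw [encode_conj]
      conv_lhs => rw [← List.take_append_drop c (List.finRange n), finRange_drop hc]
      simp [childRest]
  | all y χ =>
      obtain ⟨rfl, rfl⟩ : c = 0 ∧ χ = ψ := by simpa [child] using h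
      exact ⟨.all :: y.encode, by simp, by simp [encode, childRest]⟩
  | ex y χ =>
      obtain ⟨rfl, rfl⟩ : c = 0 ∧ χ = ψ := by simpa [child] using h
      exact ⟨.ex :: y.encode, by simp, by simp [encode, childRest]⟩

/-- A later child is written entirely behind an earlier one. -/
theorem childRest_lt (hcd : c < d) (h : φ.child c = some χ) (h' : φ.child d = some ψ)
    (r : List Symb) : ψ.encode ++ φ.childRest d r <:+ φ.childRest c r := by
  cases φ with
  | atom R vs => simp [child] at h
  | conj n χ =>
      obtain ⟨hd, rfl⟩ := child_conj.1 h'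
      have : (List.finRange n).drop d <:+ (List.finRange n).drop (c + 1) := by
        rw [show d = c + 1 + (d - (c + 1)) by omega, ← List.drop_drop]
        exact List.drop_suffix _ _
      obtain ⟨t, ht⟩ := this
      rw [finRange_drop hd] at ht
      exact ⟨t.flatMap fun d => (χ d).encode, by simp [childRest, ← ht]⟩
  | all y χ => simp [child] at h h'; omega
  | ex y χ => simp [child] at h h'; omega

theorem sub_cons : φ.sub (c :: p) = some ψ ↔ ∃ χ, φ.child c = some χ ∧ χ.sub p = some ψ := by
  rw [sub, Option.bind_eq_some_iff]

theorem restAt_cons (h : φ.child c = some χ) : φ.restAt (c :: p) r = χ.restAt p (φ.childRest c r) := by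
  rw [restAt, h]

theorem restAt_suffix (φ : QCFormula) (p : List ℕ) (r : List Symb) : r <:+ φ.restAt p r := by
  induction p generalizing φ r with
  | nil => exact List.suffix_rfl
  | cons c p ih =>
      rw [restAt]
      split
      · exact List.suffix_rfl
      · exact (φ.childRest_suffix c r).trans (ih _ _)

theorem sub_suffix (h : φ.sub p = some ψ) (r : List Symb) :
    ψ.encode ++ φ.restAt p r <:+ φ.encode ++ r := by
  induction p generalizing φ r with
  | nil => cases h; exact List.suffix_rfl
  | cons c p ih =>
      obtain ⟨χ, hχ, h⟩ := sub_cons.1 h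
      rw [restAt_cons hχ]
      obtain ⟨l, -, hl⟩ := encode_child hχ r
      exact (ih h _).trans ⟨l, hl.symm⟩

theorem encode_ne_nil (φ : QCFormula) : φ.encode ≠ [] := by
  cases φ <;> simp [encode]

theorem sub_append : φ.sub (p ++ q) = (φ.sub p).bind fun ψ => ψ.sub q := by
  induction p generalizing φ with
  | nil => simp [sub]
  | cons c p ih => simp [sub, ih, Option.bind_assoc]

theorem restAt_append (h : φ.sub p = some ψ) : φ.restAt (p ++ q) r = ψ.restAt q (φ.restAt p r) := by
  induction p generalizing φ r with
  | nil => cases h; rfl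
  | cons c p ih =>
      obtain ⟨χ, hχ, h⟩ := sub_cons.1 h
      rw [List.cons_append, restAt_cons hχ, restAt_cons hχ, ih h]

/-- A proper descendant starts strictly after its ancestor, and nodes below different children
occupy disjoint stretches of text; both follow by comparing lengths. Hence a position can stand for
a node, even if the same subformula occurs several times. -/
theorem position_injective {ψ' : QCFormula} (h : φ.sub p = some ψ) (h' : φ.sub q = some ψ')
    (e : ψ.encode ++ φ.restAt p r = ψ'.encode ++ φ.restAt q r) : p = q := by
  have root : ∀ {φ : QCFormula} {c p ψ r}, φ.sub (c :: p) = some ψ →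
      φ.encode ++ r ≠ ψ.encode ++ φ.restAt (c :: p) r := by
    intro φ c p ψ r h e
    obtain ⟨χ, hχ, h⟩ := sub_cons.1 h
    rw [restAt_cons hχ] at e
    obtain ⟨l, hl, hl'⟩ := encode_child hχ r
    have h₁ := (sub_suffix h (φ.childRest c r)).length_le
    rw [← e, hl'] at h₁
    have := List.length_pos_iff.2 hl
    rw [List.length_append (as := l)] at h₁
    omega
  have siblings : ∀ {φ : QCFormula} {c d p q ψ ψ' r}, c < d → φ.sub (c :: p) = some ψ →
      φ.sub (d :: q) = some ψ' →
      ψ.encode ++ φ.restAt (c :: p) r ≠ ψ'.encode ++ φ.restAt (d :: q) r := by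
    intro φ c d p q ψ ψ' r hcd h h' e
    obtain ⟨χ, hχ, h⟩ := sub_cons.1 h
    obtain ⟨χ', hχ', h'⟩ := sub_cons.1 h'
    rw [restAt_cons hχ, restAt_cons hχ'] at e
    have h₁ := (sub_suffix h' (φ.childRest d r)).length_le
    have h₂ := (childRest_lt hcd hχ hχ' r).length_le
    have h₃ := (χ.restAt_suffix p (φ.childRest c r)).length_le
    have h₄ := List.length_pos_iff.2 ψ.encode_ne_nil
    rw [← e] at h₁
    simp at h₁ h₂
    omega
  induction p generalizing φ q r with
  | nil =>
      cases h
      rcases q with _ | ⟨d, q⟩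
      · rfl
      · exact absurd e (root h')
  | cons c p ih =>
      rcases q with _ | ⟨d, q⟩
      · cases h'
        exact absurd e.symm (root h)
      · rcases lt_trichotomy c d with hcd | rfl | hcd
        · exact absurd e (siblings hcd h h')
        · obtain ⟨χ, hχ, h⟩ := sub_cons.1 h
          obtain ⟨χ', hχ', h'⟩ := sub_cons.1 h'
          rw [hχ] at hχ'
          cases hχ'
          rw [restAt_cons hχ, restAt_cons hχ] at e
          rw [ih h h' e]
        · exact absurd e.symm (siblings hcd h' h)

theorem sub_index (i : φ.Index) : φ.sub i.1 = some (φ.subAt i) := (Option.some_get i.2).symm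

theorem isParent_iff {i j : φ.Index} :
    IsParent i j ↔ ∃ c, j.1 = i.1 ++ [c] ∧ (φ.subAt i).child c = some (φ.subAt j) := by
  refine ⟨fun ⟨c, hc⟩ => ⟨c, hc, ?_⟩, fun ⟨c, hc, _⟩ => ⟨c, hc⟩⟩
  have := sub_index j
  rw [hc, sub_append, sub_index i] at this
  simpa [sub] using this

theorem exists_isParent {i : φ.Index} (h : (φ.subAt i).child c = some χ) :
    ∃ j : φ.Index, j.1 = i.1 ++ [c] ∧ φ.subAt j = χ := by
  have : φ.sub (i.1 ++ [c]) = some χ := by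
    rw [sub_append, sub_index i]
    simpa [sub] using h
  refine ⟨⟨i.1 ++ [c], by simp [this]⟩, rfl, ?_⟩
  exact Option.some_inj.1 ((sub_index _).symm.trans this)

end QCFormula

/-! ### Children of a node as positions -/

section Skips

variable {L M : Language Symb} {p q r u : List Symb}

theorem skip_symb_mul {c d : Symb} : Skip (symb c * L) (d :: p) r ↔ d = c ∧ Skip L p r := by
  rw [skip_mul]
  simp only [skip_symb, List.cons.injEq]
  exact ⟨fun ⟨q, ⟨h, h'⟩, hq⟩ => ⟨h, h' ▸ hq⟩, fun ⟨h, h'⟩ => ⟨p, ⟨h, rfl⟩, h'⟩⟩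

theorem Prefix.skip_append (hL : Prefix L) (hu : u ∈ L) : Skip L (u ++ r) q ↔ q = r :=
  ⟨fun h => hL.skip_unique h ⟨u, hu, rfl⟩, fun h => h ▸ ⟨u, hu, rfl⟩⟩

theorem Prefix.skip_mul_append (hL : Prefix L) (hu : u ∈ L) :
    Skip (L * M) (u ++ r) q ↔ Skip M r q := by
  rw [skip_mul]
  simp [hL.skip_append hu]

open Computability in
theorem Prefix.skip_kstar_flatMap_cons (hL : Prefix L) {A : Type} {f : A → List Symb}
    (hf : ∀ x, f x ∈ L) (l : List A) (r e : List Symb) :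
    Skip L∗ (l.flatMap f ++ .cls :: r) e ∧ e.head? ≠ some .cls ↔
      ∃ l₁ x l₂, l = l₁ ++ x :: l₂ ∧ e = f x ++ (l₂.flatMap f ++ .cls :: r) := by
  rw [hL.skip_kstar_flatMap hf]
  constructor
  · rintro ⟨⟨l₁, l₂, rfl, rfl⟩, h⟩
    rcases l₂ with _ | ⟨x, l₂⟩
    · simp at h
    · exact ⟨l₁, x, l₂, rfl, by simp⟩
  · rintro ⟨l₁, x, l₂, rfl, rfl⟩
    refine ⟨⟨l₁, x :: l₂, rfl, by simp⟩, ?_⟩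
    have := (hL.head _ (hf x)).1
    rcases h : f x with _ | ⟨y, t⟩
    · simp [h] at this
    · simpa [h] using (hL.head _ (hf x)).2

open Computability in
/-- A child of the node at `p` starts at `q`. -/
def ChildAt (p q : List Symb) : Prop :=
  Skip (symb .all * varL) p q ∨ Skip (symb .ex * varL) p q ∨
    Skip (symb .conj * (symb .opn * formL∗)) p q ∧ ¬ q.head? = some .cls

/-- In a conjunction the star reaches every border between two conjuncts; the condition on the
closing bracket removes the last border, where no child starts. -/
theorem childAt_encode {ψ : QCFormula} : ChildAt (ψ.encode ++ r) q ↔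
    ∃ c χ, ψ.child c = some χ ∧ q = χ.encode ++ ψ.childRest c r := by
  cases ψ with
  | atom R vs => simp [ChildAt, QCFormula.encode, QCFormula.child, skip_symb_mul]
  | conj n ψ =>
      have h := Prefix.formL.skip_kstar_flatMap_cons (f := fun d => (ψ d).encode)
        (fun d => (ψ d).encode_mem) (List.finRange n) r q
      simp only [ChildAt, QCFormula.encode_conj, List.cons_append, skip_symb_mul, reduceCtorEq,
        false_and, false_or, true_and, List.append_assoc, List.nil_append]
      refine Iff.trans h ?_
      constructor
      · rintro ⟨l₁, x, l₂, hl, rfl⟩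
        have h₁ : l₁.length < (List.finRange n).length := by simp [hl]
        have h₂ : (List.finRange n)[l₁.length] = x := by simp [hl]
        have h₃ : l₁.length = x.1 := by
          have := congrArg Fin.val h₂
          simpa using this
        refine ⟨x.1, ψ x, QCFormula.child_conj.2 ⟨x.2, rfl⟩, ?_⟩
        rw [QCFormula.childRest, ← h₃]
        simp [hl]
      · rintro ⟨c, χ, hχ, rfl⟩
        obtain ⟨hc, rfl⟩ := QCFormula.child_conj.1 hχ
        refine ⟨(List.finRange n).take c, ⟨c, hc⟩, (List.finRange n).drop (c + 1), ?_, rfl⟩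
        rw [← QCFormula.finRange_drop hc, List.take_append_drop]
  | all y ψ =>
      simp [ChildAt, QCFormula.encode, QCFormula.child, skip_symb_mul, QCFormula.childRest,
        Prefix.varL.skip_append y.encode_mem]
  | ex y ψ =>
      simp [ChildAt, QCFormula.encode, QCFormula.child, skip_symb_mul, QCFormula.childRest,
        Prefix.varL.skip_append y.encode_mem]

end Skips

namespace Instance

variable {I : Instance} {i j : I.formula.Index} {p q x : List Symb}

/-- The position of the node `i` in the input. -/
def pos (I : Instance) (i : I.formula.Index) : List Symb :=
  (I.formula.subAt i).encode ++ I.formula.restAt i.1 I.struct.encode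

theorem pos_suffix (i : I.formula.Index) : I.pos i <:+ I.encode :=
  QCFormula.sub_suffix (QCFormula.sub_index i) _

theorem pos_injective (h : I.pos i = I.pos j) : i = j :=
  Subtype.ext (QCFormula.position_injective (QCFormula.sub_index i) (QCFormula.sub_index j) h)

theorem childAt_pos : ChildAt (I.pos i) q ↔ ∃ j, QCFormula.IsParent i j ∧ q = I.pos j := by
  rw [pos, childAt_encode]
  constructor
  · rintro ⟨c, χ, hc, rfl⟩
    obtain ⟨j, hj, rfl⟩ := QCFormula.exists_isParent hc
    refine ⟨j, ⟨c, hj⟩, ?_⟩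
    rw [pos, hj, QCFormula.restAt_append (QCFormula.sub_index i), QCFormula.restAt_cons hc]
    rfl
  · rintro ⟨j, hj, rfl⟩
    obtain ⟨c, hc, hc'⟩ := QCFormula.isParent_iff.1 hj
    refine ⟨c, _, hc', ?_⟩
    rw [pos, hc, QCFormula.restAt_append (QCFormula.sub_index i), QCFormula.restAt_cons hc']
    rfl

variable {κ ι : Type} [Fintype κ]

theorem pt_childAt : PT encode fun _ (v : Fin 2 → List Symb) => ChildAt (v 0) (v 1) := by
  intro κ _
  exact (((Recog.symb _).mul recog_varL).ptx 0 1).or ((((Recog.symb _).mul recog_varL).ptx 0 1).or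
    ((((Recog.symb _).mul ((Recog.symb _).mul Recog.formL)).ptx 0 1).and
      (PTX.head 1 (· = some .cls)).not))

/-- There is a node at the position `p`. -/
def NodeAt (I : Instance) (p : List Symb) : Prop := ∃ i, p = I.pos i

/-- The nodes are what can be reached from the root, which starts at the beginning of the input,
along `ChildAt`. -/
theorem pt_nodeAt : PT encode fun I (v : Fin 1 → List Symb) => I.NodeAt (v 0) := by
  refine PT.lfp ((PTX.eqInput 0).or (PTX.ex (Φ := fun _ X v q => X ![q] ∧ ChildAt q (v 0))
    (((PTX.call ![none]).congr fun a X v _ => ?_).and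
      (PT.ptx₂ (R := fun _ => ChildAt) pt_childAt none (some 0))))) ?_ ?_ ?_
  · rw [show (fun c => v (![none] c)) = ![v none] by funext c; fin_cases c; rfl]
  · rintro I X Y h v (h' | ⟨q, hq, h₁, h₂⟩)
    · exact .inl h'
    · exact .inr ⟨q, hq, h _ h₁, h₂⟩
  · rintro I v hv (h' | ⟨q, hq, ⟨i, hi⟩, h₂⟩)
    · exact ⟨⟨[], rfl⟩, h'⟩
    · obtain rfl : q = I.pos i := hi
      obtain ⟨j, -, hj⟩ := childAt_pos.1 h₂
      exact ⟨j, hj⟩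
  · rintro I X hX v hv ⟨⟨p, hp⟩, hi⟩
    have : ∀ p hp, X ![I.pos ⟨p, hp⟩] := by
      intro p
      induction p using List.reverseRecOn with
      | nil =>
          intro hp
          exact hX _ (fun i => by fin_cases i; exact pos_suffix _) (.inl rfl)
      | append_singleton p c ih =>
          intro hp
          have hp' : (I.formula.sub p).isSome := by
            rw [QCFormula.sub_append] at hp
            rcases h : I.formula.sub p with _ | ψ
            · simp [h] at hp
            · rfl
          exact hX _ (fun i => by fin_cases i; exact pos_suffix _) (.inr ⟨_, pos_suffix _, ih hp',
            childAt_pos.2 ⟨_, ⟨c, rfl⟩, rfl⟩⟩)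
    rw [show v = ![v 0] by funext i; fin_cases i; rfl, hi]
    exact this p hp

end Instance

end QCSP

namespace QCSP

open Classical

/-! ### Reading the input -/

section Reading

variable {L M : Language Symb} {p q r s u x b : List Symb}

theorem ReadsNat.same {c : ℕ} (h : ReadsNat p c) : Same numL p q ↔ ReadsNat q c := by
  obtain ⟨r, rfl⟩ := h
  exact same_numL_left

theorem Reads.same {v : Var} (h : Reads p v) : Same varL p q ↔ Reads q v := by
  obtain ⟨r, rfl⟩ := h
  exact same_varL_left

theorem Same.symm (h : Same L p q) : Same L q p := by
  obtain ⟨u, hu, r, s, hp, hq⟩ := h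
  exact ⟨u, hu, s, r, hq, hp⟩

theorem not_same_nil (h : Prefix L) : ¬ Same L [] q := by
  rintro ⟨u, hu, r, s, h', -⟩
  obtain ⟨rfl, -⟩ := List.append_eq_nil_iff.1 h'.symm
  exact (h.head _ hu).1 rfl

theorem Prefix.same_head (hL : Prefix L) (h : Same L p q) : p.head? ≠ some .cls := by
  obtain ⟨u, hu, r, s, rfl, -⟩ := h
  exact (hL.skip_head ⟨u, hu, rfl⟩).2

open Computability in
-- Search in a written list: a border `y` between items is guessed, and if `P` fails at closing
-- brackets, then an item starts at `y`.
theorem Prefix.exists_skip_kstar (hL : Prefix L) {A : Type} {f : A → List Symb}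
    (hf : ∀ x, f x ∈ L) (l : List A) (r : List Symb) {P : List Symb → Prop}
    (hP : ∀ y, P y → y.head? ≠ some .cls) :
    (∃ y, Skip L∗ (l.flatMap f ++ .cls :: r) y ∧ P y) ↔
      ∃ l₁ x l₂, l = l₁ ++ x :: l₂ ∧ P (f x ++ (l₂.flatMap f ++ .cls :: r)) := by
  constructor
  · rintro ⟨y, hy, h⟩
    obtain ⟨l₁, x, l₂, hl, rfl⟩ := (hL.skip_kstar_flatMap_cons hf l r y).1 ⟨hy, hP y h⟩
    exact ⟨l₁, x, l₂, hl, h⟩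
  · rintro ⟨l₁, x, l₂, hl, h⟩
    exact ⟨_, ((hL.skip_kstar_flatMap_cons hf l r _).2 ⟨l₁, x, l₂, hl, rfl⟩).1, h⟩

open Computability in
/-- The variable that is written at `x` is written in the atom that starts at `p`. -/
def AtomVar (p x : List Symb) : Prop :=
  ∃ y, Skip (symb .atom * (numL * (symb .opn * varL∗))) p y ∧ Same varL y x

theorem atomVar_encode {ψ : QCFormula} : AtomVar (ψ.encode ++ r) x ↔
    ∃ R vs, ψ = .atom R vs ∧ ∃ u ∈ vs, Reads x u := by
  cases ψ with
  | atom R vs =>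
      have h := Prefix.varL.exists_skip_kstar Var.encode_mem vs r
        (P := fun y => Same varL y x) fun y h => Prefix.varL.same_head h
      simp only [AtomVar, QCFormula.encode, encodeList, List.cons_append, List.append_assoc,
        skip_symb_mul, true_and, Prefix.numL.skip_mul_append (encodeNat_mem R), List.nil_append]
      refine Iff.trans h ?_
      clear h
      simp only [same_varL_left, QCFormula.atom.injEq]
      constructor
      · rintro ⟨l₁, u, l₂, rfl, h⟩
        exact ⟨R, _, ⟨rfl, rfl⟩, u, by simp, h⟩
      · rintro ⟨_, _, ⟨rfl, rfl⟩, u, hu, h⟩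
        obtain ⟨l₁, l₂, rfl⟩ := List.append_of_mem hu
        exact ⟨l₁, u, l₂, rfl, h⟩
  | _ => simp [AtomVar, QCFormula.encode, skip_symb_mul]

/-- A quantifier at `p` binds the variable that is written at `x`. -/
def BindsAt (p x : List Symb) : Prop :=
  (p.head? = some .all ∨ p.head? = some .ex) ∧ Same varL p.tail x

theorem bindsAt_encode {ψ : QCFormula} {u : Var} (hx : Reads x u) : BindsAt (ψ.encode ++ r) x ↔
    ∃ χ, ψ = .all u χ ∨ ψ = .ex u χ := by
  have : ∀ v : Var, Reads x v ↔ v = u := fun v =>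
    ⟨fun h => h.unique hx, fun h => h ▸ hx⟩
  cases ψ <;> simp [BindsAt, QCFormula.encode, same_varL_left, this]

/-- The recursive definition of free variables in the form of a closure rule along children, uniform
in the kind of formula, as the fixed point in `Instance.pt_freeAt` needs it. -/
theorem QCFormula.mem_free {ψ : QCFormula} {u : Var} : u ∈ ψ.free ↔
    (∃ R vs, ψ = .atom R vs ∧ u ∈ vs) ∨
      ∃ c χ, ψ.child c = some χ ∧ u ∈ χ.free ∧ ¬ ∃ χ, ψ = .all u χ ∨ ψ = .ex u χ := by
  cases ψ with
  | atom R vs => simp [QCFormula.free, QCFormula.child]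
  | conj n ψ =>
      simp only [QCFormula.free, Finset.mem_biUnion, Finset.mem_univ, true_and, reduceCtorEq,
        false_and, exists_false, false_or, or_false, not_false_eq_true, and_true,
        QCFormula.child_conj]
      exact ⟨fun ⟨c, h⟩ => ⟨c.1, ψ c, ⟨c.2, rfl⟩, h⟩, fun ⟨c, _, ⟨hc, h'⟩, h⟩ => ⟨⟨c, hc⟩, h' ▸ h⟩⟩
  | all y ψ => simp [QCFormula.free, QCFormula.child, and_comm, eq_comm]
  | ex y ψ => simp [QCFormula.free, QCFormula.child, and_comm, eq_comm]

/-- A free variable occurs in an atom, so it has a position that can represent it. -/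
theorem QCFormula.exists_reads {ψ : QCFormula} {u : Var} (hu : u ∈ ψ.free) (r : List Symb) :
    ∃ x, x <:+ ψ.encode ++ r ∧ Reads x u := by
  have key : ∀ {ψ χ : QCFormula} {c r}, ψ.child c = some χ →
      (∃ x, x <:+ χ.encode ++ ψ.childRest c r ∧ Reads x u) → ∃ x, x <:+ ψ.encode ++ r ∧ Reads x u := by
    rintro ψ χ c r hc ⟨x, hx, h⟩
    obtain ⟨l, -, hl⟩ := QCFormula.encode_child hc r
    exact ⟨x, hx.trans ⟨l, hl.symm⟩, h⟩
  induction ψ generalizing r with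
  | atom R vs =>
      obtain ⟨l₁, l₂, rfl⟩ := List.append_of_mem (List.mem_toFinset.1 hu)
      refine ⟨u.encode ++ (l₂.flatMap Var.encode ++ .cls :: r), ⟨.atom :: (encodeNat R ++
        .opn :: l₁.flatMap Var.encode), ?_⟩, _, rfl⟩
      simp [QCFormula.encode, encodeList]
  | conj n ψ ih =>
      obtain ⟨c, -, hc⟩ := Finset.mem_biUnion.1 hu
      exact key (QCFormula.child_conj.2 ⟨c.2, rfl⟩) (ih c hc _)
  | all y ψ ih => exact key (c := 0) rfl (ih (Finset.mem_erase.1 hu).2 _)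
  | ex y ψ ih => exact key (c := 0) rfl (ih (Finset.mem_erase.1 hu).2 _)

end Reading

namespace Instance

variable {I : Instance} {i j : I.formula.Index} {p q x b r : List Symb} {κ ι : Type} [Fintype κ]
  {L M : Language Symb}

open Computability in
theorem pt_atomVar : PT encode fun _ (v : Fin 2 → List Symb) => AtomVar (v 0) (v 1) := by
  intro κ _
  refine (PTX.ex (Φ := fun _ _ v y =>
      Skip (symb .atom * (numL * (symb .opn * varL∗))) (v 0) y ∧ Same varL y (v 1))
    ((((Recog.symb .atom).mul (recog_numL.mul ((Recog.symb .opn).mul recog_varL.kstar))).ptx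
      (some 0) none).and
    (PT.ptx₂ (R := fun _ => Same varL) pt_same_varL none (some 1)))).congr fun I X v hv => ?_
  exact ⟨fun ⟨y, _, h⟩ => ⟨y, h⟩, fun ⟨y, h⟩ => ⟨y, h.1.suffix.trans (hv 0), h⟩⟩

theorem pt_bindsAt : PT encode fun _ (v : Fin 2 → List Symb) => BindsAt (v 0) (v 1) := by
  intro κ _
  exact ((PTX.head 0 (· = some .all)).or (PTX.head 0 (· = some .ex))).and
    (PTX.tail (Φ := fun _ _ v s => Same varL s (v 1)) 0
      (PT.ptx₂ (R := fun _ => Same varL) pt_same_varL none (some 1)))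

/-- A variable that is free in the formula at the node at `p` is written at `x`. -/
def FreeAt (I : Instance) (p x : List Symb) : Prop :=
  ∃ i u, p = I.pos i ∧ Reads x u ∧ u ∈ (I.formula.subAt i).free

theorem pt_freeAt : PT encode fun I (v : Fin 2 → List Symb) => I.FreeAt (v 0) (v 1) := by
  refine PT.lfp (((PT.reindex pt_nodeAt ![0]).ptx).and ((PT.ptx₂ (R := fun _ => AtomVar)
    pt_atomVar 0 1).or (PTX.ex (Φ := fun _ X v q => ChildAt (v 0) q ∧ X ![q, v 1] ∧
      ¬ BindsAt (v 0) (v 1)) ((PT.ptx₂ (R := fun _ => ChildAt) pt_childAt (some 0) none).and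
        ((PTX.call₂ none (some 1)).and (PT.ptx₂ (R := fun _ => BindsAt) pt_bindsAt (some 0)
          (some 1)).not))))) ?_ ?_ ?_
  · rintro I X Y h v ⟨h₀, h' | ⟨q, hq, h₁, h₂, h₃⟩⟩
    · exact ⟨h₀, .inl h'⟩
    · exact ⟨h₀, .inr ⟨q, hq, h₁, h _ h₂, h₃⟩⟩
  · rintro I v hv ⟨⟨i, hi⟩, h⟩
    obtain hi : v 0 = I.pos i := hi
    simp only [hi] at h
    rcases h with h | ⟨q, hq, h₁, ⟨j, u, hj, hu, hu'⟩, h₃⟩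
    · obtain ⟨R, vs, h, u, hu, hx⟩ := atomVar_encode.1 h
      exact ⟨i, u, hi, hx, QCFormula.mem_free.2 (.inl ⟨R, vs, h, hu⟩)⟩
    · obtain ⟨j', hj', rfl⟩ := childAt_pos.1 h₁
      cases pos_injective hj
      obtain ⟨c, -, hc⟩ := QCFormula.isParent_iff.1 hj'
      exact ⟨i, u, hi, hu, QCFormula.mem_free.2 (.inr ⟨c, _, hc, hu', fun h =>
        h₃ ((bindsAt_encode hu).2 h)⟩)⟩
  · rintro I X hX v hv ⟨i, u, hi, hu, hf⟩
    have hX' : ∀ i, I.NodeAt (I.pos i) ∧ _ → X ![I.pos i, v 1] := fun i h =>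
      hX ![I.pos i, v 1] (fun c => by fin_cases c; exacts [pos_suffix i, hv 1]) h
    have key : ∀ ψ : QCFormula, ∀ i, I.formula.subAt i = ψ → u ∈ ψ.free → X ![I.pos i, v 1] := by
      have step : ∀ i, (∀ c χ, (I.formula.subAt i).child c = some χ → u ∈ χ.free →
          ∀ j, I.formula.subAt j = χ → X ![I.pos j, v 1]) →
          u ∈ (I.formula.subAt i).free → X ![I.pos i, v 1] := by
        intro i ih hf
        refine hX' i ⟨⟨i, rfl⟩, ?_⟩
        rcases QCFormula.mem_free.1 hf with ⟨R, vs, h, h'⟩ | ⟨c, χ, hc, hχ, h⟩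
        · exact .inl (atomVar_encode.2 ⟨R, vs, h, u, h', hu⟩)
        · obtain ⟨j, hj, rfl⟩ := QCFormula.exists_isParent hc
          exact .inr ⟨_, pos_suffix j, childAt_pos.2 ⟨j, ⟨c, hj⟩, rfl⟩, ih c _ hc hχ j rfl,
            fun h' => h ((bindsAt_encode hu).1 h')⟩
      intro ψ
      induction ψ with
      | atom R vs =>
          intro i hi hf
          rw [← hi] at hf
          refine step i (fun c χ hc => ?_) hf
          simp [hi, QCFormula.child] at hc
      | conj n ψ ih =>
          intro i hi hf
          rw [← hi] at hf
          refine step i (fun c χ hc hχ j hj => ?_) hf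
          rw [hi] at hc
          obtain ⟨hc, rfl⟩ := QCFormula.child_conj.1 hc
          exact ih _ j hj hχ
      | all y ψ ih =>
          intro i hi hf
          rw [← hi] at hf
          refine step i (fun c χ hc hχ j hj => ?_) hf
          simp only [hi, QCFormula.child, Option.ite_none_right_eq_some, Option.some.injEq] at hc
          exact ih j (hj.trans hc.2.symm) (hc.2 ▸ hχ)
      | ex y ψ ih =>
          intro i hi hf
          rw [← hi] at hf
          refine step i (fun c χ hc hχ j hj => ?_) hf
          simp only [hi, QCFormula.child, Option.ite_none_right_eq_some, Option.some.injEq] at hc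
          exact ih j (hj.trans hc.2.symm) (hc.2 ▸ hχ)
    rw [show v = ![v 0, v 1] by funext i; fin_cases i <;> rfl, hi]
    exact key _ i rfl hf

end Instance

/-! ### Finding the universes in the input -/

section Struct

variable {L M : Language Symb} {p q r s e x b : List Symb}

theorem skip_mul_append_of_unique (hM : ∀ u ∈ L, ∀ v ∈ L, ∀ r s, u ++ r = v ++ s → u = v ∧ r = s)
    {u : List Symb} (hu : u ∈ L) : Skip (L * M) (u ++ r) q ↔ Skip M r q := by
  rw [skip_mul]
  constructor
  · rintro ⟨t, ⟨v, hv, h⟩, h'⟩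
    obtain ⟨-, rfl⟩ := hM u hu v hv r t h
    exact h'
  · exact fun h => ⟨r, ⟨u, hu, rfl⟩, h⟩

theorem head_formL {u : List Symb} (hu : u ∈ formL) : u.head? ≠ some .opn := by
  obtain ⟨n, hu⟩ := hu
  rcases n with _ | n
  · exact hu.elim
  · rcases hu with hu | hu | hu | hu
    · have : u.head? = some .atom := head_symb_mul hu
      simp [this]
    all_goals simp [head_symb_mul hu]

open Computability in
-- This locates the structure behind the formula. Only `formL∗` is known to be recognisable, but no
-- formula begins with an opening bracket, so the first bracket after a sequence of formulas marks
-- the end of `φ`.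
theorem skip_formL_mul (φ : QCFormula) :
    Skip (formL∗ * symb .opn * M) (φ.encode ++ .opn :: r) q ↔ Skip M r q := by
  have : φ.encode ++ [.opn] ∈ formL∗ * symb .opn :=
    ⟨_, Language.mem_kstar.2 ⟨[φ.encode], by simp, by simpa using φ.encode_mem⟩, _, rfl, rfl⟩
  simpa only [List.append_assoc, List.singleton_append] using skip_mul_append_of_unique (M := M)
    (r := r) (q := q) (Prefix.formL.kstar_mul_unique (c := .opn) fun u hu => head_formL hu) this

open Computability in
theorem Prefix.skip_kstar_cls_mul (hL : Prefix L) {A : Type} {f : A → List Symb}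
    (hf : ∀ x, f x ∈ L) (l : List A) :
    Skip (L∗ * QCSP.symb .cls * M) (l.flatMap f ++ .cls :: r) q ↔ Skip M r q := by
  have : l.flatMap f ++ [.cls] ∈ L∗ * QCSP.symb .cls := by
    refine ⟨_, Language.mem_kstar.2 ⟨l.map f, rfl, ?_⟩, _, rfl, ?_⟩
    · intro u hu
      obtain ⟨x, -, rfl⟩ := List.mem_map.1 hu
      exact hf x
    · simp [List.flatMap]
  simpa only [List.append_assoc, List.singleton_append] using skip_mul_append_of_unique (M := M)
    (r := r) (q := q) (hL.kstar_mul_unique (c := .cls) fun u hu => (hL.head u hu).2) this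

namespace Instance

variable {I : Instance}

open Computability in
/-- An element of the universe of the sort of the variable at `x` is written at `b`. -/
def DomAt (I : Instance) (x b : List Symb) : Prop :=
  ∃ e, Skip (formL∗ * symb .opn * sortL∗) I.encode e ∧ ∃ xs, Skip numL x xs ∧ Same numL xs e ∧
    ∃ c, Skip (numL * (symb .opn * numL∗)) e c ∧ Same numL c b

open Computability in
theorem domAt_iff {u : Var} (hx : Reads x u) :
    I.DomAt x b ↔ ∃ c ∈ I.struct.dom u.sort, ReadsNat b c := by
  obtain ⟨rx, rfl⟩ := hx
  have hxs : ∀ xs, Skip numL (u.encode ++ rx) xs ↔ xs = encodeNat u.sort ++ rx := fun xs => by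
    rw [Var.encode, List.append_assoc, Prefix.numL.skip_append (encodeNat_mem _)]
  simp only [DomAt, encode, FinStructure.encode, encodeList, List.cons_append, List.append_assoc,
    skip_formL_mul, hxs, exists_eq_left, List.nil_append]
  rw [Prefix.sortL.exists_skip_kstar SortTable.encode_mem]
  · simp only [SortTable.encode, encodeList, List.append_assoc, List.cons_append, same_numL_left,
      Prefix.numL.skip_mul_append (encodeNat_mem _), skip_symb_mul, true_and, List.nil_append]
    have h₁ : ∀ (l : List ℕ) r, (∃ c, Skip numL∗ (l.flatMap encodeNat ++ .cls :: r) c ∧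
        Same numL c b) ↔ ∃ c ∈ l, ReadsNat b c := by
      intro l r
      rw [Prefix.numL.exists_skip_kstar encodeNat_mem l r fun y h => Prefix.numL.same_head h]
      simp only [same_numL_left]
      constructor
      · rintro ⟨l₁, c, l₂, rfl, h⟩
        exact ⟨c, by simp, h⟩
      · rintro ⟨c, hc, h⟩
        obtain ⟨l₁, l₂, rfl⟩ := List.append_of_mem hc
        exact ⟨l₁, c, l₂, rfl, h⟩
    simp only [h₁]
    constructor
    · rintro ⟨l₁, T, l₂, hl, ⟨r, hr⟩, c, hc, h⟩
      exact ⟨c, ⟨T, by simp [hl], (encodeNat_append_inj hr).1, hc⟩, h⟩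
    · rintro ⟨c, ⟨T, hT, hs, hc⟩, h⟩
      obtain ⟨l₁, l₂, hl⟩ := List.append_of_mem hT
      exact ⟨l₁, T, l₂, hl, ⟨_, by rw [hs]⟩, c, hc, h⟩
  · rintro y ⟨h, -⟩
    exact Prefix.numL.same_head h.symm

theorem exists_readsNat {c s : ℕ} (h : c ∈ I.struct.dom s) : ∃ b, b <:+ I.encode ∧ ReadsNat b c := by
  obtain ⟨T, hT, -, hc⟩ := h
  obtain ⟨l₁, l₂, hl⟩ := List.append_of_mem hT
  obtain ⟨m₁, m₂, hm⟩ := List.append_of_mem hc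
  refine ⟨encodeNat c ++ (m₂.flatMap encodeNat ++ .cls :: (l₂.flatMap SortTable.encode ++ .cls ::
    encodeList RelTable.encode I.struct.rels)), ⟨I.formula.encode ++ .opn :: (l₁.flatMap
      SortTable.encode ++ (encodeNat T.sort ++ .opn :: m₁.flatMap encodeNat)), ?_⟩, _, rfl⟩
  simp [encode, FinStructure.encode, encodeList, hl, SortTable.encode, hm]

theorem exists_reads {u : Var} {i : I.formula.Index} (h : u ∈ (I.formula.subAt i).free) :
    ∃ x, x <:+ I.encode ∧ Reads x u := by
  obtain ⟨x, hx, hu⟩ := QCFormula.exists_reads h (I.formula.restAt i.1 I.struct.encode)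
  exact ⟨x, hx.trans (pos_suffix i), hu⟩

end Instance

end Struct

end QCSP

namespace QCSP

open Classical

/-! ### Tuples -/

/-- The indices of the strings that represent a judgement: its node, a flag, its variables, and
values for them. -/
abbrev Key (k : ℕ) : Type := Fin 2 ⊕ (Fin k ⊕ Fin k)

/-- The strings that represent a judgement. -/
def key {k : ℕ} (p z : List Symb) (x b : Fin k → List Symb) : Key k → List Symb :=
  Sum.elim ![p, z] (Sum.elim x b)

theorem key_eta {k : ℕ} (v : Key k → List Symb) : key (v (.inl 0)) (v (.inl 1))
    (fun j => v (.inr (.inl j))) (fun j => v (.inr (.inr j))) = v := by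
  funext c
  rcases c with c | c | c
  · fin_cases c <;> rfl
  · rfl
  · rfl

theorem areSuffixes_key {k : ℕ} {w p z : List Symb} {x b : Fin k → List Symb} :
    AreSuffixes w (key p z x b) ↔ p <:+ w ∧ z <:+ w ∧ AreSuffixes w x ∧ AreSuffixes w b := by
  simp [AreSuffixes, key, and_assoc]

theorem PTX.callKey {α ι : Type} {enc : α → List Symb} {k : ℕ} (p z : ι) (x b : Fin k → ι) :
    PTX enc fun _ (X : (Key k → List Symb) → Prop) v =>
      X (key (v p) (v z) (fun j => v (x j)) fun j => v (b j)) :=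
  (PTX.call (Sum.elim ![p, z] (Sum.elim x b))).congr fun a X v _ => by
    rw [← key_eta fun c => v (Sum.elim ![p, z] (Sum.elim x b) c)]
    rfl

section Tuples

variable {L M : Language Symb} {p q r s e : List Symb} {k : ℕ} {x b : Fin k → List Symb}

/-- The variables written from `p` on have the values written from `q` on, if the variables at `x`
have the values at `b`. -/
inductive TupleMatch {k : ℕ} (x b : Fin k → List Symb) : List Symb → List Symb → Prop
  | nil {p q : List Symb} : p.head? = some .cls → q.head? = some .cls → TupleMatch x b p q
  | cons {p q p' q' : List Symb} : Skip varL p p' → Skip numL q q' →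
      (∀ j, Same varL p (x j) → Same numL q (b j)) → TupleMatch x b p' q' → TupleMatch x b p q

theorem tupleMatch_flatMap {vs : List Var} {t : List ℕ} :
    TupleMatch x b (vs.flatMap Var.encode ++ .cls :: r) (t.flatMap encodeNat ++ .cls :: s) ↔
      List.Forall₂ (fun u c => ∀ j, Reads (x j) u → ReadsNat (b j) c) vs t := by
  constructor
  · intro h
    generalize hp : vs.flatMap Var.encode ++ .cls :: r = p at h
    generalize hq : t.flatMap encodeNat ++ .cls :: s = q at h
    induction h generalizing vs t with
    | nil h₁ h₂ =>
        rcases vs with _ | ⟨u, vs⟩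
        · rcases t with _ | ⟨c, t⟩
          · exact .nil
          · exact absurd h₂ (Prefix.numL.skip_head ⟨_, encodeNat_mem c, by rw [← hq]; simp; rfl⟩).2
        · exact absurd h₁ (Prefix.varL.skip_head ⟨_, u.encode_mem, by rw [← hp]; simp; rfl⟩).2
    | cons h₁ h₂ h₃ h₄ ih =>
        rcases vs with _ | ⟨u, vs⟩
        · exact absurd (by rw [← hp]; rfl) (Prefix.varL.skip_head h₁).2
        · rcases t with _ | ⟨c, t⟩
          · exact absurd (by rw [← hq]; rfl) (Prefix.numL.skip_head h₂).2
          · rw [List.flatMap_cons, List.append_assoc] at hp hq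
            rw [← hp, Prefix.varL.skip_append u.encode_mem] at h₁
            rw [← hq, Prefix.numL.skip_append (encodeNat_mem c)] at h₂
            refine .cons (fun j hj => ?_) (ih h₁.symm h₂.symm)
            have := h₃ j
            rw [← hp, ← hq, same_varL_left, same_numL_left] at this
            exact this hj
  · intro h
    induction h with
    | nil => exact .nil rfl rfl
    | @cons u c vs t h _ ih =>
        refine .cons (p' := vs.flatMap Var.encode ++ .cls :: r)
          (q' := t.flatMap encodeNat ++ .cls :: s) ⟨_, u.encode_mem, by simp⟩
          ⟨_, encodeNat_mem c, by simp⟩ (fun j hj => ?_) ih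
        rw [List.flatMap_cons, List.append_assoc] at hj ⊢
        exact same_numL_left.2 (h j (same_varL_left.1 hj))

open Computability in
/-- The values at `b` of the variables at `x` satisfy the atom at the position `p`. -/
def Instance.SatAt (I : Instance) (p : List Symb) (x b : Fin k → List Symb) : Prop :=
  ∃ p', Skip (symb .atom) p p' ∧ ∃ q, Skip (numL * symb .opn) p' q ∧
    ∃ e, Skip (formL∗ * symb .opn * (sortL∗ * symb .cls * (symb .opn * relL∗))) I.encode e ∧
      Same numL p' e ∧ ∃ t, Skip (numL * (listL numL * (symb .opn *
        ((listL numL)∗ * symb .opn)))) e t ∧ TupleMatch x b q t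

open Computability in
-- The reading is deterministic up to two searches: for the table of `R` among the relation tables,
-- and for a tuple in that table.
theorem Instance.satAt_iff {I : Instance} {R : ℕ} {vs : List Var} :
    I.SatAt ((QCFormula.atom R vs).encode ++ r) x b ↔ ∃ t ∈ I.struct.rel R,
      List.Forall₂ (fun u c => ∀ j, Reads (x j) u → ReadsNat (b j) c) vs t := by
  simp only [SatAt, skip_symb, QCFormula.encode, encodeList, List.cons_append, List.append_assoc,
    List.cons.injEq, true_and, exists_eq_left', Prefix.numL.skip_mul_append (encodeNat_mem R),
    List.nil_append, encode, FinStructure.encode, skip_formL_mul,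
    Prefix.sortL.skip_kstar_cls_mul SortTable.encode_mem, skip_symb_mul, same_numL_left]
  rw [Prefix.relL.exists_skip_kstar RelTable.encode_mem]
  · have h₁ : ∀ (l : List (List ℕ)) r', (∃ t, Skip ((listL numL)∗ * symb .opn)
        (l.flatMap (encodeList encodeNat) ++ .cls :: r') t ∧
          TupleMatch x b (vs.flatMap Var.encode ++ .cls :: r) t) ↔ ∃ t ∈ l,
        List.Forall₂ (fun u c => ∀ j, Reads (x j) u → ReadsNat (b j) c) vs t := by
      intro l r'
      have h₂ := Prefix.numL.listL.exists_skip_kstar (f := encodeList encodeNat)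
        (fun t => encodeList_mem (l := t) fun c _ => encodeNat_mem c) l r'
        (P := fun y => ∃ t, Skip (symb .opn) y t ∧
          TupleMatch x b (vs.flatMap Var.encode ++ .cls :: r) t)
        (by
          rintro y ⟨t, ht, -⟩
          rw [skip_symb.1 ht]
          simp)
      simp only [skip_mul, skip_symb, encodeList, List.cons_append, List.append_assoc,
        List.nil_append, List.cons.injEq, true_and, exists_eq_left', tupleMatch_flatMap] at h₂ ⊢
      refine Iff.trans ?_ (h₂.trans ?_)
      · exact ⟨fun ⟨t, ⟨y, h, h'⟩, h''⟩ => ⟨y, h, t, h', h''⟩,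
          fun ⟨y, h, t, h', h''⟩ => ⟨t, ⟨y, h, h'⟩, h''⟩⟩
      · constructor
        · rintro ⟨l₁, t, l₂, rfl, h⟩
          exact ⟨t, by simp, h⟩
        · rintro ⟨t, ht, h⟩
          obtain ⟨l₁, l₂, rfl⟩ := List.append_of_mem ht
          exact ⟨l₁, t, l₂, rfl, h⟩
    simp only [RelTable.encode, List.append_assoc, Prefix.numL.skip_mul_append (encodeNat_mem _),
      Prefix.numL.listL.skip_mul_append (encodeList_mem fun c _ => encodeNat_mem c)]
    simp only [encodeList, List.cons_append, List.append_assoc, skip_symb_mul, true_and,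
      List.nil_append, h₁]
    constructor
    · rintro ⟨l₁, T, l₂, hl, ⟨r, hr⟩, t, ht, h⟩
      exact ⟨t, ⟨T, by simp [hl], (encodeNat_append_inj hr).1, ht⟩, h⟩
    · rintro ⟨t, ⟨T, hT, hs, ht⟩, h⟩
      obtain ⟨l₁, l₂, hl⟩ := List.append_of_mem hT
      exact ⟨l₁, T, l₂, hl, ⟨_, by rw [hs]⟩, t, ht, h⟩
  · rintro y ⟨⟨s, hs⟩, -⟩
    rw [hs]
    exact (Prefix.numL.skip_head ⟨_, encodeNat_mem R, rfl⟩).2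

theorem pt_tupleMatch {α : Type} {enc : α → List Symb} : PT enc fun _ (v : Key k → List Symb) =>
    TupleMatch (fun j => v (.inr (.inl j))) (fun j => v (.inr (.inr j))) (v (.inl 0))
      (v (.inl 1)) := by
  refine PT.lfp (Φ := fun a X v =>
    ((v (.inl 0)).head? = some .cls ∧ (v (.inl 1)).head? = some .cls) ∨
      ∃ p, p <:+ enc a ∧ ∃ q, q <:+ enc a ∧ (Skip varL (v (.inl 0)) p ∧ Skip numL (v (.inl 1)) q ∧
        (∀ j, Same varL (v (.inl 0)) (v (.inr (.inl j))) →
          Same numL (v (.inl 1)) (v (.inr (.inr j)))) ∧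
        X (key p q (fun j => v (.inr (.inl j))) fun j => v (.inr (.inr j))))) ?_ ?_ ?_ ?_
  · refine .or (.and (PTX.head _ (· = some .cls)) (PTX.head _ (· = some .cls)))
      (.ex (.ex (.and ?_ (.and ?_ (.and (.forallFin fun j => .imp ?_ ?_) ?_)))))
    · exact recog_varL.ptx (some (some (Sum.inl 0))) (some none)
    · exact recog_numL.ptx (some (some (Sum.inl 1))) none
    · exact PT.ptx₂ (R := fun _ => Same varL) pt_same_varL (some (some (Sum.inl 0)))
        (some (some (Sum.inr (Sum.inl j))))
    · exact PT.ptx₂ (R := fun _ => Same numL) pt_same_numL (some (some (Sum.inl 1)))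
        (some (some (Sum.inr (Sum.inr j))))
    · exact PTX.callKey (some none) none (fun j => some (some (Sum.inr (Sum.inl j))))
        fun j => some (some (Sum.inr (Sum.inr j)))
  · rintro a X Y h v (h' | ⟨p, hp, q, hq, h₁, h₂, h₃, h₄⟩)
    · exact .inl h'
    · exact .inr ⟨p, hp, q, hq, h₁, h₂, h₃, h _ h₄⟩
  · rintro a v hv (h' | ⟨p, hp, q, hq, h₁, h₂, h₃, h₄⟩)
    · exact .nil h'.1 h'.2
    · exact .cons h₁ h₂ h₃ h₄
  · intro a X hX v hv h
    have : ∀ p q x b, TupleMatch x b p q → AreSuffixes (enc a) (key p q x b) → X (key p q x b) := by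
      intro p q x b h
      induction h with
      | nil h₁ h₂ => exact fun hs => hX _ hs (.inl ⟨h₁, h₂⟩)
      | cons h₁ h₂ h₃ h₄ ih =>
          intro hs
          obtain ⟨hp, hq, hx, hb⟩ := areSuffixes_key.1 hs
          have hp' := h₁.suffix.trans hp
          have hq' := h₂.suffix.trans hq
          exact hX _ hs (.inr ⟨_, hp', _, hq', h₁, h₂, h₃, ih (areSuffixes_key.2 ⟨hp', hq', hx, hb⟩)⟩)
    rw [← key_eta v] at hv ⊢
    exact this _ _ _ _ h hv

open Computability in
theorem Instance.pt_satAt : PT encode fun I (v : Fin 1 ⊕ (Fin k ⊕ Fin k) → List Symb) =>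
    I.SatAt (v (.inl 0)) (fun j => v (.inr (.inl j))) (fun j => v (.inr (.inr j))) := by
  intro κ _
  -- The same condition with all quantifiers bounded by the input and with the input itself named
  -- `w`; in this form the closure properties apply.
  have h : PTX encode fun I (_ : (κ → List Symb) → Prop) (v : Fin 1 ⊕ (Fin k ⊕ Fin k) → _) =>
      ∃ p', p' <:+ I.encode ∧ (Skip (symb .atom) (v (.inl 0)) p' ∧ ∃ q, q <:+ I.encode ∧
        (Skip (numL * symb .opn) p' q ∧ ∃ w, w <:+ I.encode ∧ (w = I.encode ∧
        ∃ e, e <:+ I.encode ∧ (Skip (formL∗ * symb .opn * (sortL∗ * symb .cls *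
          (symb .opn * relL∗))) w e ∧ Same numL p' e ∧ ∃ t, t <:+ I.encode ∧
          (Skip (numL * (listL numL * (symb .opn * ((listL numL)∗ * symb .opn)))) e t ∧
            TupleMatch (fun j => v (.inr (.inl j))) (fun j => v (.inr (.inr j))) q t))))) := by
    refine PTX.ex (((Recog.symb _).ptx (some (Sum.inl 0)) none).and (PTX.ex
      (((recog_numL.mul (Recog.symb _)).ptx (some none) none).and (PTX.ex ((PTX.eqInput none).and
      (PTX.ex ((((Recog.formL.mul (Recog.symb _)).mul ((recog_sortL.kstar.mul (Recog.symb _)).mul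
        ((Recog.symb _).mul recog_relL.kstar))).ptx (some none) none).and
      ((PT.ptx₂ (R := fun _ => Same numL) pt_same_numL (some (some (some none))) none).and
      (PTX.ex (((recog_numL.mul (recog_numL.listL.mul ((Recog.symb _).mul
        (recog_numL.listL.kstar.mul (Recog.symb _))))).ptx (some none) none).and ?_))))))))))
    exact PT.ptx (PT.reindex pt_tupleMatch (Sum.elim ![some (some (some none)), none]
      (Sum.elim (fun j => some (some (some (some (some (Sum.inr (Sum.inl j)))))))
        fun j => some (some (some (some (some (Sum.inr (Sum.inr j)))))))))
  refine h.congr fun I X v hv => ?_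
  constructor
  · rintro ⟨p', -, h₁, q, -, h₂, _, -, rfl, e, -, h₃, h₄, t, -, h₅, h₆⟩
    exact ⟨p', h₁, q, h₂, e, h₃, h₄, t, h₅, h₆⟩
  · rintro ⟨p', h₁, q, h₂, e, h₃, h₄, t, h₅, h₆⟩
    have hp' := h₁.suffix.trans (hv (.inl 0))
    exact ⟨p', hp', h₁, q, h₂.suffix.trans hp', h₂, _, List.suffix_rfl, rfl, e, h₃.suffix, h₃, h₄,
      t, h₅.suffix.trans h₃.suffix, h₅, h₆⟩

open Computability in
theorem Instance.pt_domAt : PT encode fun I (v : Fin 2 → List Symb) => I.DomAt (v 0) (v 1) := by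
  intro κ _
  have h : PTX encode fun I (_ : (κ → List Symb) → Prop) (v : Fin 2 → _) =>
      ∃ w, w <:+ I.encode ∧ (w = I.encode ∧ ∃ e, e <:+ I.encode ∧
        (Skip (formL∗ * symb .opn * sortL∗) w e ∧ ∃ xs, xs <:+ I.encode ∧ (Skip numL (v 0) xs ∧
        Same numL xs e ∧ ∃ c, c <:+ I.encode ∧
          (Skip (numL * (symb .opn * numL∗)) e c ∧ Same numL c (v 1))))) := by
    exact PTX.ex ((PTX.eqInput none).and (PTX.ex (((Recog.formL.mul (Recog.symb _)).mul
      recog_sortL.kstar).ptx (some none) none |>.and (PTX.ex ((recog_numL.ptx (some (some (some 0)))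
      none).and ((PT.ptx₂ (R := fun _ => Same numL) pt_same_numL none (some none)).and
      (PTX.ex (((recog_numL.mul ((Recog.symb _).mul recog_numL.kstar)).ptx (some (some none))
        none).and (PT.ptx₂ (R := fun _ => Same numL) pt_same_numL none
          (some (some (some (some 1)))))))))))))
  refine h.congr fun I X v hv => ?_
  constructor
  · rintro ⟨_, -, rfl, e, -, h₁, xs, -, h₂, h₃, c, -, h₄, h₅⟩
    exact ⟨e, h₁, xs, h₂, h₃, c, h₄, h₅⟩
  · rintro ⟨e, h₁, xs, h₂, h₃, c, h₄, h₅⟩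
    exact ⟨_, List.suffix_rfl, rfl, e, h₁.suffix, h₁, xs, h₂.suffix.trans (hv 0), h₂, h₃, c,
      h₄.suffix.trans h₁.suffix, h₄, h₅⟩

end Tuples
end QCSP

namespace QCSP

open Classical

/-! ### Derivable judgements -/

section Judgements

variable {φ : QCFormula} {B : FinStructure} {k : ℕ} {P Q : List (Judgement φ B)}
  {J : Judgement φ B}

theorem Follows.mono (h : Follows P J) (hPQ : ∀ J ∈ P, J ∈ Q) : Follows Q J := by
  cases h with
  | atom i R vs hi hV => exact .atom i R vs hi hV
  | projection i U V F hV hmem hUV hU => exact .projection i U V F hV (hPQ _ hmem) hUV hU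
  | join i U₁ U₂ F₁ F₂ h₁ h₂ hmem₁ hmem₂ hU =>
      exact .join i U₁ U₂ F₁ F₂ h₁ h₂ (hPQ _ hmem₁) (hPQ _ hmem₂) hU
  | upwardFlow i j V F hij hj hmem hi => exact .upwardFlow i j V F hij hj (hPQ _ hmem) hi
  | forallElimination i j y V F hij hall hy hj hmem hi =>
      exact .forallElimination i j y V F hij hall hy hj (hPQ _ hmem) hi
  | downwardFlow i j V F hij hi hmem hj => exact .downwardFlow i j V F hij hi (hPQ _ hmem) hj

theorem IsJudgementProof.append (hP : IsJudgementProof P) (hQ : ∀ (n : ℕ) (h : n < Q.length),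
    Follows (P ++ Q.take n) Q[n]) : IsJudgementProof (P ++ Q) := by
  intro n h
  rcases lt_or_ge n P.length with hn | hn
  · rw [List.getElem_append_left hn, List.take_append_of_le_length hn.le]
    exact hP n hn
  · obtain ⟨m, rfl⟩ := Nat.exists_eq_add_of_le hn
    rw [List.getElem_append_right hn, List.take_append, List.take_of_length_le hn]
    simp only [Nat.add_sub_cancel_left]
    exact hQ m _

/-- The judgement occurs in a judgement proof of width at most `k`. -/
def Derivable (k : ℕ) (J : Judgement φ B) : Prop :=
  ∃ P, IsJudgementProof P ∧ (∀ J' ∈ P, J'.vars.card ≤ k) ∧ J ∈ P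

theorem Derivable.card_le (h : Derivable k J) : J.vars.card ≤ k := by
  obtain ⟨P, -, h, hJ⟩ := h
  exact h J hJ

/-- Concatenate proofs of the finitely many premises and append the conclusion; more previous
judgements do no harm, by `Follows.mono`. -/
theorem Derivable.of_follows (h : Follows P J) (hP : ∀ J' ∈ P, Derivable k J')
    (hk : J.vars.card ≤ k) : Derivable k J := by
  have : ∃ Q, IsJudgementProof Q ∧ (∀ J' ∈ Q, J'.vars.card ≤ k) ∧ ∀ J' ∈ P, J' ∈ Q := by
    clear h
    induction P with
    | nil => exact ⟨[], fun n h => absurd h (by simp), by simp, by simp⟩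
    | cons J' P ih =>
        obtain ⟨Q, hQ, hQ', hPQ⟩ := ih fun J'' hJ'' => hP J'' (List.mem_cons_of_mem _ hJ'')
        obtain ⟨Q', h₁, h₂, h₃⟩ := hP J' List.mem_cons_self
        refine ⟨Q ++ Q', hQ.append fun n h => (h₁ n h).mono fun _ h =>
          List.mem_append_right _ h, fun J hJ => ?_, fun J hJ => ?_⟩
        · exact (List.mem_append.1 hJ).elim (hQ' J) (h₂ J)
        · rcases List.mem_cons.1 hJ with rfl | hJ
          exacts [List.mem_append_right _ h₃, List.mem_append_left _ (hPQ J hJ)]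
  obtain ⟨Q, hQ, hQ', hPQ⟩ := this
  refine ⟨Q ++ [J], hQ.append fun n hn => ?_, fun J' hJ' => ?_, by simp⟩
  · obtain rfl : n = 0 := by simpa using hn
    simpa using h.mono hPQ
  · rcases List.mem_append.1 hJ' with h | h
    · exact hQ' J' h
    · rwa [List.mem_singleton.1 h]

theorem Derivable.of_follows_one {J' : Judgement φ B} (h : Derivable k J') (h' : Follows [J'] J)
    (hk : J.vars.card ≤ k) : Derivable k J :=
  .of_follows h' (by simpa using h) hk

/-- Replaces sequences by an induction over rule applications, in which the premises are known to be
derivable as well. -/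
theorem Derivable.induction {C : Judgement φ B → Prop}
    (step : ∀ P J, (∀ J' ∈ P, Derivable k J' ∧ C J') → Follows P J → J.vars.card ≤ k → C J)
    (h : Derivable k J) : C J := by
  obtain ⟨P, hP, hk, hJ⟩ := h
  have : ∀ n, ∀ h : n < P.length, C P[n] := by
    intro n
    induction n using Nat.strong_induction_on with
    | _ n ih =>
        intro h
        refine step (P.take n) _ (fun J' hJ' => ?_) (hP n h) (hk _ (List.getElem_mem h))
        obtain ⟨m, hm, rfl⟩ := List.mem_take_iff_getElem.1 hJ'
        exact ⟨⟨P, hP, hk, List.getElem_mem _⟩, ih m (by omega) _⟩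
  obtain ⟨n, hn, rfl⟩ := List.getElem_of_mem hJ
  exact this n hn

theorem FinStructure.dom_finite (B : FinStructure) (s : ℕ) : (B.dom s).Finite := by
  refine (B.sorts.flatMap SortTable.elems).toFinset.finite_toSet.subset ?_
  rintro b ⟨T, hT, -, hb⟩
  exact List.mem_toFinset.2 (List.mem_flatMap.2 ⟨T, hT, hb⟩)

instance (V : Finset Var) : Finite (Mapping B V) := by
  have : ∀ v : {v : Var // v ∈ V}, Finite {b : ℕ // b ∈ B.dom v.1.sort} :=
    fun v => (B.dom_finite _).to_subtype
  unfold Mapping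
  infer_instance

variable {i : φ.Index} {V : Finset Var} {hV : V ⊆ (φ.subAt i).free}

/-- The join over the same variables is the intersection, and it does not increase the width. The
projection only leads from `V ∪ V` back to `V`. -/
theorem Derivable.inter {F₁ F₂ : Set (Mapping B V)} (h₁ : Derivable k ⟨i, V, F₁, hV⟩)
    (h₂ : Derivable k ⟨i, V, F₂, hV⟩) : Derivable k ⟨i, V, F₁ ∩ F₂, hV⟩ := by
  have hk := h₁.card_le
  have h := Derivable.of_follows (P := [⟨i, V, F₁, hV⟩, ⟨i, V, F₂, hV⟩]) (k := k)
    (.join i V V F₁ F₂ hV hV (by simp) (by simp) (by simpa using hV)) (by simp [h₁, h₂])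
    (by simpa using hk)
  have h' := h.of_follows_one (.projection i V (V ∪ V) _ _ List.mem_cons_self
    Finset.subset_union_left hV) hk
  have : F₁ ∩ F₂ = Mapping.restrict Finset.subset_union_left '' join F₁ F₂ := by
    ext f
    constructor
    · rintro ⟨hf₁, hf₂⟩
      exact ⟨fun v => f ⟨v.1, by simpa using v.2⟩, ⟨hf₁, hf₂⟩, rfl⟩
    · rintro ⟨g, hg, rfl⟩
      exact hg
  rwa [this]

/-- Intersect, over the finitely many elements of `S`, judgements that omit them one by one. This
passes from single excluded mappings back to whole constraints. The last hypothesis is needed when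
`S` is empty: some judgement must be derivable to begin with. -/
theorem Derivable.exists_disjoint (S : Set (Mapping B V))
    (hS : ∀ f ∈ S, ∃ F, Derivable k ⟨i, V, F, hV⟩ ∧ f ∉ F) (h : ∃ F : Set (Mapping B V), Derivable k ⟨i, V, F, hV⟩) :
    ∃ F, Derivable k ⟨i, V, F, hV⟩ ∧ ∀ f ∈ S, f ∉ F := by
  induction S, S.toFinite using Set.Finite.induction_on with
  | empty =>
      obtain ⟨F, hF⟩ := h
      exact ⟨F, hF, by simp⟩
  | @insert f S _ _ ih =>
      obtain ⟨F, hF, hF'⟩ := ih fun g hg => hS g (Set.mem_insert_of_mem f hg)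
      obtain ⟨G, hG, hG'⟩ := hS f (Set.mem_insert f S)
      refine ⟨_, hF.inter hG, fun g hg => ?_⟩
      rcases hg with rfl | hg
      exacts [fun h => hG' h.2, fun h => hF' g hg h.1]

end Judgements

/-! ### Judgements as strings -/

section Strings

variable {k : ℕ} {B : FinStructure} {V U : Finset Var} {x x' b b' : Fin k → List Symb}

/-- The variables written at `x` are those in `V`. -/
def Lists (x : Fin k → List Symb) (V : Finset Var) : Prop :=
  (∀ j, x j = [] ∨ ∃ u ∈ V, Reads (x j) u) ∧ ∀ u ∈ V, ∃ j, Reads (x j) u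

theorem Lists.mem (h : Lists x V) {j : Fin k} {u : Var} (hu : Reads (x j) u) : u ∈ V := by
  rcases h.1 j with h | ⟨v, hv, h⟩
  · exact absurd h hu.ne_nil
  · rwa [hu.unique h]

/-- The `k` entries of `x` are themselves the bound on the width, so the rules on strings need no
separate condition for it. -/
theorem Lists.card_le (h : Lists x V) : V.card ≤ k := by
  choose j hj using h.2
  have : Function.Injective fun u : {u // u ∈ V} => j u.1 u.2 := by
    intro u v huv
    have h₁ := hj u.1 u.2
    have h₂ := hj v.1 v.2
    rw [show j u.1 u.2 = j v.1 v.2 from huv] at h₁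
    exact Subtype.ext (h₁.unique h₂)
  simpa using Fintype.card_le_of_injective _ this

/-- Each variable is represented by a position where it is written, and entries that are left over
are filled with the empty suffix. -/
theorem exists_lists {I : Instance} {i : I.formula.Index} (hV : V ⊆ (I.formula.subAt i).free)
    (hk : V.card ≤ k) : ∃ x : Fin k → List Symb, AreSuffixes I.encode x ∧ Lists x V := by
  choose w hw hw' using fun u : {u // u ∈ V} => Instance.exists_reads (hV u.2)
  refine ⟨fun j => if h : j.1 < V.card then w (V.equivFin.symm ⟨j, h⟩) else [], fun j => ?_,
    fun j => ?_, fun u hu => ?_⟩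
  · dsimp only
    split
    exacts [hw _, List.nil_suffix]
  · dsimp only
    split
    · exact .inr ⟨_, (V.equivFin.symm _).2, hw' _⟩
    · exact .inl rfl
  · refine ⟨⟨V.equivFin ⟨u, hu⟩, (V.equivFin ⟨u, hu⟩).2.trans_le hk⟩, ?_⟩
    simpa using hw' ⟨u, hu⟩

/-- The values at `b` of the variables at `x` are those of `f`. -/
def Agrees (x b : Fin k → List Symb) (f : Mapping B V) : Prop :=
  ∀ v j, Reads (x j) v.1 → ReadsNat (b j) (f v).1

theorem Lists.exists_agrees {I : Instance} (h : Lists x V) (f : Mapping I.struct V) :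
    ∃ b, AreSuffixes I.encode b ∧ Agrees x b f := by
  have : ∀ j, ∃ b, b <:+ I.encode ∧ ∀ v, Reads (x j) v.1 → ReadsNat b (f v).1 := by
    intro j
    rcases h.1 j with h | ⟨u, hu, h⟩
    · exact ⟨[], List.nil_suffix, fun v hv => absurd h hv.ne_nil⟩
    · obtain ⟨b, hb, hb'⟩ := Instance.exists_readsNat (f ⟨u, hu⟩).2
      refine ⟨b, hb, fun v hv => ?_⟩
      obtain rfl : v = ⟨u, hu⟩ := Subtype.ext (hv.unique h)
      exact hb'
  choose b hb hb' using this
  exact ⟨b, hb, fun v j hv => hb' j v hv⟩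

theorem Lists.agrees_unique (h : Lists x V) {f g : Mapping B V} (hf : Agrees x b f)
    (hg : Agrees x b g) : f = g := by
  funext v
  obtain ⟨j, hj⟩ := h.2 v.1 v.2
  exact Subtype.ext ((hf v j hj).unique (hg v j hj))

/-- The variables that are written both at `x` and at `x'` have the same values. -/
def Compatible (x b x' b' : Fin k → List Symb) : Prop :=
  ∀ j j', Same varL (x j) (x' j') → Same numL (b j) (b' j')

/-- The variables written at `x` are written at `x'`. -/
def Included (x x' : Fin k → List Symb) : Prop :=
  ∀ j, x j = [] ∨ ∃ j', Same varL (x j) (x' j')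

/-- The strings `b` are the values of a mapping of the variables written at `x`. -/
def Valid (I : Instance) (x b : Fin k → List Symb) : Prop :=
  Compatible x b x b ∧ ∀ j, x j = [] ∨ I.DomAt (x j) (b j)

theorem Lists.included (h : Lists x V) (h' : Lists x' U) : Included x x' ↔ V ⊆ U := by
  constructor
  · intro hi u hu
    obtain ⟨j, hj⟩ := h.2 u hu
    rcases hi j with hi | ⟨j', hi⟩
    · exact absurd hi hj.ne_nil
    · exact h'.mem (hj.same.1 hi)
  · intro hVU j
    refine (h.1 j).imp_right fun ⟨u, hu, hj⟩ => ?_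
    obtain ⟨j', hj'⟩ := h'.2 u (hVU hu)
    exact ⟨j', hj.same.2 hj'⟩

theorem Lists.valid_iff {I : Instance} (h : Lists x V) :
    Valid I x b ↔ ∃ f : Mapping I.struct V, Agrees x b f := by
  constructor
  · rintro ⟨h₁, h₂⟩
    have : ∀ v : {v // v ∈ V}, ∃ c : {c // c ∈ I.struct.dom v.1.sort},
        ∀ j, Reads (x j) v.1 → ReadsNat (b j) c.1 := by
      intro v
      obtain ⟨j, hj⟩ := h.2 v.1 v.2
      obtain ⟨c, hc, hc'⟩ := (Instance.domAt_iff hj).1 ((h₂ j).resolve_left hj.ne_nil)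
      exact ⟨⟨c, hc⟩, fun j' hj' => hc'.same.1 (h₁ j j' (hj.same.2 hj'))⟩
    choose f hf using this
    exact ⟨f, hf⟩
  · rintro ⟨f, hf⟩
    refine ⟨fun j j' hj => ?_, fun j => ?_⟩
    · rcases h.1 j with h | ⟨u, hu, h⟩
      · rw [h] at hj
        exact absurd hj (not_same_nil Prefix.varL)
      · exact (hf ⟨u, hu⟩ j h).same.2 (hf ⟨u, hu⟩ j' (h.same.1 hj))
    · refine (h.1 j).imp_right fun ⟨u, hu, h⟩ => ?_
      exact (Instance.domAt_iff h).2 ⟨_, (f ⟨u, hu⟩).2, hf ⟨u, hu⟩ j h⟩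

/-- Restriction of mappings becomes a comparison of strings. -/
theorem Agrees.restrict (h : Lists x U) (h' : Lists x' V) (hUV : U ⊆ V) {f : Mapping B V}
    (hf : Agrees x' b' f) : Agrees x b (f.restrict hUV) ↔ Compatible x b x' b' := by
  constructor
  · intro hg j j' hj
    rcases h.1 j with h | ⟨u, hu, h⟩
    · rw [h] at hj
      exact absurd hj (not_same_nil Prefix.varL)
    · exact (hg ⟨u, hu⟩ j h).same.2 (hf ⟨u, hUV hu⟩ j' (h.same.1 hj))
  · intro hc v j hj
    obtain ⟨j', hj'⟩ := h'.2 v.1 (hUV v.2)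
    exact (hf ⟨v.1, hUV v.2⟩ j' hj').same.1 (hc j j' (hj.same.2 hj')).symm

end Strings

end QCSP

namespace QCSP

open Classical

/-! ### Rules for excluded mappings and their soundness -/

section Rules

variable {k : ℕ} {I : Instance} {p z : List Symb} {x b : Fin k → List Symb}

/-- A judgement at the node at `p` with the variables written at `x` is derivable; if the flag `z`
is empty, then its constraint does not contain the mapping with the values at `b`. -/
def Excludes (I : Instance) (p z : List Symb) (x b : Fin k → List Symb) : Prop :=
  ∃ i V, p = I.pos i ∧ Lists x V ∧ ∃ F hV,
    Derivable k (⟨i, V, F, hV⟩ : Judgement I.formula I.struct) ∧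
      (z = [] → ∀ f ∈ F, ¬ Agrees x b f)

/-- The conclusion of an application of the rule for atoms. -/
def AtomRule (I : Instance) (p z : List Symb) (x b : Fin k → List Symb) : Prop :=
  p.head? = some .atom ∧ I.NodeAt p ∧ (∀ j, x j = [] ∨ AtomVar p (x j)) ∧
    (∀ y, y <:+ I.encode → AtomVar p y → ∃ j, Same varL y (x j)) ∧ (z = [] → ¬ I.SatAt p x b)

/-- The conclusion of an application of the rule for projections. -/
def ProjectionRule (I : Instance) (X : (Key k → List Symb) → Prop) (p z : List Symb)
    (x b : Fin k → List Symb) : Prop :=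
  -- A query with the flag `p` only asks whether a judgement is derivable, because the position of a
  -- node is never empty; the values `x'` are a dummy. Derivability has to be known separately: if
  -- there are no mappings, for instance over an empty universe, the condition on excluded mappings
  -- is vacuous.
  ∃ x', AreSuffixes I.encode x' ∧ (Included x x' ∧ X (key p p x' x') ∧
    (z = [] → ∀ b', AreSuffixes I.encode b' → Compatible x b x' b' → X (key p z x' b')))

/-- The conclusion of an application of the rule for joins. -/
def JoinRule (I : Instance) (X : (Key k → List Symb) → Prop) (p z : List Symb)
    (x b : Fin k → List Symb) : Prop :=
  ∃ x₁, AreSuffixes I.encode x₁ ∧ ∃ x₂, AreSuffixes I.encode x₂ ∧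
    (Included x₁ x ∧ Included x₂ x ∧
      (∀ j, x j = [] ∨ (∃ j', Same varL (x j) (x₁ j')) ∨ ∃ j', Same varL (x j) (x₂ j')) ∧
      X (key p p x₁ x₁) ∧ X (key p p x₂ x₂) ∧
      (z = [] →
        (∀ b₁, AreSuffixes I.encode b₁ → Compatible x₁ b₁ x b → X (key p z x₁ b₁)) ∨
        (∀ b₂, AreSuffixes I.encode b₂ → Compatible x₂ b₂ x b → X (key p z x₂ b₂))))

/-- The conclusion of an application of one of the rules for flows. -/
def FlowRule (I : Instance) (X : (Key k → List Symb) → Prop) (p z : List Symb)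
    (x b : Fin k → List Symb) : Prop :=
  I.NodeAt p ∧ (∀ j, x j = [] ∨ I.FreeAt p (x j)) ∧ ∃ q, q <:+ I.encode ∧
    ((ChildAt p q ∨ ChildAt q p) ∧ X (key q z x b))

/-- The conclusion of an application of the rule for eliminations. -/
def EliminationRule (I : Instance) (X : (Key k → List Symb) → Prop) (p z : List Symb)
    (x b : Fin k → List Symb) : Prop :=
  I.NodeAt p ∧ ∃ y, y <:+ I.encode ∧ (p = .all :: y ∧ (∀ j, ¬ Same varL y (x j)) ∧
    ∃ q, q <:+ I.encode ∧ (ChildAt p q ∧ ∃ x', AreSuffixes I.encode x' ∧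
      ((∃ j, Same varL y (x' j)) ∧ Included x x' ∧
      (∀ j, x' j = [] ∨ Same varL y (x' j) ∨ ∃ j', Same varL (x' j) (x j')) ∧
      -- If `b` stands for a mapping, then `b'` has to stand for one of its extensions. Otherwise
      -- there is nothing to exclude and `b'` may be arbitrary.
      ∃ b', AreSuffixes I.encode b' ∧ (X (key q z x' b') ∧ (z = [] → Valid I x b →
        Compatible x' b' x' b' ∧ Compatible x b x' b' ∧
          ∀ j, Same varL y (x' j) → I.DomAt (x' j) (b' j))))))

theorem Instance.pos_ne_nil (i : I.formula.Index) : I.pos i ≠ [] := by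
  simp [Instance.pos, QCFormula.encode_ne_nil]

theorem Instance.pos_of_subAt {i : I.formula.Index} {ψ : QCFormula} (h : I.formula.subAt i = ψ) :
    I.pos i = ψ.encode ++ I.formula.restAt i.1 I.struct.encode := by
  rw [Instance.pos, h]

/-- The position determines the node and `x` determines the set of variables, so the existential
quantifiers over them can be dropped. -/
theorem Lists.excludes_iff {V : Finset Var} (hx : Lists x V) {i : I.formula.Index}
    (hp : p = I.pos i) : Excludes I p z x b ↔ ∃ F hV,
      Derivable k (⟨i, V, F, hV⟩ : Judgement I.formula I.struct) ∧
        (z = [] → ∀ f ∈ F, ¬ Agrees x b f) := by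
  constructor
  · rintro ⟨i', V', h, hx', h'⟩
    obtain rfl : i = i' := Instance.pos_injective (hp.symm.trans h)
    obtain rfl : V = V' := by
      ext u
      exact ⟨fun hu => (hx.2 u hu).elim fun j hj => hx'.mem hj,
        fun hu => (hx'.2 u hu).elim fun j hj => hx.mem hj⟩
    exact h'
  · exact fun h => ⟨i, V, hp, hx, h⟩

theorem QCFormula.WellSorted.sub {B : FinStructure} {φ ψ : QCFormula} {p : List ℕ}
    (h : φ.WellSorted B) (hp : φ.sub p = some ψ) : ψ.WellSorted B := by
  induction p generalizing φ with
  | nil => cases hp; exact h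
  | cons c p ih =>
      obtain ⟨χ, hχ, hp⟩ := QCFormula.sub_cons.1 hp
      refine ih ?_ hp
      cases φ with
      | atom R vs => simp [QCFormula.child] at hχ
      | conj n ψ =>
          obtain ⟨hc, rfl⟩ := QCFormula.child_conj.1 hχ
          exact h _
      | all y ψ =>
          simp only [QCFormula.child, Option.ite_none_right_eq_some, Option.some.injEq] at hχ
          exact hχ.2 ▸ h.2
      | ex y ψ =>
          simp only [QCFormula.child, Option.ite_none_right_eq_some, Option.some.injEq] at hχ
          exact hχ.2 ▸ h.2

theorem Instance.mem_dom_of_mem_rel {i : I.formula.Index} {R : ℕ} {vs : List Var}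
    (hi : I.formula.subAt i = .atom R vs) {t : List ℕ} (ht : t ∈ I.struct.rel R) :
    List.Forall₂ (fun c s => c ∈ I.struct.dom s) t (vs.map Var.sort) := by
  have h := I.formula_wf.sub (QCFormula.sub_index i)
  rw [hi] at h
  obtain ⟨T, hT, hR, hvs⟩ : I.struct.HasArity R (vs.map Var.sort) := h
  obtain ⟨T', hT', hR', ht⟩ := ht
  have := List.inj_on_of_nodup_map I.struct_wf.rels_nodup hT hT' (hR.trans hR'.symm)
  rw [← hvs, this]
  exact I.struct_wf.tuples_mem T' hT' t ht

theorem Mapping.getElem_tuple {B : FinStructure} {vs : List Var} (f : Mapping B vs.toFinset) {n : ℕ}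
    (h : n < (f.tuple vs).length) (h' : n < vs.length) :
    (f.tuple vs)[n] = (f ⟨vs[n], by simp⟩).1 := by
  have : vs.attach[n]'(by simpa using h') = ⟨vs[n], by simp⟩ := List.getElem_attach _
  simp only [Mapping.tuple, List.getElem_map]
  rw [this]

/-- The mappings that satisfy an atom. -/
theorem Lists.satAt_iff {i : I.formula.Index} {R : ℕ} {vs : List Var}
    (hi : I.formula.subAt i = .atom R vs) (hx : Lists x vs.toFinset) :
    I.SatAt (I.pos i) x b ↔ ∃ f : Mapping I.struct vs.toFinset,
      f.tuple vs ∈ I.struct.rel R ∧ Agrees x b f := by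
  rw [Instance.pos_of_subAt hi, Instance.satAt_iff]
  constructor
  · rintro ⟨t, ht, h⟩
    obtain ⟨hl, h⟩ := List.forall₂_iff_get.1 h
    obtain ⟨-, h'⟩ := List.forall₂_iff_get.1 (Instance.mem_dom_of_mem_rel hi ht)
    have : ∀ v : {v // v ∈ vs.toFinset}, ∃ c : {c // c ∈ I.struct.dom v.1.sort},
        ∀ j, Reads (x j) v.1 → ReadsNat (b j) c.1 := by
      rintro ⟨v, hv⟩
      obtain ⟨n, hn, rfl⟩ := List.getElem_of_mem (List.mem_toFinset.1 hv)
      have hn' : n < t.length := hl ▸ hn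
      exact ⟨⟨t[n], by simpa using h' n hn' (by simpa using hn)⟩, fun j hj => h n hn hn' j hj⟩
    choose f hf using this
    -- A variable may occur several times in the atom, and `f` was read off from one occurrence. All
    -- occurrences carry the same value, since each of them equals the value at `b j` for an entry
    -- `x j` with this variable.
    have hft : Mapping.tuple vs f = t := by
      refine List.ext_getElem (by simp [Mapping.tuple, hl]) fun n h₁ h₂ => ?_
      have hn : n < vs.length := hl ▸ h₂
      obtain ⟨j, hj⟩ := hx.2 vs[n] (by simp)
      have h₃ := hf ⟨vs[n], by simp⟩ j hj
      rw [Mapping.getElem_tuple f h₁ hn]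
      exact h₃.unique (h n hn h₂ j hj)
    exact ⟨f, hft.symm ▸ ht, hf⟩
  · rintro ⟨f, hf, h⟩
    refine ⟨_, hf, List.forall₂_iff_get.2 ⟨by simp [Mapping.tuple], fun n h₁ h₂ j hj => ?_⟩⟩
    rw [List.get_eq_getElem, Mapping.getElem_tuple f h₂ h₁]
    exact h ⟨vs[n], by simp⟩ j hj

theorem AtomRule.excludes (h : AtomRule I p z x b) : Excludes I p z x b := by
  obtain ⟨h₁, ⟨i, rfl⟩, h₂, h₃, h₄⟩ := h
  obtain ⟨R, vs, hi⟩ : ∃ R vs, I.formula.subAt i = .atom R vs := by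
    rw [Instance.pos] at h₁
    cases h : I.formula.subAt i <;> simp [h, QCFormula.encode] at h₁ ⊢
  have hv : ∀ y, AtomVar (I.pos i) y ↔ ∃ u ∈ vs, Reads y u := by
    intro y
    rw [Instance.pos_of_subAt hi, atomVar_encode]
    constructor
    · rintro ⟨R', vs', h, h'⟩
      cases h
      exact h'
    · exact fun h => ⟨R, vs, rfl, h⟩
  have hV : vs.toFinset ⊆ (I.formula.subAt i).free := by simp [hi, QCFormula.free]
  have hx : Lists x vs.toFinset := by
    refine ⟨fun j => (h₂ j).imp_right fun h => ?_, fun u hu => ?_⟩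
    · simpa using (hv _).1 h
    · obtain ⟨y, hy, hu'⟩ := Instance.exists_reads (hV hu)
      obtain ⟨j, hj⟩ := h₃ y hy ((hv y).2 ⟨u, List.mem_toFinset.1 hu, hu'⟩)
      exact ⟨j, hu'.same.1 hj⟩
  refine (hx.excludes_iff rfl).2 ⟨_, hV, .of_follows (P := []) (.atom i R vs hi hV) (by simp)
    hx.card_le, fun hz f hf hf' => h₄ hz ((hx.satAt_iff hi).2 ⟨f, hf, hf'⟩)⟩

/-- The relation `Excludes` as a relation of tuples of strings. -/
def ExcludesKey (I : Instance) (v : Key k → List Symb) : Prop :=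
  Excludes I (v (.inl 0)) (v (.inl 1)) (fun j => v (.inr (.inl j))) fun j => v (.inr (.inr j))

theorem excludesKey_key : ExcludesKey I (key p z x b) ↔ Excludes I p z x b := Iff.rfl

theorem Lists.exists_of_included {x x' : Fin k → List Symb} {V : Finset Var} (h : Lists x' V)
    (hx : Included x x') : ∃ U, U ⊆ V ∧ Lists x U := by
  have key : ∀ j, x j = [] ∨ ∃ u ∈ V, Reads (x j) u := by
    intro j
    refine (hx j).imp_right fun ⟨j', hj⟩ => ?_
    rcases h.1 j' with h | ⟨u, hu, h⟩
    · rw [h] at hj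
      exact absurd hj.symm (not_same_nil Prefix.varL)
    · exact ⟨u, hu, h.same.1 hj.symm⟩
  refine ⟨V.filter fun u => ∃ j, Reads (x j) u, Finset.filter_subset _ _, fun j => ?_,
    fun u hu => (Finset.mem_filter.1 hu).2⟩
  exact (key j).imp_right fun ⟨u, hu, h⟩ => ⟨u, Finset.mem_filter.2 ⟨hu, j, h⟩, h⟩

/-- The extensions of the mapping are excluded by possibly different judgements; their intersection
excludes all extensions at once, and projecting it excludes the mapping. -/
theorem ProjectionRule.excludes (h : ProjectionRule I (ExcludesKey I) p z x b) :
    Excludes I p z x b := by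
  simp only [ProjectionRule, excludesKey_key] at h
  obtain ⟨x', hx', h₁, ⟨i, V, rfl, hV, F₀, hVi, hF₀, -⟩, h₃⟩ := h
  simp only [hV.excludes_iff rfl] at h₃
  obtain ⟨U, hUV, hU⟩ := hV.exists_of_included h₁
  refine (hU.excludes_iff rfl).2 ?_
  obtain ⟨F, hF, hF'⟩ := Derivable.exists_disjoint (k := k) (hV := hVi)
    {f : Mapping I.struct V | z = [] ∧ Agrees x b (f.restrict hUV)} (by
      rintro f ⟨hz, hf⟩
      obtain ⟨b', hb', hfb⟩ := hV.exists_agrees f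
      obtain ⟨F, _, hF, hF'⟩ := h₃ hz b' hb' ((hfb.restrict hU hV hUV).1 hf)
      exact ⟨F, hF, fun h => hF' hz f h hfb⟩) ⟨F₀, hF₀⟩
  refine ⟨_, hUV.trans hVi, hF.of_follows_one (.projection i U V F hVi List.mem_cons_self hUV _)
    hU.card_le, ?_⟩
  rintro hz _ ⟨f, hf, rfl⟩ hf'
  exact hF' f ⟨hz, hf'⟩ hf

theorem JoinRule.excludes (h : JoinRule I (ExcludesKey I) p z x b) : Excludes I p z x b := by
  simp only [JoinRule, excludesKey_key] at h
  obtain ⟨x₁, hx₁, x₂, hx₂, hi₁, hi₂, hc, ⟨i, V₁, rfl, hV₁, F₁, hF, hF₁, -⟩,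
    ⟨i', V₂, hi', hV₂, F₂, hG, hF₂, -⟩, h⟩ := h
  obtain rfl := Instance.pos_injective hi'
  have hV : Lists x (V₁ ∪ V₂) := by
    refine ⟨fun j => (hc j).imp_right ?_, fun u hu => ?_⟩
    · rintro (⟨j', h⟩ | ⟨j', h⟩)
      · rcases hV₁.1 j' with h' | ⟨u, hu, h'⟩
        · rw [h'] at h
          exact absurd h.symm (not_same_nil Prefix.varL)
        · exact ⟨u, Finset.mem_union_left _ hu, h'.same.1 h.symm⟩
      · rcases hV₂.1 j' with h' | ⟨u, hu, h'⟩
        · rw [h'] at h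
          exact absurd h.symm (not_same_nil Prefix.varL)
        · exact ⟨u, Finset.mem_union_right _ hu, h'.same.1 h.symm⟩
    · rcases Finset.mem_union.1 hu with hu | hu
      · obtain ⟨j, hj⟩ := hV₁.2 u hu
        obtain ⟨j', h⟩ := (hi₁ j).resolve_left hj.ne_nil
        exact ⟨j', hj.same.1 h⟩
      · obtain ⟨j, hj⟩ := hV₂.2 u hu
        obtain ⟨j', h⟩ := (hi₂ j).resolve_left hj.ne_nil
        exact ⟨j', hj.same.1 h⟩
  have hfree := Finset.union_subset hF hG
  have join : ∀ F₁ F₂, Derivable k (⟨i, V₁, F₁, hF⟩ : Judgement I.formula I.struct) →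
      Derivable k (⟨i, V₂, F₂, hG⟩ : Judgement I.formula I.struct) →
      Derivable k (⟨i, V₁ ∪ V₂, join F₁ F₂, hfree⟩ : Judgement I.formula I.struct) :=
    fun F₁ F₂ h₁ h₂ => .of_follows (P := [⟨i, V₁, F₁, hF⟩, ⟨i, V₂, F₂, hG⟩])
      (.join i V₁ V₂ F₁ F₂ hF hG (by simp) (by simp) hfree) (by simp [h₁, h₂]) hV.card_le
  refine (hV.excludes_iff rfl).2 ?_
  -- If only derivability is asked for, or if `b` stands for no mapping, then any join will do.
  -- Otherwise `b` determines the mapping, and one factor of the join is chosen so that it omits the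
  -- restriction.
  by_cases hz : z = [] ∧ ∃ f : Mapping I.struct (V₁ ∪ V₂), Agrees x b f
  · obtain ⟨hz, f, hf⟩ := hz
    have huniq : ∀ g : Mapping I.struct (V₁ ∪ V₂), Agrees x b g → g = f :=
      fun g hg => hV.agrees_unique hg hf
    rcases h hz with h | h
    · obtain ⟨b₁, hb₁, hfb⟩ := hV₁.exists_agrees (f.restrict Finset.subset_union_left)
      obtain ⟨F, _, hF', hF''⟩ := (hV₁.excludes_iff rfl).1 (h b₁ hb₁
        ((hf.restrict hV₁ hV Finset.subset_union_left).1 hfb))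
      refine ⟨_, hfree, join _ _ hF' hF₂, fun _ g hg hg' => ?_⟩
      rw [huniq g hg'] at hg
      exact hF'' hz _ hg.1 hfb
    · obtain ⟨b₁, hb₁, hfb⟩ := hV₂.exists_agrees (f.restrict Finset.subset_union_right)
      obtain ⟨F, _, hF', hF''⟩ := (hV₂.excludes_iff rfl).1 (h b₁ hb₁
        ((hf.restrict hV₂ hV Finset.subset_union_right).1 hfb))
      refine ⟨_, hfree, join _ _ hF₁ hF', fun _ g hg hg' => ?_⟩
      rw [huniq g hg'] at hg
      exact hF'' hz _ hg.2 hfb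
  · exact ⟨_, hfree, join _ _ hF₁ hF₂, fun h f _ hf => hz ⟨h, f, hf⟩⟩

theorem FlowRule.excludes (h : FlowRule I (ExcludesKey I) p z x b) : Excludes I p z x b := by
  simp only [FlowRule, excludesKey_key] at h
  obtain ⟨⟨i, rfl⟩, hfree, q, hq, hpq, ⟨j, V, rfl, hV, F, hVj, hF, hF'⟩⟩ := h
  have hVi : V ⊆ (I.formula.subAt i).free := by
    intro u hu
    obtain ⟨n, hn⟩ := hV.2 u hu
    obtain ⟨i', u', hi, hu', hu''⟩ := (hfree n).resolve_left hn.ne_nil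
    rw [Instance.pos_injective hi, hn.unique hu']
    exact hu''
  refine ⟨i, V, rfl, hV, F, hVi, hF.of_follows_one ?_ hV.card_le, hF'⟩
  rcases hpq with h | h
  · obtain ⟨j', hj, h⟩ := Instance.childAt_pos.1 h
    obtain rfl := Instance.pos_injective h
    exact .upwardFlow i j V F hj hVj List.mem_cons_self hVi
  · obtain ⟨j', hj, h⟩ := Instance.childAt_pos.1 h
    obtain rfl := Instance.pos_injective h
    exact .downwardFlow j i V F hj hVj List.mem_cons_self hVi

/-- One excluded extension `f[y → d]` is enough, since the elimination keeps `f` only if all its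
extensions belong to the constraint. -/
theorem EliminationRule.excludes (h : EliminationRule I (ExcludesKey I) p z x b) :
    Excludes I p z x b := by
  simp only [EliminationRule, excludesKey_key] at h
  obtain ⟨⟨i, rfl⟩, y, -, hy, hyx, q, -, hq, x', -, hyx', hxx', hx', b', -,
    ⟨j, V, rfl, hV, F, hVj, hF, hF'⟩, hb⟩ := h
  obtain ⟨j', hij, h⟩ := Instance.childAt_pos.1 hq
  obtain rfl := Instance.pos_injective h
  obtain ⟨c, hc, hc'⟩ := QCFormula.isParent_iff.1 hij
  obtain ⟨u, hi⟩ : ∃ u, I.formula.subAt i = .all u (I.formula.subAt j) := by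
    rw [Instance.pos] at hy
    cases h : I.formula.subAt i with
    | all u ψ =>
        simp only [h, QCFormula.child, Option.ite_none_right_eq_some, Option.some.injEq] at hc'
        exact ⟨u, by rw [hc'.2]⟩
    | _ => simp [h, QCFormula.encode] at hy
  have hyu : Reads y u := by
    rw [Instance.pos_of_subAt hi] at hy
    simp only [QCFormula.encode, List.cons_append, List.append_assoc, List.cons.injEq, true_and]
      at hy
    exact ⟨_, hy.symm⟩
  simp only [hyu.same] at hyx hyx' hx' hb
  have hVx : Lists x (V.erase u) := by
    refine ⟨fun n => (hxx' n).imp_right ?_, fun v hv => ?_⟩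
    · rintro ⟨m, hm⟩
      rcases hV.1 m with h | ⟨v, hv, h⟩
      · rw [h] at hm
        exact absurd hm.symm (not_same_nil Prefix.varL)
      · have := h.same.1 hm.symm
        exact ⟨v, Finset.mem_erase.2 ⟨fun e => hyx n (e ▸ this), hv⟩, this⟩
    · obtain ⟨hvu, hv⟩ := Finset.mem_erase.1 hv
      obtain ⟨n, hn⟩ := hV.2 v hv
      rcases hx' n with h | h | ⟨m, h⟩
      · exact absurd h hn.ne_nil
      · exact absurd (hn.unique h) hvu
      · exact ⟨m, hn.same.1 h⟩
  have huV : u ∈ V := hyx'.elim fun n hn => hV.mem hn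
  have hVi : V.erase u ⊆ (I.formula.subAt i).free := by
    rw [hi]
    exact Finset.erase_subset_erase u hVj
  refine (hVx.excludes_iff rfl).2 ⟨_, hVi, hF.of_follows_one (.forallElimination i j u V F hij hi huV
    hVj List.mem_cons_self hVi) hVx.card_le, fun hz f hf hfx => ?_⟩
  obtain ⟨h₁, h₂, h₃⟩ := hb hz (hVx.valid_iff.2 ⟨f, hfx⟩)
  obtain ⟨n, hn⟩ := hyx'
  obtain ⟨d, hd, hnd⟩ := (Instance.domAt_iff hn).1 (h₃ n hn)
  refine hF' hz _ (hf ⟨d, hd⟩) fun v m hm => ?_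
  by_cases hv : v.1 = u
  · have : (f.extend ⟨d, hd⟩ v).1 = d := by simp [Mapping.extend, hv]
    rw [this]
    rw [hv] at hm
    exact hnd.same.1 (h₁ n m (hn.same.2 hm))
  · have : (f.extend ⟨d, hd⟩ v).1 = (f ⟨v.1, Finset.mem_erase.2 ⟨hv, v.2⟩⟩).1 := by
      simp [Mapping.extend, hv]
    rw [this]
    obtain ⟨m', hm'⟩ := hVx.2 v.1 (Finset.mem_erase.2 ⟨hv, v.2⟩)
    exact (hfx ⟨v.1, Finset.mem_erase.2 ⟨hv, v.2⟩⟩ m' hm').same.1 (h₂ m' m (hm'.same.2 hm))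

end Rules

end QCSP

namespace QCSP

open Classical

/-! ### Completeness of the rules -/

section Completeness

variable {k : ℕ} {I : Instance} {p z : List Symb} {x b : Fin k → List Symb}
  {X Y : (Key k → List Symb) → Prop}

/-- The conclusion of an application of one of the rules. -/
def Step (I : Instance) (X : (Key k → List Symb) → Prop) (p z : List Symb)
    (x b : Fin k → List Symb) : Prop :=
  AtomRule I p z x b ∨ ProjectionRule I X p z x b ∨ JoinRule I X p z x b ∨ FlowRule I X p z x b ∨
    EliminationRule I X p z x b

theorem Step.mono (hXY : ∀ v, X v → Y v) (h : Step I X p z x b) : Step I Y p z x b := by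
  rcases h with h | ⟨x', hx', h₁, h₂, h₃⟩ | ⟨x₁, hx₁, x₂, hx₂, h₁, h₂, h₃, h₄, h₅, h₆⟩ |
    ⟨h₁, h₂, q, hq, h₃, h₄⟩ |
    ⟨h₁, y, hy, h₂, h₃, q, hq, h₄, x', hx', h₅, h₆, h₇, b', hb', h₈, h₉⟩
  · exact .inl h
  · exact .inr (.inl ⟨x', hx', h₁, hXY _ h₂, fun hz b' hb' h => hXY _ (h₃ hz b' hb' h)⟩)
  · exact .inr (.inr (.inl ⟨x₁, hx₁, x₂, hx₂, h₁, h₂, h₃, hXY _ h₄, hXY _ h₅, fun hz => (h₆ hz).imp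
      (fun h b hb hc => hXY _ (h b hb hc)) fun h b hb hc => hXY _ (h b hb hc)⟩))
  · exact .inr (.inr (.inr (.inl ⟨h₁, h₂, q, hq, h₃, hXY _ h₄⟩)))
  · exact .inr (.inr (.inr (.inr ⟨h₁, y, hy, h₂, h₃, q, hq, h₄, x', hx', h₅, h₆, h₇, b', hb',
      hXY _ h₈, h₉⟩)))

theorem Step.excludes (h : Step I (ExcludesKey I) p z x b) : Excludes I p z x b := by
  rcases h with h | h | h | h | h
  exacts [h.excludes, h.excludes, h.excludes, h.excludes, h.excludes]

/-- What a derivable judgement excludes is in `X`. -/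
def Covered (X : (Key k → List Symb) → Prop) (J : Judgement I.formula I.struct) : Prop :=
  ∀ z x b, z <:+ I.encode → AreSuffixes I.encode x → AreSuffixes I.encode b → Lists x J.vars →
    (z = [] → ∀ f ∈ J.maps, ¬ Agrees x b f) → X (key (I.pos J.loc) z x b)

/-- With a non-empty flag nothing has to be excluded, so coverage yields the bare fact that a
judgement is derivable. -/
theorem Covered.derivable {J : Judgement I.formula I.struct} (h : Covered X J)
    (hx : AreSuffixes I.encode x) (hJ : Lists x J.vars) :
    X (key (I.pos J.loc) (I.pos J.loc) x x) :=
  h _ _ _ (Instance.pos_suffix _) hx hx hJ fun h => absurd h (Instance.pos_ne_nil _)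

variable {i j : I.formula.Index} {U V : Finset Var}

theorem atomRule_of_lists {R : ℕ} {vs : List Var} (hi : I.formula.subAt i = .atom R vs)
    (hx : Lists x vs.toFinset)
    (h : z = [] → ∀ f : Mapping I.struct vs.toFinset, f.tuple vs ∈ I.struct.rel R → ¬ Agrees x b f) :
    AtomRule I (I.pos i) z x b := by
  refine ⟨?_, ⟨i, rfl⟩, fun j => (hx.1 j).imp_right ?_, fun y _ hy => ?_, fun hz hs => ?_⟩
  · rw [Instance.pos_of_subAt hi]
    rfl
  · rintro ⟨u, hu, hj⟩
    rw [Instance.pos_of_subAt hi, atomVar_encode]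
    exact ⟨R, vs, rfl, u, List.mem_toFinset.1 hu, hj⟩
  · rw [Instance.pos_of_subAt hi, atomVar_encode] at hy
    obtain ⟨R', vs', h', u, hu, hy⟩ := hy
    cases h'
    obtain ⟨j, hj⟩ := hx.2 u (List.mem_toFinset.2 hu)
    exact ⟨j, hy.same.2 hj⟩
  · obtain ⟨f, hf, hf'⟩ := (hx.satAt_iff hi).1 hs
    exact h hz f hf hf'

theorem projectionRule_of_covered {F : Set (Mapping I.struct V)}
    {hV : V ⊆ (I.formula.subAt i).free} (hk : V.card ≤ k) (h : Covered X ⟨i, V, F, hV⟩)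
    (hUV : U ⊆ V) (hz : z <:+ I.encode) (hx : Lists x U)
    (hF : z = [] → ∀ f ∈ Mapping.restrict hUV '' F, ¬ Agrees x b f) :
    ProjectionRule I X (I.pos i) z x b := by
  obtain ⟨x', hx', hV'⟩ := exists_lists hV hk
  refine ⟨x', hx', (hx.included hV').2 hUV, h.derivable hx' hV', fun hz' b' hb' hc =>
    h z x' b' hz hx' hb' hV' fun _ f hf hf' => hF hz' _ ⟨f, hf, rfl⟩ ?_⟩
  exact (hf'.restrict hx hV' hUV).2 hc

theorem Agrees.of_compatible {x' b' : Fin k → List Symb} (hU : Lists x' U)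
    {f : Mapping I.struct U} (hf : Agrees x' b' f) (hc : Compatible x' b' x b) : Agrees x b f := by
  intro v j hj
  obtain ⟨j', hj'⟩ := hU.2 v.1 v.2
  exact (hf v j' hj').same.1 (hc j' j (hj'.same.2 hj))

theorem joinRule_of_covered {F₁ : Set (Mapping I.struct U)} {F₂ : Set (Mapping I.struct V)}
    {hU : U ⊆ (I.formula.subAt i).free} {hV : V ⊆ (I.formula.subAt i).free}
    (hk₁ : U.card ≤ k) (hk₂ : V.card ≤ k) (h₁ : Covered X ⟨i, U, F₁, hU⟩)
    (h₂ : Covered X ⟨i, V, F₂, hV⟩) (hz : z <:+ I.encode) (hx : Lists x (U ∪ V))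
    (hF : z = [] → ∀ f ∈ join F₁ F₂, ¬ Agrees x b f) : JoinRule I X (I.pos i) z x b := by
  obtain ⟨x₁, hx₁, hU'⟩ := exists_lists hU hk₁
  obtain ⟨x₂, hx₂, hV'⟩ := exists_lists hV hk₂
  refine ⟨x₁, hx₁, x₂, hx₂, (hU'.included hx).2 Finset.subset_union_left,
    (hV'.included hx).2 Finset.subset_union_right, fun j => (hx.1 j).imp_right ?_,
    h₁.derivable hx₁ hU', h₂.derivable hx₂ hV', fun hz' => ?_⟩
  · rintro ⟨u, hu, hj⟩
    rcases Finset.mem_union.1 hu with hu | hu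
    · exact .inl ((hU'.2 u hu).imp fun j' hj' => hj.same.2 hj')
    · exact .inr ((hV'.2 u hu).imp fun j' hj' => hj.same.2 hj')
  -- If neither restriction is covered, then `F₁` and `F₂` contain mappings whose values are those
  -- at `b`. They coincide on the common variables, so they can be glued to an element of the join
  -- that agrees with `b`.
  · by_contra! hn
    obtain ⟨⟨b₁, hb₁, hc₁, hX₁⟩, b₂, hb₂, hc₂, hX₂⟩ := hn
    have h₁' := mt (h₁ z x₁ b₁ hz hx₁ hb₁ hU') hX₁
    have h₂' := mt (h₂ z x₂ b₂ hz hx₂ hb₂ hV') hX₂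
    push Not at h₁' h₂'
    obtain ⟨-, f, hf, hf'⟩ := h₁'
    obtain ⟨-, g, hg, hg'⟩ := h₂'
    replace hf' := hf'.of_compatible hU' hc₁
    replace hg' := hg'.of_compatible hV' hc₂
    have hfg : ∀ v (hu : v ∈ U) (hv : v ∈ V), f ⟨v, hu⟩ = g ⟨v, hv⟩ := by
      intro v hu hv
      obtain ⟨j, hj⟩ := hx.2 v (Finset.mem_union_left _ hu)
      exact Subtype.ext ((hf' ⟨v, hu⟩ j hj).unique (hg' ⟨v, hv⟩ j hj))
    let e : Mapping I.struct (U ∪ V) := fun v => if h : v.1 ∈ U then f ⟨v.1, h⟩ else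
      g ⟨v.1, (Finset.mem_union.1 v.2).resolve_left h⟩
    have he₁ : e.restrict Finset.subset_union_left = f := by
      funext v
      simp [e, Mapping.restrict]
    have he₂ : e.restrict Finset.subset_union_right = g := by
      funext v
      by_cases h : v.1 ∈ U
      · simp [e, Mapping.restrict, h, hfg]
      · simp [e, Mapping.restrict, h]
    refine hF hz' e ⟨he₁ ▸ hf, he₂ ▸ hg⟩ fun v j hj => ?_
    by_cases h : v.1 ∈ U
    · simpa [e, h] using hf' ⟨v.1, h⟩ j hj
    · simpa [e, h] using hg' ⟨v.1, _⟩ j hj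

theorem flowRule_of_covered {F : Set (Mapping I.struct V)} {hV : V ⊆ (I.formula.subAt j).free}
    (h : Covered X ⟨j, V, F, hV⟩) (hV' : V ⊆ (I.formula.subAt i).free)
    (hij : QCFormula.IsParent i j ∨ QCFormula.IsParent j i) (hz : z <:+ I.encode)
    (hxs : AreSuffixes I.encode x) (hbs : AreSuffixes I.encode b) (hx : Lists x V)
    (hF : z = [] → ∀ f ∈ F, ¬ Agrees x b f) : FlowRule I X (I.pos i) z x b :=
  ⟨⟨i, rfl⟩, fun n => (hx.1 n).imp_right fun ⟨u, hu, hn⟩ => ⟨i, u, rfl, hn, hV' hu⟩, I.pos j,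
    Instance.pos_suffix j, hij.imp (fun h => Instance.childAt_pos.2 ⟨j, h, rfl⟩)
      fun h => Instance.childAt_pos.2 ⟨i, h, rfl⟩, h z x b hz hxs hbs hx hF⟩

theorem eliminationRule_of_covered {F : Set (Mapping I.struct V)}
    {hV : V ⊆ (I.formula.subAt j).free} (hk : V.card ≤ k) (h : Covered X ⟨j, V, F, hV⟩) {y : Var}
    (hij : QCFormula.IsParent i j) (hi : I.formula.subAt i = .all y (I.formula.subAt j))
    (hy : y ∈ V) (hz : z <:+ I.encode) (hx : Lists x (V.erase y))
    (hF : z = [] → ∀ f ∈ elimAll y F, ¬ Agrees x b f) : EliminationRule I X (I.pos i) z x b := by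
  obtain ⟨x', hx', hV'⟩ := exists_lists hV hk
  obtain ⟨s, hs, hsy⟩ : ∃ s, I.pos i = .all :: s ∧ Reads s y := by
    rw [Instance.pos_of_subAt hi]
    exact ⟨_, rfl, _, List.append_assoc _ _ _⟩
  refine ⟨⟨i, rfl⟩, s, (hs ▸ List.suffix_cons _ _ : s <:+ I.pos i).trans
    (Instance.pos_suffix i), hs, fun n hn => ?_, I.pos j, Instance.pos_suffix j,
    Instance.childAt_pos.2 ⟨j, hij, rfl⟩, x', hx', ?_, (hx.included hV').2 (Finset.erase_subset _ _),
    fun n => (hV'.1 n).imp_right ?_, ?_⟩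
  · exact absurd (hx.mem (hsy.same.1 hn)) (Finset.notMem_erase y V)
  · exact (hV'.2 y hy).imp fun n hn => hsy.same.2 hn
  · rintro ⟨u, hu, hn⟩
    by_cases huy : u = y
    · exact .inl (hsy.same.2 (huy ▸ hn))
    · exact .inr ((hx.2 u (Finset.mem_erase.2 ⟨huy, hu⟩)).imp fun m hm => hn.same.2 hm)
  · by_cases hb : z = [] ∧ Valid I x b
    · obtain ⟨hz', hb⟩ := hb
      obtain ⟨f, hf⟩ := hx.valid_iff.1 hb
      have hfF : ¬ ∀ c, f.extend c ∈ F := fun h => hF hz' f h hf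
      push Not at hfF
      obtain ⟨c, hc⟩ := hfF
      obtain ⟨b', hb', hag⟩ := hV'.exists_agrees (f.extend c)
      have hval := hV'.valid_iff.2 ⟨_, hag⟩
      have hres : (f.extend c).restrict (Finset.erase_subset y V) = f := by
        funext v
        have := (Finset.mem_erase.1 v.2).1
        simp [Mapping.extend, Mapping.restrict, this]
      refine ⟨b', hb', h z x' b' hz hx' hb' hV' fun _ g hg hg' => ?_, fun _ _ => ⟨hval.1, ?_,
        fun n hn => ?_⟩⟩
      · exact hc (hV'.agrees_unique hg' hag ▸ hg)
      · exact (hag.restrict hx hV' (Finset.erase_subset y V)).1 (hres.symm ▸ hf)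
      · exact (hval.2 n).resolve_left (hsy.same.1 hn).ne_nil
    -- No extension needs to be excluded here. The empty strings are values of no mapping on `V`,
    -- because `y ∈ V` would need a written value, so they are covered for a trivial reason.
    · refine ⟨fun _ => [], fun _ => List.nil_suffix, h z x' _ hz hx' (fun _ => List.nil_suffix) hV'
        fun _ f _ hf => ?_, fun h₁ h₂ => absurd ⟨h₁, h₂⟩ hb⟩
      obtain ⟨n, hn⟩ := hV'.2 y hy
      obtain ⟨r, hr⟩ := hf ⟨y, hy⟩ n hn
      simp [encodeNat] at hr

/-- Every relation closed under the rules contains all facts that a derivable judgement provides, by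
induction over the proof with one rule for each type of judgement. -/
theorem covered_of_derivable
    (hX : ∀ p z x b, AreSuffixes I.encode (key p z x b) → Step I X p z x b → X (key p z x b))
    {J : Judgement I.formula I.struct} (hJ : Derivable k J) : Covered X J := by
  refine hJ.induction fun P J hP h _ z x b hz hxs hbs hx hF => ?_
  refine hX _ _ _ _ (areSuffixes_key.2 ⟨Instance.pos_suffix _, hz, hxs, hbs⟩) ?_
  cases h with
  | atom i R vs hi hV => exact .inl (atomRule_of_lists hi hx hF)
  | projection i U V F hV hmem hUV hU =>
      exact .inr (.inl (projectionRule_of_covered (hP _ hmem).1.card_le (hP _ hmem).2 hUV hz hx hF))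
  | join i U₁ U₂ F₁ F₂ h₁ h₂ hmem₁ hmem₂ hU =>
      exact .inr (.inr (.inl (joinRule_of_covered (hP _ hmem₁).1.card_le (hP _ hmem₂).1.card_le
        (hP _ hmem₁).2 (hP _ hmem₂).2 hz hx hF)))
  | upwardFlow i j V F hij hj hmem hi =>
      exact .inr (.inr (.inr (.inl (flowRule_of_covered (hP _ hmem).2 hi (.inl hij) hz hxs hbs hx
        hF))))
  | forallElimination i j y V F hij hall hy hj hmem hi =>
      exact .inr (.inr (.inr (.inr (eliminationRule_of_covered (hP _ hmem).1.card_le (hP _ hmem).2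
        hij hall hy hz hx hF))))
  | downwardFlow i j V F hij hi hmem hj =>
      exact .inr (.inr (.inr (.inl (flowRule_of_covered (hP _ hmem).2 hj (.inr hij) hz hxs hbs hx
        hF))))

/-- An empty constraint excludes everything. Conversely, if every mapping is excluded at the same
node and variables, then the intersection of the responsible judgements is empty. Strings `b` that
stand for no mapping add nothing beyond derivability, so the quantifier over `b` may range over all
tuples. -/
theorem exists_isJudgementProof_iff : (∃ P : List (Judgement I.formula I.struct),
    IsJudgementProof P ∧ (∀ J ∈ P, J.vars.card ≤ k) ∧ ∃ J ∈ P, J.maps = ∅) ↔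
    ∃ p, p <:+ I.encode ∧ ∃ x : Fin k → List Symb, AreSuffixes I.encode x ∧
      ∀ b, AreSuffixes I.encode b → Excludes I p [] x b := by
  constructor
  · rintro ⟨P, hP, hk, J, hJ, hF⟩
    obtain ⟨x, hx, hV⟩ := exists_lists J.vars_subset (hk J hJ)
    refine ⟨I.pos J.loc, Instance.pos_suffix _, x, hx, fun b _ => ⟨J.loc, J.vars, rfl, hV, J.maps,
      J.vars_subset, ⟨P, hP, hk, hJ⟩, fun _ f hf => ?_⟩⟩
    rw [hF] at hf
    exact hf.elim
  · rintro ⟨p, -, x, hx, h⟩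
    obtain ⟨i, V, rfl, hV, F, hVi, hF, -⟩ := h x hx
    obtain ⟨F, ⟨P, hP, hk, hJ⟩, hF⟩ := Derivable.exists_disjoint (k := k) (hV := hVi) Set.univ
      (fun f _ => by
        obtain ⟨b, hb, hfb⟩ := hV.exists_agrees f
        obtain ⟨F, _, hF, hF'⟩ := (hV.excludes_iff rfl).1 (h b hb)
        exact ⟨F, hF, fun h => hF' rfl f h hfb⟩) ⟨F, hF⟩
    exact ⟨P, hP, hk, _, hJ, Set.eq_empty_of_forall_notMem fun f => hF f (Set.mem_univ f)⟩

end Completeness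

end QCSP

namespace QCSP

open Classical
open Sum (inl inr)

/-! ### Polynomial-time evaluation of the rules -/

section Decision

variable {k : ℕ} {κ ι : Type} [Fintype κ]

theorem PTX.eqNil {α : Type} {enc : α → List Symb} (i : ι) :
    PTX enc fun _ (_ : (κ → List Symb) → Prop) v => v i = [] :=
  (PTX.head i (· = none)).congr fun _ _ _ _ => List.head?_eq_none_iff

theorem PTX.sameVar {α : Type} {enc : α → List Symb} (i j : ι) :
    PTX enc fun _ (_ : (κ → List Symb) → Prop) v => Same varL (v i) (v j) :=
  PT.ptx₂ (R := fun _ => Same varL) pt_same_varL i j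

theorem PTX.sameNat {α : Type} {enc : α → List Symb} (i j : ι) :
    PTX enc fun _ (_ : (κ → List Symb) → Prop) v => Same numL (v i) (v j) :=
  PT.ptx₂ (R := fun _ => Same numL) pt_same_numL i j

theorem PTX.included {α : Type} {enc : α → List Symb} (x x' : Fin k → ι) :
    PTX enc fun _ (_ : (κ → List Symb) → Prop) v =>
      Included (fun j => v (x j)) fun j => v (x' j) :=
  .forallFin fun j => .or (PTX.eqNil (x j)) (.existsFin fun j' => PTX.sameVar (x j) (x' j'))

theorem PTX.compatible {α : Type} {enc : α → List Symb} (x b x' b' : Fin k → ι) :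
    PTX enc fun _ (_ : (κ → List Symb) → Prop) v =>
      Compatible (fun j => v (x j)) (fun j => v (b j)) (fun j => v (x' j)) fun j => v (b' j) :=
  .forallFin fun j => .forallFin fun j' =>
    .imp (PTX.sameVar (x j) (x' j')) (PTX.sameNat (b j) (b' j'))

theorem PTX.domAt (i j : ι) : PTX Instance.encode fun I (_ : (κ → List Symb) → Prop) v =>
    I.DomAt (v i) (v j) :=
  PT.ptx₂ (R := Instance.DomAt) Instance.pt_domAt i j

theorem PTX.childAt (i j : ι) : PTX Instance.encode fun _ (_ : (κ → List Symb) → Prop) v =>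
    ChildAt (v i) (v j) :=
  PT.ptx₂ (R := fun _ => ChildAt) Instance.pt_childAt i j

theorem PTX.nodeAt (i : ι) : PTX Instance.encode fun I (_ : (κ → List Symb) → Prop) v =>
    I.NodeAt (v i) :=
  (PT.reindex Instance.pt_nodeAt ![i]).ptx

theorem PTX.valid (x b : Fin k → ι) : PTX Instance.encode fun I (_ : (κ → List Symb) → Prop) v =>
    Valid I (fun j => v (x j)) fun j => v (b j) :=
  .and (PTX.compatible x b x b) (.forallFin fun j => .or (PTX.eqNil (x j)) (PTX.domAt (x j) (b j)))

theorem ptx_atomRule (p z : ι) (x b : Fin k → ι) :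
    PTX Instance.encode fun I (_ : (κ → List Symb) → Prop) v =>
      AtomRule I (v p) (v z) (fun j => v (x j)) fun j => v (b j) := by
  refine .and (PTX.head p (· = some .atom)) (.and (PTX.nodeAt p) (.and (.forallFin fun j =>
    .or (PTX.eqNil (x j)) ?_) (.and (.all (.imp ?_ (.existsFin fun j => ?_)))
      (.imp (PTX.eqNil z) (.not ?_)))))
  · exact PT.ptx₂ (R := fun _ => AtomVar) Instance.pt_atomVar p (x j)
  · exact PT.ptx₂ (R := fun _ => AtomVar) Instance.pt_atomVar (some p) none
  · exact PTX.sameVar none (some (x j))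
  · exact (PT.reindex Instance.pt_satAt (Sum.elim ![p] (Sum.elim x b))).ptx

theorem ptx_projectionRule (p z : ι) (x b : Fin k → ι) :
    PTX Instance.encode fun I (X : (Key k → List Symb) → Prop) v =>
      ProjectionRule I X (v p) (v z) (fun j => v (x j)) fun j => v (b j) := by
  refine .exTuple (.and ?_ (.and ?_ (.imp ?_ (.allTuple (.imp ?_ ?_)))))
  · exact PTX.included (fun j => inl (x j)) fun j => inr j
  · exact PTX.callKey (inl p) (inl p) (fun j => inr j) fun j => inr j
  · exact PTX.eqNil (inl z)
  · exact PTX.compatible (fun j => inl (inl (x j))) (fun j => inl (inl (b j)))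
      (fun j => inl (inr j)) fun j => inr j
  · exact PTX.callKey (inl (inl p)) (inl (inl z)) (fun j => inl (inr j)) fun j => inr j

theorem ptx_joinRule (p z : ι) (x b : Fin k → ι) :
    PTX Instance.encode fun I (X : (Key k → List Symb) → Prop) v =>
      JoinRule I X (v p) (v z) (fun j => v (x j)) fun j => v (b j) := by
  refine .exTuple (.exTuple (.and ?_ (.and ?_ (.and (.forallFin fun j => .or ?_ (.or
    (.existsFin fun j' => ?_) (.existsFin fun j' => ?_))) (.and ?_ (.and ?_ (.imp ?_ (.or
      (.allTuple (.imp ?_ ?_)) (.allTuple (.imp ?_ ?_))))))))))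
  · exact PTX.included (fun j => inl (inr j)) fun j => inl (inl (x j))
  · exact PTX.included (fun j => inr j) fun j => inl (inl (x j))
  · exact PTX.eqNil (inl (inl (x j)))
  · exact PTX.sameVar (inl (inl (x j))) (inl (inr j'))
  · exact PTX.sameVar (inl (inl (x j))) (inr j')
  · exact PTX.callKey (inl (inl p)) (inl (inl p)) (fun j => inl (inr j)) fun j => inl (inr j)
  · exact PTX.callKey (inl (inl p)) (inl (inl p)) (fun j => inr j) fun j => inr j
  · exact PTX.eqNil (inl (inl z))
  · exact PTX.compatible (fun j => inl (inl (inr j))) (fun j => inr j)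
      (fun j => inl (inl (inl (x j)))) fun j => inl (inl (inl (b j)))
  · exact PTX.callKey (inl (inl (inl p))) (inl (inl (inl z))) (fun j => inl (inl (inr j)))
      fun j => inr j
  · exact PTX.compatible (fun j => inl (inr j)) (fun j => inr j)
      (fun j => inl (inl (inl (x j)))) fun j => inl (inl (inl (b j)))
  · exact PTX.callKey (inl (inl (inl p))) (inl (inl (inl z))) (fun j => inl (inr j))
      fun j => inr j

theorem ptx_flowRule (p z : ι) (x b : Fin k → ι) :
    PTX Instance.encode fun I (X : (Key k → List Symb) → Prop) v =>
      FlowRule I X (v p) (v z) (fun j => v (x j)) fun j => v (b j) := by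
  refine .and (PTX.nodeAt p) (.and (.forallFin fun j => .or (PTX.eqNil (x j)) ?_)
    (.ex (.and (.or ?_ ?_) ?_)))
  · exact PT.ptx₂ (R := Instance.FreeAt) Instance.pt_freeAt p (x j)
  · exact PTX.childAt (some p) none
  · exact PTX.childAt none (some p)
  · exact PTX.callKey none (some z) (fun j => some (x j)) fun j => some (b j)

theorem ptx_eliminationRule (p z : ι) (x b : Fin k → ι) :
    PTX Instance.encode fun I (X : (Key k → List Symb) → Prop) v =>
      EliminationRule I X (v p) (v z) (fun j => v (x j)) fun j => v (b j) := by
  refine .and (PTX.nodeAt p) (.ex (.and ?_ (.and (.forallFin fun j => .not ?_) (.ex (.and ?_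
    (.exTuple (.and (.existsFin fun j => ?_) (.and ?_ (.and (.forallFin fun j => .or ?_ (.or ?_
      (.existsFin fun j' => ?_))) (.exTuple (.and ?_ (.imp ?_ (.imp ?_ (.and ?_ (.and ?_
        (.forallFin fun j => .imp ?_ ?_))))))))))))))))
  · exact PTX.eqCons .all (some p) none
  · exact PTX.sameVar none (some (x j))
  · exact PTX.childAt (some (some p)) none
  · exact PTX.sameVar (inl (some none)) (inr j)
  · exact PTX.included (fun j => inl (some (some (x j)))) fun j => inr j
  · exact PTX.eqNil (inr j)
  · exact PTX.sameVar (inl (some none)) (inr j)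
  · exact PTX.sameVar (inr j) (inl (some (some (x j'))))
  · exact PTX.callKey (inl (inl none)) (inl (inl (some (some z)))) (fun j => inl (inr j))
      fun j => inr j
  · exact PTX.eqNil (inl (inl (some (some z))))
  · exact PTX.valid (fun j => inl (inl (some (some (x j)))))
      fun j => inl (inl (some (some (b j))))
  · exact PTX.compatible (fun j => inl (inr j)) (fun j => inr j) (fun j => inl (inr j))
      fun j => inr j
  · exact PTX.compatible (fun j => inl (inl (some (some (x j)))))
      (fun j => inl (inl (some (some (b j))))) (fun j => inl (inr j)) fun j => inr j
  · exact PTX.sameVar (inl (inl (some none))) (inl (inr j))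
  · exact PTX.domAt (inl (inr j)) (inr j)

/-- Soundness of the rules makes `ExcludesKey` closed under `Step`, and completeness makes it the
least such relation on positions. -/
theorem pt_excludes : PT Instance.encode fun I (v : Key k → List Symb) => ExcludesKey I v := by
  refine PT.lfp (Φ := fun I X v => Step I X (v (inl 0)) (v (inl 1))
    (fun j => v (inr (inl j))) fun j => v (inr (inr j))) ?_ (fun I X Y h v => Step.mono h)
    (fun I v _ h => h.excludes) ?_
  · exact .or (ptx_atomRule _ _ _ _) (.or (ptx_projectionRule _ _ _ _) (.or (ptx_joinRule _ _ _ _)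
      (.or (ptx_flowRule _ _ _ _) (ptx_eliminationRule _ _ _ _))))
  · rintro I X hX v hv ⟨i, V, hi, hx, F, hV, hF, hF'⟩
    have hv' := hv
    rw [← key_eta v, areSuffixes_key] at hv'
    rw [← key_eta v, hi]
    exact covered_of_derivable (X := X) (fun p z x b hs hstep => hX (key p z x b) hs hstep) hF _ _ _
      hv'.2.1 hv'.2.2.1 hv'.2.2.2 hx hF'

theorem pt_isJudgeConsistent : PT (ι := Empty) Instance.encode fun I _ => I.IsJudgeConsistent k := by
  intro κ _
  have h : PTX Instance.encode fun I (_ : (κ → List Symb) → Prop) (_ : Empty → List Symb) =>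
      ¬ ∃ p, p <:+ I.encode ∧ ∃ z, z <:+ I.encode ∧ (z = [] ∧ ∃ x : Fin k → List Symb,
        AreSuffixes I.encode x ∧ ∀ b, AreSuffixes I.encode b → ExcludesKey I (key p z x b)) := by
    refine .not (.ex (.ex (.and (PTX.eqNil none) (.exTuple (.allTuple ?_)))))
    refine (PT.reindex pt_excludes (Sum.elim ![inl (inl (some none)), inl (inl none)]
      (Sum.elim (fun j => inl (inr j)) fun j => inr j))).ptx.congr fun I X v _ => ?_
    rw [← key_eta fun c => v (Sum.elim _ _ c)]
    rfl
  refine h.congr fun I X v _ => not_congr ?_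
  rw [exists_isJudgementProof_iff]
  constructor
  · rintro ⟨p, hp, _, -, rfl, x, hx, h⟩
    exact ⟨p, hp, x, hx, h⟩
  · rintro ⟨p, hp, x, hx, h⟩
    exact ⟨p, hp, [], List.nil_suffix, rfl, x, hx, h⟩

end Decision

end QCSP

theorem mainTheorem7 (k : ℕ) (hk : 1 ≤ k) :
    QCSP.DecidableInPolyTime QCSP.Instance.encode (QCSP.Instance.IsJudgeConsistent k) :=
  QCSP.pt_isJudgeConsistent.decidableInPolyTime
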